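/- Let $n\ge 2$ be an even integer, let $u\in C^\infty(\mathbb{R}^n)$ be real-valued, and let $g=e^{2u}|dx|^2$. Define the Q-curvature $Q_g$ of $g$ by $(-\Delta)^{n/2}u=Q_g\,e^{nu}$. Assume that the Riemannian manifold $(\mathbb{R}^n,g)$ is complete and has finite total Q-curvature, i.e. $\int_{\mathbb{R}^n}|Q_g|e^{nu}\,dx<\infty$. Let $|\mathbb{S}^n|$ denote the volume of the unit sphere of $\mathbb{R}^{n+1}$ and put $$\alpha_0=\frac{2}{(n-1)!\,|\mathbb{S}^n|}\int_{\mathbb{R}^n}Q_g e^{nu}\,dx .$$ The metric $g$ is called normal if there is a constant $C$ such that for all $x\in\mathbb{R}^n$ $$u(x)=\frac{2}{(n-1)!\,|\mathbb{S}^n|}\int_{\mathbb{R}^n}\log\frac{|y|}{|x-y|}\,Q_g(y)e^{nu(y)}\,dy+C .$$ The volume entropy of $g$ is $$\tau(g)=\limsup_{R\to\infty}\frac{\log V_g(B_R(0))}{\log|B_R(0)|},\qquad V_g(A)=\int_A e^{nu}\,dx,$$ where $B_R(0)$ is the Euclidean ball of radius $R$ centered at $0$ and $|B_R(0)|$ its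 Lebesgue measure; it is called finite if $\tau(g)<+\infty$. Then: (i) The metric $g$ is normal if and only if $\tau(g)$ is finite. (ii) If $\tau(g)$ is finite, then $\tau(g)=1-\alpha_0$. -/

import Mathlib

open MeasureTheory Filter Topology Set
open scoped ENNReal Manifold ContDiff

noncomputable section

namespace ConformalMetric

variable {n : ℕ}

/-- The length `e^{u(x)} |v|` of a tangent vector `v` at `x` for the metric `g = e^{2u}|dx|²` on
`ℝⁿ`. -/
@[reducible] def tangentENorm (u : EuclideanSpace ℝ (Fin n) → ℝ) (x : EuclideanSpace ℝ (Fin n)) :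
    ENorm (TangentSpace 𝓘(ℝ, EuclideanSpace ℝ (Fin n)) x) where
  enorm v := ENNReal.ofReal (Real.exp (u x)) * ‖(id v : EuclideanSpace ℝ (Fin n))‖ₑ

/-- The geodesic distance `d_g` of `g = e^{2u}|dx|²`: the infimum of the `g`-lengths
`∫ e^{u(γ(t))} |γ'(t)| dt` of the `C¹` curves `γ` from `x` to `y`. -/
def geodesicDist (u : EuclideanSpace ℝ (Fin n) → ℝ) (x y : EuclideanSpace ℝ (Fin n)) : ℝ≥0∞ :=
  letI : ∀ z : EuclideanSpace ℝ (Fin n), ENorm (TangentSpace 𝓘(ℝ, EuclideanSpace ℝ (Fin n)) z) :=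
    tangentENorm u
  Manifold.riemannianEDist 𝓘(ℝ, EuclideanSpace ℝ (Fin n)) x y

/-- Completeness of `(ℝⁿ, e^{2u}|dx|²)`: every `d_g`-Cauchy sequence converges with respect to
`d_g`. -/
def IsCompleteMetric (u : EuclideanSpace ℝ (Fin n) → ℝ) : Prop :=
  ∀ x : ℕ → EuclideanSpace ℝ (Fin n),
    (∀ ε : ℝ≥0∞, 0 < ε → ∃ N : ℕ, ∀ j ≥ N, ∀ k ≥ N, geodesicDist u (x j) (x k) < ε) →
      ∃ a : EuclideanSpace ℝ (Fin n), Tendsto (fun k => geodesicDist u (x k) a) atTop (𝓝 0)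

/-- The Q-curvature of `g = e^{2u}|dx|²` for `n` even: the function `Q_g` determined by
`(-Δ)^{n/2} u = Q_g e^{nu}`. -/
def qCurvature (u : EuclideanSpace ℝ (Fin n) → ℝ) (x : EuclideanSpace ℝ (Fin n)) : ℝ :=
  Real.exp (-(n * u x)) *
    ((fun f : EuclideanSpace ℝ (Fin n) → ℝ => -Laplacian.laplacian f)^[n / 2] u) x

/-- The density `Q_g e^{nu}` of the total Q-curvature with respect to Lebesgue measure. -/
def qDensity (u : EuclideanSpace ℝ (Fin n) → ℝ) (x : EuclideanSpace ℝ (Fin n)) : ℝ :=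
  qCurvature u x * Real.exp (n * u x)

/-- Finite total Q-curvature: `∫ |Q_g| e^{nu} dx < ∞`. -/
def HasFiniteTotalQCurvature (u : EuclideanSpace ℝ (Fin n) → ℝ) : Prop :=
  Integrable (qDensity u)

/-- The constant `2 / ((n-1)! |𝕊ⁿ|)`, where `|𝕊ⁿ|` is the volume of the unit sphere of `ℝⁿ⁺¹`
(used only for `n ≥ 1`). -/
def normalizingConst (n : ℕ) : ℝ :=
  2 / ((n - 1).factorial *
    (volume : Measure (EuclideanSpace ℝ (Fin (n + 1)))).toSphere.real univ)

/-- The normalized integrated Q-curvature `α₀`. -/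
def alphaZero (u : EuclideanSpace ℝ (Fin n) → ℝ) : ℝ :=
  normalizingConst n * ∫ x, qDensity u x

/-- The logarithmic potential
`𝓛(f)(x) = 2 / ((n-1)! |𝕊ⁿ|) ∫ log (|y| / |x - y|) f(y) dy`. -/
def logPotential (f : EuclideanSpace ℝ (Fin n) → ℝ) (x : EuclideanSpace ℝ (Fin n)) : ℝ :=
  normalizingConst n * ∫ y, Real.log (‖y‖ / ‖x - y‖) * f y

/-- The metric `g = e^{2u}|dx|²` is normal: `u = 𝓛(Q_g e^{nu}) + C` for some constant `C`. -/
def IsNormalMetric (u : EuclideanSpace ℝ (Fin n) → ℝ) : Prop :=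
  ∃ C : ℝ, ∀ x, u x = logPotential (qDensity u) x + C

/-- The Riemannian volume measure `V_g = e^{nu} dx`. -/
def volumeMeasure (u : EuclideanSpace ℝ (Fin n) → ℝ) : Measure (EuclideanSpace ℝ (Fin n)) :=
  volume.withDensity fun x => ENNReal.ofReal (Real.exp (n * u x))

/-- The volume entropy `τ(g) = limsup_{R → ∞} log V_g(B_R(0)) / log |B_R(0)|`, as an extended
real number. -/
def volumeEntropy (u : EuclideanSpace ℝ (Fin n) → ℝ) : EReal :=
  limsup (fun R : ℝ =>
    ((Real.log ((volumeMeasure u).real (Metric.ball 0 R)) /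
      Real.log ((volume : Measure (EuclideanSpace ℝ (Fin n))).real (Metric.ball 0 R)) : ℝ) :
        EReal)) atTop

end ConformalMetric

end

/-!
Write `n = 2m`, `f = (-Δ)^m u = Q_g e^{nu}` and `v = 𝓛(f)`, the logarithmic potential of `f`.

**The potential.** The kernel `log (|y| / |x - y|)` splits into a part that is continuous and grows
logarithmically and the singular part `log⁻ |x - y|`, up to an additive constant in `x`. Accordingly
`v = h + g`, where `h ~ -α₀ log |x|` at infinity (dominated convergence) and `g` is integrable. Since `f`
has small mass near infinity, every exponential moment `e^{p|g|} - 1` is integrable there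
(`integrableOn_exp_nearPotential`): `g` is negligible for averages over balls, and along almost every ray
through the origin. Moreover `(-Δ)^m v = f` in the sense of distributions
(`integral_logPotential_mul`), because `-log |x|` is, up to the normalizing constant, the fundamental solution
of `(-Δ)^m`.

**Normal metrics.** If `u = v + C`, then `e^u` behaves like `|x|^{-α₀}`. In a complete metric rays have
infinite length, which forces `α₀ ≤ 1` (`normalizingConst_mul_integral_le_one`), and then the volume of
`B_R` grows like `R^{n(1 - α₀)}` on the logarithmic scale (`tendsto_log_setIntegral_ball_exp_div_log`).
So the entropy is `1 - α₀`, and in particular finite.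

**Finite entropy.** Then the volume of `B_R` is bounded by a power of `R`, and since `u⁺ ≤ e^{nu}`, so is
`∫_{B_R} w⁺` for `w = u - v`, a distributional solution of `(-Δ)^m w = 0`. A Liouville theorem, proved by
Pizzetti's formula and a reproducing kernel, shows that `w` is a polynomial along every line through the origin,
with coefficients depending continuously on the direction (`exists_continuous_coeff_of_polyharmonic`).
If `w` were not constant, take its top coefficient: where it is negative, `e^u` decays fast and almost every
ray has finite length, against completeness; where it is positive, `e^{nu}` grows faster than any power
along almost every ray, against the volume bound (`eq_logPotential_add_const`). Hence `u = v + C`.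
-/

noncomputable section

set_option linter.unusedSectionVars false

namespace ConformalMetric

/-! ### The Laplacian and Green's identities -/

section

open Laplacian InnerProductSpace Module

variable {E : Type*} [NormedAddCommGroup E] [InnerProductSpace ℝ E] [FiniteDimensional ℝ E]

/-- The directional derivative of `f` in the constant direction `h`. -/
def dirDeriv (h : E) (f : E → ℝ) : E → ℝ := fun x => fderiv ℝ f x h

/-- The geometer's Laplacian `-Δ`, the operator iterated in the definition of the Q-curvature. -/
def negLaplacian (f : E → ℝ) : E → ℝ := -Δ f

lemma contDiff_dirDeriv {f : E → ℝ} (hf : ContDiff ℝ ∞ f) (h : E) :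
    ContDiff ℝ ∞ (dirDeriv h f) :=
  (hf.fderiv_right (m := ∞) (by simp)).clm_apply contDiff_const

lemma tsupport_dirDeriv_subset (h : E) (f : E → ℝ) :
    tsupport (dirDeriv h f) ⊆ tsupport f := by
  have := tsupport_fderiv_subset ℝ (f := f)
  refine subset_trans (closure_mono ?_) this
  intro x hx hx'
  exact hx (by simp [dirDeriv, hx'])

lemma hasCompactSupport_dirDeriv {f : E → ℝ} (hf : HasCompactSupport f) (h : E) :
    HasCompactSupport (dirDeriv h f) :=
  hf.of_isClosed_subset (isClosed_tsupport _) (tsupport_dirDeriv_subset h f)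

lemma laplacian_eq_sum_dirDeriv {f : E → ℝ} (hf : ContDiff ℝ 2 f) :
    Δ f = fun x => ∑ i, dirDeriv (stdOrthonormalBasis ℝ E i)
      (dirDeriv (stdOrthonormalBasis ℝ E i) f) x := by
  rw [laplacian_eq_iteratedFDeriv_stdOrthonormalBasis]
  ext x
  refine Finset.sum_congr rfl fun i _ => ?_
  rw [iteratedFDeriv_two_apply]
  have hd : DifferentiableAt ℝ (fderiv ℝ f) x :=
    (hf.fderiv_right (m := 1) (by norm_num)).differentiable one_ne_zero x
  unfold dirDeriv
  rw [fderiv_clm_apply hd (by fun_prop)]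
  simp

lemma contDiff_negLaplacian {f : E → ℝ} (hf : ContDiff ℝ ∞ f) :
    ContDiff ℝ ∞ (negLaplacian f) := by
  rw [negLaplacian, laplacian_eq_sum_dirDeriv (hf.of_le ENat.LEInfty.out)]
  exact (ContDiff.sum fun i _ => contDiff_dirDeriv (contDiff_dirDeriv hf _) _).neg

lemma tsupport_negLaplacian_subset (f : E → ℝ) :
    tsupport (negLaplacian f) ⊆ tsupport f := by
  refine closure_minimal ?_ (isClosed_tsupport _)
  intro x hx
  by_contra h
  apply hx
  have h0 : f =ᶠ[𝓝 x] fun _ => 0 := notMem_tsupport_iff_eventuallyEq.1 h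
  have := laplacian_congr_nhds h0
  simp [negLaplacian, this.eq_of_nhds]

lemma hasCompactSupport_negLaplacian {f : E → ℝ} (hf : HasCompactSupport f) :
    HasCompactSupport (negLaplacian f) :=
  hf.of_isClosed_subset (isClosed_tsupport _) (tsupport_negLaplacian_subset f)

lemma contDiff_iterate_negLaplacian {f : E → ℝ} (hf : ContDiff ℝ ∞ f) (k : ℕ) :
    ContDiff ℝ ∞ (negLaplacian^[k] f) := by
  induction k with
  | zero => exact hf
  | succ k ih => rw [Function.iterate_succ_apply']; exact contDiff_negLaplacian ih

lemma hasCompactSupport_iterate_negLaplacian {f : E → ℝ} (hf : HasCompactSupport f) (k : ℕ) :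
    HasCompactSupport (negLaplacian^[k] f) := by
  induction k with
  | zero => exact hf
  | succ k ih => rw [Function.iterate_succ_apply']; exact hasCompactSupport_negLaplacian ih

section Green

variable [MeasurableSpace E] [BorelSpace E]

lemma integrable_mul_of_hasCompactSupport {f g : E → ℝ} (hf : Continuous f) (hg : Continuous g)
    (hgs : HasCompactSupport g) : Integrable (fun x => f x * g x) :=
  (hf.mul hg).integrable_of_hasCompactSupport hgs.mul_left

lemma integral_mul_dirDeriv {f g : E → ℝ} (hf : ContDiff ℝ ∞ f) (hg : ContDiff ℝ ∞ g)
    (hgs : HasCompactSupport g) (h : E) :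
    ∫ x, f x * dirDeriv h g x = - ∫ x, dirDeriv h f x * g x := by
  apply integral_mul_fderiv_eq_neg_fderiv_mul_of_integrable
  · exact integrable_mul_of_hasCompactSupport (contDiff_dirDeriv hf h).continuous hg.continuous hgs
  · exact integrable_mul_of_hasCompactSupport hf.continuous (contDiff_dirDeriv hg h).continuous
      (hasCompactSupport_dirDeriv hgs h)
  · exact integrable_mul_of_hasCompactSupport hf.continuous hg.continuous hgs
  · exact fun x _ => hf.differentiable (by simp) x
  · exact fun x _ => hg.differentiable (by simp) x

/-- Green's second identity on the whole space. -/
lemma integral_mul_negLaplacian {f g : E → ℝ} (hf : ContDiff ℝ ∞ f) (hg : ContDiff ℝ ∞ g)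
    (hgs : HasCompactSupport g) :
    ∫ x, f x * negLaplacian g x = ∫ x, negLaplacian f x * g x := by
  have h2 : ∀ {φ : E → ℝ}, ContDiff ℝ ∞ φ → ContDiff ℝ 2 φ := fun h =>
    h.of_le ENat.LEInfty.out
  simp only [negLaplacian, laplacian_eq_sum_dirDeriv (h2 hf), laplacian_eq_sum_dirDeriv (h2 hg),
    Pi.neg_apply, mul_neg, neg_mul, integral_neg, Finset.mul_sum, Finset.sum_mul]
  rw [integral_finsetSum, integral_finsetSum]
  · congr 1
    refine Finset.sum_congr rfl fun i _ => ?_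
    rw [integral_mul_dirDeriv hf (contDiff_dirDeriv hg _) (hasCompactSupport_dirDeriv hgs _),
      integral_mul_dirDeriv (contDiff_dirDeriv hf _) hg hgs, neg_neg]
  · exact fun i _ => integrable_mul_of_hasCompactSupport
      (contDiff_dirDeriv (contDiff_dirDeriv hf _) _).continuous hg.continuous hgs
  · exact fun i _ => integrable_mul_of_hasCompactSupport hf.continuous
      (contDiff_dirDeriv (contDiff_dirDeriv hg _) _).continuous
      (hasCompactSupport_dirDeriv (hasCompactSupport_dirDeriv hgs _) _)

lemma integral_mul_iterate_negLaplacian {f g : E → ℝ} (hf : ContDiff ℝ ∞ f)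
    (hg : ContDiff ℝ ∞ g) (hgs : HasCompactSupport g) (k : ℕ) :
    ∫ x, f x * negLaplacian^[k] g x = ∫ x, negLaplacian^[k] f x * g x := by
  induction k generalizing f with
  | zero => rfl
  | succ k ih =>
    rw [Function.iterate_succ_apply', integral_mul_negLaplacian hf
      (contDiff_iterate_negLaplacian hg k) (hasCompactSupport_iterate_negLaplacian hgs k),
      ih (contDiff_negLaplacian hf), Function.iterate_succ_apply]

end Green

/-- The Laplacian of a radial function, written as a function of `|x|²`. -/
lemma laplacian_comp_norm_sq {G G' G'' : ℝ → ℝ} {x : E}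
    (hG : ContDiff ℝ 2 fun y : E => G (‖y‖ ^ 2))
    (h1 : ∀ y : E, HasDerivAt G (G' (‖y‖ ^ 2)) (‖y‖ ^ 2))
    (h2 : HasDerivAt G' (G'' (‖x‖ ^ 2)) (‖x‖ ^ 2)) :
    Δ (fun y : E => G (‖y‖ ^ 2)) x =
      2 * finrank ℝ E * G' (‖x‖ ^ 2) + 4 * ‖x‖ ^ 2 * G'' (‖x‖ ^ 2) := by
  rw [laplacian_eq_sum_dirDeriv hG]
  have hn : ∀ y : E, HasFDerivAt (fun y : E => ‖y‖ ^ 2) (2 • innerSL ℝ y) y := fun y =>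
    (hasStrictFDerivAt_norm_sq y).hasFDerivAt
  have e1 : ∀ h : E, dirDeriv h (fun y : E => G (‖y‖ ^ 2)) =
      fun y => G' (‖y‖ ^ 2) * (2 * inner ℝ y h) := by
    intro h
    ext y
    have := (h1 y).comp_hasFDerivAt y (hn y)
    rw [dirDeriv]
    erw [this.fderiv]
    simp
  have e2 : ∀ h : E, dirDeriv h (dirDeriv h (fun y : E => G (‖y‖ ^ 2))) x =
      G'' (‖x‖ ^ 2) * (4 * (inner ℝ x h) ^ 2) + G' (‖x‖ ^ 2) * (2 * inner ℝ h h) := by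
    intro h
    rw [e1 h]
    have a1 := h2.comp_hasFDerivAt x (hn x)
    have a2 : HasFDerivAt (fun y : E => 2 * inner ℝ y h) ((2 : ℝ) • innerSL ℝ h) x := by
      have : (fun y : E => 2 * inner ℝ y h) = fun y => ((2 : ℝ) • innerSL ℝ h) y := by
        ext y; simp [real_inner_comm]
      rw [this]
      exact ContinuousLinearMap.hasFDerivAt _
    have := a1.mul a2
    rw [dirDeriv]
    erw [this.fderiv]
    simp
    ring
  simp only [e2, Finset.sum_add_distrib, ← Finset.mul_sum]
  have : ∑ i, (inner ℝ x (stdOrthonormalBasis ℝ E i)) ^ 2 = ‖x‖ ^ 2 := by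
    rw [← (stdOrthonormalBasis ℝ E).sum_sq_norm_inner_left x]
    simp
  rw [this]
  simp
  ring

end

/-! ### The fundamental solution of `(-Δ)^m` in dimension `2m` -/

section

open Laplacian InnerProductSpace Module

variable {E : Type*} [NormedAddCommGroup E] [InnerProductSpace ℝ E] [FiniteDimensional ℝ E]

/-- The chain of radial profiles `-½ log s`, `½ s⁻¹`, `½ s⁻²`, `½ 2! s⁻³`, …, each the negative of
the derivative of the preceding one. At `s = |x|²` they run from `-log |x|` to the Newtonian
kernel. -/
def rieszProfile : ℕ → ℝ → ℝ
  | 0, s => -(1 / 2) * Real.log s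
  | k + 1, s => (1 / 2) * k.factorial * (s ^ (k + 1))⁻¹

lemma hasDerivAt_rieszProfile (k : ℕ) {s : ℝ} (hs : s ≠ 0) :
    HasDerivAt (rieszProfile k) (-rieszProfile (k + 1) s) s := by
  cases k with
  | zero =>
    have := (Real.hasDerivAt_log hs).const_mul (-(1 / 2))
    convert! this using 1
    simp [rieszProfile]
  | succ k =>
    have := ((hasDerivAt_pow (k + 1) s).inv (pow_ne_zero _ hs)).const_mul
      ((1 / 2) * (k.factorial : ℝ))
    convert! this using 1
    simp only [rieszProfile, Nat.factorial_succ]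
    push_cast
    field_simp
    ring

lemma mul_rieszProfile (k : ℕ) {s : ℝ} (hs : s ≠ 0) :
    s * rieszProfile (k + 2) s = (k + 1) * rieszProfile (k + 1) s := by
  simp only [rieszProfile, Nat.factorial_succ]
  push_cast
  field_simp
  ring

lemma contDiff_rieszProfile (k : ℕ) {ε : ℝ} (hε : 0 < ε) :
    ContDiff ℝ ∞ fun x : E => rieszProfile k (‖x‖ ^ 2 + ε) := by
  have h : ContDiff ℝ ∞ fun x : E => ‖x‖ ^ 2 + ε := (contDiff_norm_sq ℝ).add contDiff_const
  have h0 : ∀ x : E, ‖x‖ ^ 2 + ε ≠ 0 := fun x => by positivity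
  cases k with
  | zero => exact contDiff_const.mul (h.log h0)
  | succ k => exact contDiff_const.mul ((h.pow _).inv fun x => pow_ne_zero _ (h0 x))

/-- In dimension `2m`, `-Δ` moves one step along the chain of profiles, regularised by `s = |x|² + ε`;
for `k = m - 1` only the `ε`-term survives, and it becomes a point mass as `ε → 0`. -/
lemma negLaplacian_rieszProfile {m : ℕ} (hd : finrank ℝ E = 2 * m) (k : ℕ) {ε : ℝ} (hε : 0 < ε)
    (x : E) :
    negLaplacian (fun x : E => rieszProfile k (‖x‖ ^ 2 + ε)) x =
      4 * (m - 1 - k) * rieszProfile (k + 1) (‖x‖ ^ 2 + ε) +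
        4 * ε * rieszProfile (k + 2) (‖x‖ ^ 2 + ε) := by
  have h0 : ∀ x : E, ‖x‖ ^ 2 + ε ≠ 0 := fun x => by positivity
  have key := laplacian_comp_norm_sq (E := E) (x := x)
    (G := fun r => rieszProfile k (r + ε)) (G' := fun r => -rieszProfile (k + 1) (r + ε))
    (G'' := fun r => rieszProfile (k + 2) (r + ε))
    ((contDiff_rieszProfile k hε).of_le ENat.LEInfty.out)
    (fun y => by
      simpa using (hasDerivAt_rieszProfile k (h0 y)).comp_add_const (‖y‖ ^ 2) ε)
    (by simpa using ((hasDerivAt_rieszProfile (k + 1) (h0 x)).comp_add_const (‖x‖ ^ 2) ε).fun_neg)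
  have hm := mul_rieszProfile k (h0 x)
  rw [negLaplacian, Pi.neg_apply, key, hd]
  push_cast
  linear_combination -4 * hm

variable [MeasurableSpace E] [BorelSpace E]

lemma locallyIntegrable_fun_norm {φ : ℝ → ℝ} {ψ : ℝ → ℝ} (hψ : Continuous ψ)
    (h : ∀ r > 0, r ^ (finrank ℝ E - 1) * φ r = ψ r) (hE : 0 < finrank ℝ E) :
    LocallyIntegrable fun x : E => φ ‖x‖ := by
  have : Nontrivial E := finrank_pos_iff.1 hE
  intro x
  refine ⟨Metric.ball 0 (‖x‖ + 1), Metric.isOpen_ball.mem_nhds (by simp), ?_⟩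
  rw [integrableOn_fun_norm_addHaar]
  refine IntegrableOn.congr_fun (f := ψ) ?_ (fun r hr => ?_) measurableSet_Ioo
  · exact (hψ.continuousOn.integrableOn_Icc).mono_set Ioo_subset_Icc_self
  · rw [← h r hr.1, smul_eq_mul]

lemma locallyIntegrable_log_norm (h2 : 2 ≤ finrank ℝ E) :
    LocallyIntegrable fun x : E => Real.log ‖x‖ := by
  refine locallyIntegrable_fun_norm (ψ := fun r => r ^ (finrank ℝ E - 2) * (r * Real.log r)) ?_ ?_
    (by omega)
  · exact (continuous_pow _).mul Real.continuous_mul_log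
  · intro r hr
    obtain ⟨j, hj⟩ := Nat.exists_eq_add_of_le h2
    rw [hj, show 2 + j - 1 = j + 1 by omega, show 2 + j - 2 = j by omega, pow_succ]
    ring

lemma locallyIntegrable_norm_pow_inv {k : ℕ} (hk : k < finrank ℝ E) :
    LocallyIntegrable fun x : E => (‖x‖ ^ k)⁻¹ := by
  refine locallyIntegrable_fun_norm (φ := fun r => (r ^ k)⁻¹)
    (ψ := fun r => r ^ (finrank ℝ E - 1 - k)) (continuous_pow _) ?_ (by omega)
  intro r hr
  have : finrank ℝ E - 1 = (finrank ℝ E - 1 - k) + k := by omega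
  nth_rewrite 1 [this]
  rw [pow_add]
  field_simp

lemma locallyIntegrable_rieszProfile {m : ℕ} (hd : finrank ℝ E = 2 * m) {k : ℕ} (hk : k < m) :
    LocallyIntegrable fun x : E => rieszProfile k (‖x‖ ^ 2) := by
  cases k with
  | zero =>
    have := (locallyIntegrable_log_norm (E := E) (by omega)).smul (-1 : ℝ)
    refine this.congr (Eventually.of_forall fun x => ?_)
    simp [rieszProfile]
  | succ k =>
    have := (locallyIntegrable_norm_pow_inv (E := E) (k := 2 * (k + 1)) (by omega)).smul
      ((1 / 2) * (k.factorial : ℝ))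
    refine this.congr (Eventually.of_forall fun x => ?_)
    simp [rieszProfile, pow_mul]

lemma rieszProfile_succ_nonneg (k : ℕ) {s : ℝ} (hs : 0 ≤ s) : 0 ≤ rieszProfile (k + 1) s := by
  unfold rieszProfile; positivity

lemma rieszProfile_succ_anti (k : ℕ) {s t : ℝ} (hs : 0 < s) (hst : s ≤ t) :
    rieszProfile (k + 1) t ≤ rieszProfile (k + 1) s := by
  simp only [rieszProfile]
  have : (t ^ (k + 1))⁻¹ ≤ (s ^ (k + 1))⁻¹ := by gcongr
  gcongr

lemma ae_ne_zero (hE : 0 < finrank ℝ E) : ∀ᵐ x : E, x ≠ 0 := by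
  have : Nontrivial E := finrank_pos_iff.1 hE
  simp [ae_iff]

lemma tendsto_rieszProfile (k : ℕ) {x : E} (hx : x ≠ 0) :
    Tendsto (fun ε : ℝ => rieszProfile k (‖x‖ ^ 2 + ε)) (𝓝[>] 0)
      (𝓝 (rieszProfile k (‖x‖ ^ 2))) := by
  have h0 : ‖x‖ ^ 2 ≠ 0 := by simpa using hx
  have hc := (hasDerivAt_rieszProfile k h0).continuousAt
  have : Tendsto (fun ε : ℝ => ‖x‖ ^ 2 + ε) (𝓝[>] 0) (𝓝 (‖x‖ ^ 2)) := by
    have : Tendsto (fun ε : ℝ => ‖x‖ ^ 2 + ε) (𝓝 0) (𝓝 (‖x‖ ^ 2 + 0)) :=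
      (continuous_const.add continuous_id).tendsto 0
    rw [add_zero] at this
    exact this.mono_left nhdsWithin_le_nhds
  exact hc.tendsto.comp this

lemma tendsto_integral_rieszProfile {m : ℕ} (hd : finrank ℝ E = 2 * m) {k : ℕ} (hk : k < m)
    {ψ : E → ℝ} (hψ : Continuous ψ) (hψs : HasCompactSupport ψ) :
    Tendsto (fun ε : ℝ => ∫ x, rieszProfile k (‖x‖ ^ 2 + ε) * ψ x) (𝓝[>] 0)
      (𝓝 (∫ x, rieszProfile k (‖x‖ ^ 2) * ψ x)) := by
  have hloc := locallyIntegrable_rieszProfile hd hk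
  have hone : Continuous fun x : E => rieszProfile k (‖x‖ ^ 2 + 1) :=
    (contDiff_rieszProfile k one_pos).continuous
  have hdom : LocallyIntegrable
      fun x : E => |rieszProfile k (‖x‖ ^ 2)| + |rieszProfile k (‖x‖ ^ 2 + 1)| :=
    LocallyIntegrable.add (fun x => (hloc x).norm) (hone.abs.locallyIntegrable)
  refine tendsto_integral_filter_of_dominated_convergence
    (fun x => (|rieszProfile k (‖x‖ ^ 2)| + |rieszProfile k (‖x‖ ^ 2 + 1)|) * |ψ x|) ?_ ?_ ?_ ?_
  · filter_upwards [self_mem_nhdsWithin] with ε hε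
    exact ((contDiff_rieszProfile k hε).continuous.mul hψ).aestronglyMeasurable
  · filter_upwards [Ioo_mem_nhdsGT one_pos] with ε hε
    filter_upwards [ae_ne_zero (E := E) (by omega)] with x hx
    have hpos : 0 < ‖x‖ ^ 2 := by positivity
    rw [norm_mul, Real.norm_eq_abs, Real.norm_eq_abs]
    refine mul_le_mul_of_nonneg_right ?_ (abs_nonneg _)
    -- the profiles are monotone, so the value lies between those at `ε = 0` and `ε = 1`
    cases k with
    | zero =>
      have h1 : Real.log (‖x‖ ^ 2) ≤ Real.log (‖x‖ ^ 2 + ε) :=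
        Real.log_le_log hpos (by linarith [hε.1])
      have h2 : Real.log (‖x‖ ^ 2 + ε) ≤ Real.log (‖x‖ ^ 2 + 1) :=
        Real.log_le_log (by linarith [hε.1]) (by linarith [hε.2])
      simp only [rieszProfile, abs_mul, ← mul_add]
      gcongr
      rw [abs_le]
      constructor
      · have := neg_abs_le (Real.log (‖x‖ ^ 2)); have := abs_nonneg (Real.log (‖x‖ ^ 2 + 1))
        linarith
      · have := le_abs_self (Real.log (‖x‖ ^ 2 + 1)); have := abs_nonneg (Real.log (‖x‖ ^ 2))
        linarith
    | succ k =>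
      rw [abs_of_nonneg (rieszProfile_succ_nonneg k (by linarith [hε.1])),
        abs_of_nonneg (rieszProfile_succ_nonneg k hpos.le)]
      have := rieszProfile_succ_anti k hpos (by linarith [hε.1] : ‖x‖ ^ 2 ≤ ‖x‖ ^ 2 + ε)
      linarith [abs_nonneg (rieszProfile (k + 1) (‖x‖ ^ 2 + 1))]
  · have := hdom.integrable_smul_right_of_hasCompactSupport hψ.abs hψs.abs
    simpa using this
  · filter_upwards [ae_ne_zero (E := E) (by omega)] with x hx
    exact (tendsto_rieszProfile k hx).mul_const _

lemma tendsto_integral_eps_mul_rieszProfile {m : ℕ} (hd : finrank ℝ E = 2 * m) {k : ℕ}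
    (hk : k + 1 < m) {ψ : E → ℝ} (hψ : Continuous ψ) (hψs : HasCompactSupport ψ) :
    Tendsto (fun ε : ℝ => ∫ x, ε * rieszProfile (k + 2) (‖x‖ ^ 2 + ε) * ψ x) (𝓝[>] 0) (𝓝 0) := by
  have hloc := (locallyIntegrable_rieszProfile hd hk).smul (k + 1 : ℝ)
  have h0 : (0 : ℝ) = ∫ _ : E, (0 : ℝ) := by simp
  nth_rewrite 3 [h0]
  refine tendsto_integral_filter_of_dominated_convergence
    (fun x => (k + 1) * rieszProfile (k + 1) (‖x‖ ^ 2) * |ψ x|) ?_ ?_ ?_ ?_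
  · filter_upwards [self_mem_nhdsWithin] with ε hε
    exact ((continuous_const.mul (contDiff_rieszProfile (k + 2) hε).continuous).mul
      hψ).aestronglyMeasurable
  · filter_upwards [self_mem_nhdsWithin] with ε (hε : 0 < ε)
    filter_upwards [ae_ne_zero (E := E) (by omega)] with x hx
    have hpos : 0 < ‖x‖ ^ 2 := by positivity
    rw [norm_mul, Real.norm_eq_abs, Real.norm_eq_abs]
    refine mul_le_mul_of_nonneg_right ?_ (abs_nonneg _)
    have h1 := rieszProfile_succ_nonneg (k + 1) (by linarith : 0 ≤ ‖x‖ ^ 2 + ε)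
    rw [abs_of_nonneg (by positivity)]
    calc ε * rieszProfile (k + 2) (‖x‖ ^ 2 + ε)
        ≤ (‖x‖ ^ 2 + ε) * rieszProfile (k + 2) (‖x‖ ^ 2 + ε) :=
          mul_le_mul_of_nonneg_right (by linarith) h1
      _ = (k + 1) * rieszProfile (k + 1) (‖x‖ ^ 2 + ε) := mul_rieszProfile k (by positivity)
      _ ≤ (k + 1) * rieszProfile (k + 1) (‖x‖ ^ 2) := by
          gcongr; exact rieszProfile_succ_anti k hpos (by linarith)
  · have := hloc.integrable_smul_right_of_hasCompactSupport hψ.abs hψs.abs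
    simpa using this
  · filter_upwards [ae_ne_zero (E := E) (by omega)] with x hx
    have h1 := (tendsto_rieszProfile (k + 2) hx)
    have h2 : Tendsto (fun ε : ℝ => ε) (𝓝[>] 0) (𝓝 0) := nhdsWithin_le_nhds
    simpa using (h2.mul h1).mul_const (ψ x)

/-- The mass of the last regularised kernel: `∫ (|x|² + 1)^{-(m+1)} dx = |B_1|` in dimension `2m`.
The radial integrand `r^{2m-1} (r² + 1)^{-(m+1)}` is the derivative of
`(r² / (r² + 1))^m / (2m)`. -/
lemma integral_norm_sq_add_one_inv {m : ℕ} (hm : 0 < m) (hd : finrank ℝ E = 2 * m) :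
    Integrable (fun x : E => ((‖x‖ ^ 2 + 1) ^ (m + 1))⁻¹) ∧
    ∫ x : E, ((‖x‖ ^ 2 + 1) ^ (m + 1))⁻¹ = (volume : Measure E).real (Metric.ball 0 1) := by
  have : Nontrivial E := (finrank_pos_iff (R := ℝ)).1 (by omega)
  have hder : ∀ r : ℝ, HasDerivAt (fun r : ℝ => (1 / (2 * m)) * (r ^ 2 * (r ^ 2 + 1)⁻¹) ^ m)
      (r ^ (2 * m - 1) * ((r ^ 2 + 1) ^ (m + 1))⁻¹) r := by
    intro r
    have hr : r ^ 2 + 1 ≠ 0 := by positivity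
    have h1 : HasDerivAt (fun r : ℝ => r ^ 2 * (r ^ 2 + 1)⁻¹) (2 * r * ((r ^ 2 + 1) ^ 2)⁻¹) r := by
      have a := hasDerivAt_pow 2 r
      have := a.mul ((a.add_const 1).inv hr)
      convert! this using 1
      push_cast
      simp only [Pi.inv_apply]
      field_simp
      ring
    have h2 := (h1.pow m).const_mul (1 / (2 * (m : ℝ)))
    convert! h2 using 1
    obtain ⟨j, rfl⟩ := Nat.exists_eq_succ_of_ne_zero hm.ne'
    have hj : ((j.succ : ℕ) : ℝ) ≠ 0 := by positivity
    simp only [Nat.succ_eq_add_one] at hj ⊢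
    rw [show 2 * (j + 1) - 1 = 2 * j + 1 by omega, Nat.add_sub_cancel, mul_pow, inv_pow]
    field_simp
    ring
  have hlim : Tendsto (fun r : ℝ => (1 / (2 * (m : ℝ))) * (r ^ 2 * (r ^ 2 + 1)⁻¹) ^ m) atTop
      (𝓝 (1 / (2 * (m : ℝ)))) := by
    have h1 : Tendsto (fun r : ℝ => r ^ 2 * (r ^ 2 + 1)⁻¹) atTop (𝓝 1) := by
      have h2 : Tendsto (fun r : ℝ => 1 - (r ^ 2 + 1)⁻¹) atTop (𝓝 (1 - 0)) := by
        refine tendsto_const_nhds.sub (tendsto_inv_atTop_zero.comp ?_)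
        exact tendsto_atTop_add_const_right _ _ (tendsto_pow_atTop two_ne_zero)
      rw [sub_zero] at h2
      refine h2.congr fun r => ?_
      have hr : r ^ 2 + 1 ≠ 0 := by positivity
      field_simp
      ring
    simpa using (h1.pow m).const_mul (1 / (2 * (m : ℝ)))
  have hnn : ∀ r ∈ Ioi (0 : ℝ), 0 ≤ r ^ (2 * m - 1) * ((r ^ 2 + 1) ^ (m + 1))⁻¹ := by
    intro r hr
    have : (0 : ℝ) < r := hr
    positivity
  have hint := integrableOn_Ioi_deriv_of_nonneg' (fun r _ => hder r) hnn hlim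
  have hval := integral_Ioi_of_hasDerivAt_of_nonneg' (fun r _ => hder r) hnn hlim
  constructor
  · rw [integrable_fun_norm_addHaar (μ := (volume : Measure E))
      (f := fun r : ℝ => ((r ^ 2 + 1) ^ (m + 1))⁻¹), hd]
    exact hint
  · rw [integral_fun_norm_addHaar (μ := (volume : Measure E))
      (fun r : ℝ => ((r ^ 2 + 1) ^ (m + 1))⁻¹), hd]
    simp only [smul_eq_mul, hval]
    have : (m : ℝ) ≠ 0 := by positivity
    simp only [nsmul_eq_mul]
    rw [zero_pow two_ne_zero, zero_mul, zero_pow hm.ne']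
    push_cast
    field_simp
    simp

/-- The kernels `ε (|x|² + ε)^{-(m+1)}` form an approximate identity of mass `|B_1|`. -/
lemma tendsto_integral_eps_mul_rieszProfile_top {m : ℕ} (hm : 0 < m) (hd : finrank ℝ E = 2 * m)
    {ψ : E → ℝ} (hψ : Continuous ψ) (hψs : HasCompactSupport ψ) :
    Tendsto (fun ε : ℝ => ∫ x, ε * rieszProfile (m + 1) (‖x‖ ^ 2 + ε) * ψ x) (𝓝[>] 0)
      (𝓝 ((1 / 2) * m.factorial * (volume : Measure E).real (Metric.ball 0 1) * ψ 0)) := by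
  obtain ⟨hint, hval⟩ := integral_norm_sq_add_one_inv (E := E) hm hd
  obtain ⟨C, hC⟩ := hψs.exists_bound_of_continuous hψ
  have key : Tendsto
      (fun ε : ℝ => ∫ x : E, ((1 / 2) * m.factorial * ((‖x‖ ^ 2 + 1) ^ (m + 1))⁻¹) * ψ (√ε • x))
      (𝓝[>] 0) (𝓝 (∫ x : E, ((1 / 2) * m.factorial * ((‖x‖ ^ 2 + 1) ^ (m + 1))⁻¹) * ψ 0)) := by
    refine tendsto_integral_filter_of_dominated_convergence
      (fun x => ((1 / 2) * m.factorial * ((‖x‖ ^ 2 + 1) ^ (m + 1))⁻¹) * C) ?_ ?_ ?_ ?_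
    · refine Eventually.of_forall fun ε => Continuous.aestronglyMeasurable ?_
      have : Continuous fun x : E => ((‖x‖ ^ 2 + 1) ^ (m + 1))⁻¹ :=
        Continuous.inv₀ (by fun_prop) fun x => by positivity
      exact (continuous_const.mul this).mul (hψ.comp (continuous_const_smul _))
    · refine Eventually.of_forall fun ε => Eventually.of_forall fun x => ?_
      rw [norm_mul, Real.norm_of_nonneg (by positivity)]
      gcongr
      exact hC _
    · exact (hint.const_mul _).mul_const _
    · refine Eventually.of_forall fun x => Tendsto.const_mul _ ?_
      have h1 : Tendsto (fun ε : ℝ => √ε • x) (𝓝 0) (𝓝 (√0 • x)) :=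
        (Real.continuous_sqrt.smul continuous_const).tendsto 0
      rw [Real.sqrt_zero, zero_smul] at h1
      exact (hψ.tendsto 0).comp (h1.mono_left nhdsWithin_le_nhds)
  rw [integral_mul_const, integral_const_mul, hval] at key
  refine key.congr' ?_
  filter_upwards [self_mem_nhdsWithin] with ε (hε : 0 < ε)
  have hs : 0 < √ε := Real.sqrt_pos.2 hε
  have hsq : √ε ^ 2 = ε := Real.sq_sqrt hε.le
  have := Measure.integral_comp_smul (volume : Measure E)
    (fun x => ε * rieszProfile (m + 1) (‖x‖ ^ 2 + ε) * ψ x) (√ε)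
  rw [hd, pow_mul, hsq, abs_of_pos (by positivity), smul_eq_mul] at this
  rw [← mul_right_inj' (inv_ne_zero (pow_ne_zero m hε.ne')), ← this, ← integral_const_mul]
  congr 1
  ext x
  rw [norm_smul, mul_pow, Real.norm_of_nonneg hs.le, hsq]
  have h1 : ‖x‖ ^ 2 + 1 ≠ 0 := by positivity
  simp only [rieszProfile]
  rw [show ε * ‖x‖ ^ 2 + ε = ε * (‖x‖ ^ 2 + 1) by ring, mul_pow]
  field_simp
  ring

lemma tendsto_integral_rieszProfile_negLaplacian {m : ℕ} (hd : finrank ℝ E = 2 * m)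
    {k : ℕ} (hk : k < m) {ψ : E → ℝ} (hψ : ContDiff ℝ ∞ ψ) (hψs : HasCompactSupport ψ) :
    Tendsto (fun ε : ℝ => 4 * (m - 1 - k) * (∫ x, rieszProfile (k + 1) (‖x‖ ^ 2 + ε) * ψ x) +
        4 * ∫ x, ε * rieszProfile (k + 2) (‖x‖ ^ 2 + ε) * ψ x) (𝓝[>] 0)
      (𝓝 (∫ x, rieszProfile k (‖x‖ ^ 2) * negLaplacian ψ x)) := by
  refine (tendsto_integral_rieszProfile hd hk (contDiff_negLaplacian hψ).continuous
    (hasCompactSupport_negLaplacian hψs)).congr' ?_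
  filter_upwards [self_mem_nhdsWithin] with ε (hε : 0 < ε)
  rw [integral_mul_negLaplacian (contDiff_rieszProfile k hε) hψ hψs, ← integral_const_mul,
    ← integral_const_mul, ← integral_add]
  · congr 1
    ext x
    rw [negLaplacian_rieszProfile hd k hε]
    ring
  · exact (integrable_mul_of_hasCompactSupport (contDiff_rieszProfile (k + 1) hε).continuous
      hψ.continuous hψs).const_mul _
  · refine Integrable.const_mul ?_ _
    exact integrable_mul_of_hasCompactSupport
      (continuous_const.mul (contDiff_rieszProfile (k + 2) hε).continuous) hψ.continuous hψs

lemma integral_rieszProfile_negLaplacian {m : ℕ} (hd : finrank ℝ E = 2 * m)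
    {k : ℕ} (hk : k + 1 < m) {ψ : E → ℝ} (hψ : ContDiff ℝ ∞ ψ) (hψs : HasCompactSupport ψ) :
    ∫ x, rieszProfile k (‖x‖ ^ 2) * negLaplacian ψ x =
      4 * (m - 1 - k) * ∫ x, rieszProfile (k + 1) (‖x‖ ^ 2) * ψ x := by
  have h1 := tendsto_integral_rieszProfile_negLaplacian hd (by omega : k < m) hψ hψs
  have h2 := ((tendsto_integral_rieszProfile hd hk hψ.continuous hψs).const_mul
    (4 * (m - 1 - k) : ℝ)).add
    ((tendsto_integral_eps_mul_rieszProfile hd hk hψ.continuous hψs).const_mul 4)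
  rw [mul_zero, add_zero] at h2
  exact tendsto_nhds_unique h1 h2

lemma integral_rieszProfile_negLaplacian_top {m : ℕ} (hm : 0 < m) (hd : finrank ℝ E = 2 * m)
    {ψ : E → ℝ} (hψ : ContDiff ℝ ∞ ψ) (hψs : HasCompactSupport ψ) :
    ∫ x, rieszProfile (m - 1) (‖x‖ ^ 2) * negLaplacian ψ x =
      2 * m.factorial * (volume : Measure E).real (Metric.ball 0 1) * ψ 0 := by
  obtain ⟨j, rfl⟩ : ∃ j, m = j + 1 := ⟨m - 1, by omega⟩
  have h1 := tendsto_integral_rieszProfile_negLaplacian hd (by omega : j < j + 1) hψ hψs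
  have h2 := (tendsto_integral_eps_mul_rieszProfile_top hm hd hψ.continuous hψs).const_mul 4
  have hc : (((j + 1 : ℕ) : ℝ) - 1 - j) = 0 := by push_cast; ring
  simp only [hc, mul_zero, zero_mul, zero_add] at h1
  rw [Nat.add_sub_cancel, tendsto_nhds_unique h1 h2]
  ring

/-- `-log |x|` is, up to an explicit constant, the fundamental solution of `(-Δ)^m` in dimension
`2m`. -/
lemma integral_log_iterate_negLaplacian {m : ℕ} (hm : 0 < m) (hd : finrank ℝ E = 2 * m)
    {ψ : E → ℝ} (hψ : ContDiff ℝ ∞ ψ) (hψs : HasCompactSupport ψ) :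
    ∫ x, -Real.log ‖x‖ * negLaplacian^[m] ψ x =
      4 ^ (m - 1) * (m - 1).factorial *
        (2 * m.factorial * (volume : Measure E).real (Metric.ball 0 1)) * ψ 0 := by
  have iter : ∀ j, j < m → ∀ φ : E → ℝ, ContDiff ℝ ∞ φ → HasCompactSupport φ →
      ∫ x, rieszProfile 0 (‖x‖ ^ 2) * negLaplacian^[j] φ x =
        4 ^ j * (m - 1).descFactorial j * ∫ x, rieszProfile j (‖x‖ ^ 2) * φ x := by
    intro j
    induction j with
    | zero => intro _ φ _ _; simp
    | succ j ih =>
      intro hj φ hφ hφs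
      rw [Function.iterate_succ_apply, ih (by omega) _ (contDiff_negLaplacian hφ)
        (hasCompactSupport_negLaplacian hφs), integral_rieszProfile_negLaplacian hd hj hφ hφs,
        Nat.descFactorial_succ, Nat.cast_mul, Nat.cast_sub (by omega), Nat.cast_sub (by omega)]
      push_cast
      ring
  have h1 := iter (m - 1) (by omega) _ (contDiff_negLaplacian hψ)
    (hasCompactSupport_negLaplacian hψs)
  rw [integral_rieszProfile_negLaplacian_top hm hd hψ hψs, Nat.descFactorial_self,
    ← Function.iterate_succ_apply, Nat.succ_eq_add_one, Nat.sub_add_cancel hm] at h1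
  rw [mul_assoc _ _ (ψ 0), ← h1]
  congr 1
  ext x
  simp [rieszProfile]

lemma negLaplacian_comp_add {f : E → ℝ} (hf : ContDiff ℝ ∞ f) (a : E) :
    negLaplacian (fun x => f (x + a)) = fun x => negLaplacian f (x + a) := by
  have hd : ∀ (h : E) (g : E → ℝ), dirDeriv h (fun x => g (x + a)) = fun x => dirDeriv h g (x + a) := by
    intro h g
    ext x
    simp [dirDeriv, fderiv_comp_add_right]
  have h2 : ContDiff ℝ ∞ fun x => f (x + a) := hf.comp (contDiff_id.add contDiff_const)
  ext x
  simp only [negLaplacian, Pi.neg_apply, laplacian_eq_sum_dirDeriv (hf.of_le ENat.LEInfty.out),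
    laplacian_eq_sum_dirDeriv (h2.of_le ENat.LEInfty.out), hd]

lemma iterate_negLaplacian_comp_add {f : E → ℝ} (hf : ContDiff ℝ ∞ f) (a : E) (k : ℕ) :
    negLaplacian^[k] (fun x => f (x + a)) = fun x => negLaplacian^[k] f (x + a) := by
  induction k with
  | zero => rfl
  | succ k ih =>
    rw [Function.iterate_succ_apply', ih, negLaplacian_comp_add (contDiff_iterate_negLaplacian hf k),
      Function.iterate_succ_apply']

lemma normalizingConst_pos {n : ℕ} : 0 < normalizingConst n := by
  have : Nontrivial (EuclideanSpace ℝ (Fin (n + 1))) :=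
    (finrank_pos_iff (R := ℝ)).1 (by rw [finrank_euclideanSpace_fin]; omega)
  unfold normalizingConst
  have h : 0 < (volume : Measure (EuclideanSpace ℝ (Fin (n + 1)))).toSphere.real univ := by
    rw [Measure.toSphere_real_apply_univ]
    refine mul_pos (by simp; positivity) ?_
    exact ENNReal.toReal_pos (Metric.measure_ball_pos _ _ one_pos).ne' measure_ball_lt_top.ne
  positivity

/-- The constant `2 / ((n-1)! |𝕊ⁿ|)` is the one that normalises the fundamental solution. -/
lemma normalizingConst_mul {m : ℕ} (hm : 0 < m) :
    normalizingConst (2 * m) * (4 ^ (m - 1) * (m - 1).factorial *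
        (2 * m.factorial *
          (volume : Measure (EuclideanSpace ℝ (Fin (2 * m)))).real (Metric.ball 0 1))) = 1 := by
  have : Nontrivial (EuclideanSpace ℝ (Fin (2 * m + 1))) :=
    (finrank_pos_iff (R := ℝ)).1 (by rw [finrank_euclideanSpace_fin]; omega)
  have : Nontrivial (EuclideanSpace ℝ (Fin (2 * m))) :=
    (finrank_pos_iff (R := ℝ)).1 (by rw [finrank_euclideanSpace_fin]; omega)
  have hb : (volume : Measure (EuclideanSpace ℝ (Fin (2 * m)))).real (Metric.ball 0 1) =
      Real.pi ^ m / m.factorial := by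
    rw [Measure.real, InnerProductSpace.volume_ball_of_dim_even (k := m) (by simp)]
    simp [Real.pi_pos.le, div_nonneg]
  have ho : (volume : Measure (EuclideanSpace ℝ (Fin (2 * m + 1)))).real (Metric.ball 0 1) =
      2 ^ (m + 1) * Real.pi ^ m / Nat.doubleFactorial (2 * m + 1) := by
    rw [Measure.real, InnerProductSpace.volume_ball_of_dim_odd (k := m) (by simp)]
    simp only [ENNReal.ofReal_one, one_pow, one_mul, finrank_euclideanSpace_fin]
    rw [ENNReal.toReal_ofReal (by positivity), mul_comm (Real.pi ^ m)]
  obtain ⟨j, rfl⟩ := Nat.exists_eq_succ_of_ne_zero hm.ne'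
  rw [normalizingConst, Measure.toSphere_real_apply_univ, hb, ho]
  simp only [finrank_euclideanSpace, Fintype.card_fin, Nat.succ_eq_add_one]
  have e1 : (2 * (j + 1) + 1).doubleFactorial = (2 * j + 3) * (2 * j + 1).doubleFactorial := by
    rw [show 2 * (j + 1) + 1 = (2 * j + 1) + 2 by ring, Nat.doubleFactorial_add_two]
  have e2 : (2 * j + 1).factorial = (2 * j + 1).doubleFactorial * (2 ^ j * j.factorial) := by
    rw [Nat.factorial_eq_mul_doubleFactorial, Nat.doubleFactorial_two_mul]
  rw [e1, show 2 * (j + 1) - 1 = 2 * j + 1 by omega, e2]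
  have hdf : ((2 * j + 1).doubleFactorial : ℝ) ≠ 0 := by
    exact_mod_cast (Nat.doubleFactorial_pos _).ne'
  have hj : (j.factorial : ℝ) ≠ 0 := by positivity
  have hj1 : ((j + 1).factorial : ℝ) ≠ 0 := by positivity
  have hpi := Real.pi_pos.ne'
  rw [Nat.add_sub_cancel, show (4 : ℝ) = 2 ^ 2 by norm_num, ← pow_mul]
  push_cast
  have h3 : (2 * (j : ℝ) + 3) ≠ 0 := by positivity
  have h3' : (2 * ((j : ℝ) + 1) + 1) ≠ 0 := by positivity
  field_simp
  ring

end

/-! ### Logarithmic potentials: regular and singular parts -/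

section

open Laplacian InnerProductSpace Module Real

variable {E : Type*} [NormedAddCommGroup E] [InnerProductSpace ℝ E] [FiniteDimensional ℝ E]

/-- The singular part `log⁻ |z|` of the logarithmic kernel, supported in the unit ball. -/
def nearKernel (z : E) : ℝ := log⁺ (‖z‖⁻¹)

lemma nearKernel_nonneg (z : E) : 0 ≤ nearKernel z := posLog_nonneg

lemma nearKernel_neg (z : E) : nearKernel (-z) = nearKernel z := by simp [nearKernel]

lemma nearKernel_eq_zero {z : E} (hz : 1 ≤ ‖z‖) : nearKernel z = 0 := by
  rw [nearKernel, posLog_eq_zero_iff, abs_of_nonneg (by positivity)]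
  exact inv_le_one_of_one_le₀ hz

lemma support_nearKernel : Function.support (nearKernel (E := E)) ⊆ Metric.closedBall 0 1 := by
  intro z hz
  by_contra h
  rw [mem_closedBall_zero_iff, not_le] at h
  exact hz (nearKernel_eq_zero h.le)

lemma abs_posLog_sub_le (a b : E) : |log⁺ ‖a‖ - log⁺ ‖a - b‖| ≤ log (1 + ‖b‖) := by
  have key : ∀ a b : E, log⁺ ‖a‖ ≤ log (1 + ‖b‖) + log⁺ ‖a - b‖ := by
    intro a b
    rw [posLog_eq_log_max_one (norm_nonneg _), posLog_eq_log_max_one (norm_nonneg _),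
      ← log_mul (by positivity) (by positivity)]
    apply log_le_log (by positivity)
    have h1 : 1 ≤ max 1 ‖a - b‖ := le_max_left _ _
    have h2 : ‖a - b‖ ≤ max 1 ‖a - b‖ := le_max_right _ _
    have h3 : ‖a‖ ≤ ‖a - b‖ + ‖b‖ := by simpa using norm_add_le (a - b) b
    have h4 := norm_nonneg b
    refine max_le ?_ ?_ <;> nlinarith
  have h1 := key a b
  have h2 := key (a - b) (-b)
  rw [norm_neg, sub_neg_eq_add, sub_add_cancel] at h2
  rw [abs_le]
  constructor <;> linarith

lemma continuous_posLog_norm_sub : Continuous fun p : E × E => log⁺ ‖p.2‖ - log⁺ ‖p.1 - p.2‖ :=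
  (continuous_posLog.comp continuous_snd.norm).sub
    (continuous_posLog.comp (continuous_fst.sub continuous_snd).norm)

lemma log_norm_sub_log_norm (x y : E) :
    log ‖y‖ - log ‖x - y‖ =
      (log⁺ ‖y‖ - log⁺ ‖x - y‖) + nearKernel (x - y) - nearKernel y := by
  rw [← posLog_sub_posLog_inv, ← posLog_sub_posLog_inv (x := ‖x - y‖)]
  simp only [nearKernel]
  ring

/-- `e^{∫ k dν} - 1 ≤ ∫ (e^k - 1) dν` for `k ≥ 0` and a measure of mass at most one, written for the
measure with density `a`: Jensen's inequality for sub-probability measures. -/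
lemma exp_integral_le {X : Type*} [MeasurableSpace X] {μ : Measure X} {k a : X → ℝ}
    (ha : ∀ x, 0 ≤ a x) (hai : Integrable a μ) (ha1 : ∫ x, a x ∂μ ≤ 1)
    (hka : Integrable (fun x => k x * a x) μ)
    (hea : Integrable (fun x => (exp (k x) - 1) * a x) μ) :
    exp (∫ x, k x * a x ∂μ) ≤ 1 + ∫ x, (exp (k x) - 1) * a x ∂μ := by
  set t := ∫ x, k x * a x ∂μ with ht
  set A := ∫ x, a x ∂μ with hA
  have h1 : exp t * (A + t - t * A) - A ≤ ∫ x, (exp (k x) - 1) * a x ∂μ := by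
    have : exp t * (A + t - t * A) - A =
        ∫ x, (exp t * (a x + k x * a x - t * a x) - a x) ∂μ := by
      rw [integral_sub, integral_const_mul, integral_sub, integral_add hai hka, integral_const_mul]
      · exact hai.add hka
      · exact hai.const_mul _
      · exact ((hai.add hka).sub (hai.const_mul _)).const_mul _
      · exact hai
    rw [this]
    refine integral_mono ((((hai.add hka).sub (hai.const_mul _)).const_mul _).sub hai) hea ?_
    intro x
    -- the tangent line of `exp` at `t`
    have h2 : exp t * (1 + (k x - t)) ≤ exp (k x) := by
      have := add_one_le_exp (k x - t)
      calc exp t * (1 + (k x - t)) ≤ exp t * exp (k x - t) := by gcongr; linarith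
        _ = exp (k x) := by rw [← exp_add]; ring_nf
    have := mul_le_mul_of_nonneg_right h2 (ha x)
    simp only
    nlinarith [this]
  have h3 : 0 ≤ (1 - A) * (1 + exp t * (t - 1)) := by
    refine mul_nonneg (by linarith) ?_
    have := add_one_le_exp (-t)
    have h4 : exp t * (1 - t) ≤ exp t * exp (-t) := by gcongr; linarith
    rw [← exp_add, add_neg_cancel, exp_zero] at h4
    linarith
  nlinarith

variable [MeasurableSpace E] [BorelSpace E]

lemma measurable_nearKernel : Measurable (nearKernel (E := E)) :=
  continuous_posLog.measurable.comp measurable_norm.inv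

lemma integrable_of_support_closedBall {g : E → ℝ} {r : ℝ}
    (hs : Function.support g ⊆ Metric.closedBall 0 r)
    (hg : Measurable g) {h : E → ℝ} (hh : LocallyIntegrable h)
    (hle : ∀ x, |g x| ≤ |h x|) : Integrable g := by
  rw [← integrableOn_iff_integrable_of_support_subset hs]
  exact Integrable.mono (hh.integrableOn_isCompact (isCompact_closedBall 0 r))
    hg.aestronglyMeasurable (Eventually.of_forall hle)

lemma integrable_nearKernel (h2 : 2 ≤ finrank ℝ E) : Integrable (nearKernel (E := E)) := by
  refine integrable_of_support_closedBall support_nearKernel measurable_nearKernel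
    (locallyIntegrable_log_norm h2) fun x => ?_
  rw [abs_of_nonneg (nearKernel_nonneg x), nearKernel, posLog_apply, log_inv]
  exact max_le (abs_nonneg _) (neg_le_abs _)

lemma integrable_exp_nearKernel_sub_one (h2 : 2 ≤ finrank ℝ E) :
    Integrable fun z : E => exp (nearKernel z) - 1 := by
  refine integrable_of_support_closedBall (r := 1) ?_
    ((measurable_exp.comp measurable_nearKernel).sub_const _)
    (locallyIntegrable_norm_pow_inv (E := E) (k := 1) (by omega)) fun x => ?_
  · refine subset_trans ?_ support_nearKernel
    intro z hz h0
    exact hz (by simp [h0])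
  · have h0 : 0 ≤ exp (nearKernel x) - 1 := by
      have := add_one_le_exp (nearKernel x); have := nearKernel_nonneg x; linarith
    rw [abs_of_nonneg h0, pow_one, abs_of_nonneg (by positivity), nearKernel,
      posLog_eq_log_max_one (by positivity), exp_log (by positivity)]
    have := max_le_add_of_nonneg zero_le_one (inv_nonneg.2 (norm_nonneg x))
    linarith

/-- The part `∫ (log⁺ |y| - log⁺ |x - y|) f(y) dy` of the logarithmic potential that carries its
growth at infinity. -/
def farPotential (f : E → ℝ) (x : E) : ℝ := ∫ y, (log⁺ ‖y‖ - log⁺ ‖x - y‖) * f y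

/-- The singular part `∫ log⁻ |x - y| f(y) dy` of the logarithmic potential. -/
def nearPotential (f : E → ℝ) (x : E) : ℝ := ∫ y, nearKernel (x - y) * f y

section

variable {f : E → ℝ} (hE : 2 ≤ finrank ℝ E) (hf : Continuous f) (hfi : Integrable f)

include hfi in
lemma integrable_far (x : E) : Integrable fun y => (log⁺ ‖y‖ - log⁺ ‖x - y‖) * f y := by
  refine Integrable.bdd_mul (c := log (1 + ‖x‖)) hfi ?_ (Eventually.of_forall fun y => ?_)
  · exact (continuous_posLog_norm_sub.comp (Continuous.prodMk_right x)).aestronglyMeasurable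
  · have := abs_posLog_sub_le (-y) (-x)
    rwa [norm_neg, norm_neg, show -y - -x = x - y by abel] at this

include hE hf in
lemma integrable_near (x : E) : Integrable fun y => nearKernel (x - y) * f y := by
  have hk : Integrable fun y : E => nearKernel (x - y) := (integrable_nearKernel hE).comp_sub_left x
  have hs : Function.support (fun y => nearKernel (x - y) * f y) ⊆ Metric.closedBall x 1 := by
    intro y hy
    have h1 : nearKernel (x - y) ≠ 0 := fun h => hy (by simp [h])
    have := support_nearKernel h1
    rwa [mem_closedBall_zero_iff, ← dist_eq_norm, dist_comm] at this
  rw [← integrableOn_iff_integrable_of_support_subset hs]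
  exact hk.integrableOn.mul_continuousOn hf.continuousOn (isCompact_closedBall x 1)

include hfi in
lemma abs_farPotential_le (x : E) : |farPotential f x| ≤ log (1 + ‖x‖) * ∫ y, |f y| := by
  rw [farPotential, ← integral_const_mul, ← Real.norm_eq_abs]
  refine norm_integral_le_of_norm_le (hfi.abs.const_mul _) (Eventually.of_forall fun y => ?_)
  rw [norm_mul, Real.norm_eq_abs, Real.norm_eq_abs]
  refine mul_le_mul_of_nonneg_right ?_ (abs_nonneg _)
  have := abs_posLog_sub_le (-y) (-x)
  rw [norm_neg, norm_neg, show -y - -x = x - y by abel] at this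
  exact this

include hfi in
lemma continuous_farPotential : Continuous (farPotential f) := by
  rw [continuous_iff_continuousAt]
  intro x
  refine continuousAt_of_dominated (bound := fun y => log (1 + (‖x‖ + 1)) * |f y|) ?_ ?_ ?_ ?_
  · exact Eventually.of_forall fun z => (integrable_far hfi z).aestronglyMeasurable
  · filter_upwards [Metric.ball_mem_nhds x one_pos] with z hz
    refine Eventually.of_forall fun y => ?_
    rw [norm_mul, Real.norm_eq_abs, Real.norm_eq_abs]
    refine mul_le_mul_of_nonneg_right ?_ (abs_nonneg _)
    have h1 := abs_posLog_sub_le (-y) (-z)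
    rw [norm_neg, norm_neg, show -y - -z = z - y by abel] at h1
    refine h1.trans (log_le_log (by positivity) ?_)
    have : ‖z‖ ≤ ‖x‖ + ‖z - x‖ := by simpa using norm_add_le x (z - x)
    rw [Metric.mem_ball, dist_eq_norm] at hz
    linarith
  · exact hfi.abs.const_mul _
  · refine Eventually.of_forall fun y => ContinuousAt.mul ?_ continuousAt_const
    exact (continuous_posLog_norm_sub.comp (Continuous.prodMk_left y)).continuousAt

lemma nearPotential_eq_convolution (f : E → ℝ) :
    nearPotential f = convolution nearKernel f (ContinuousLinearMap.mul ℝ ℝ) volume := by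
  ext x
  rw [convolution_mul_swap, nearPotential]

include hE hf in
lemma continuous_nearPotential : Continuous (nearPotential f) := by
  rw [continuous_iff_continuousAt]
  intro x
  let χ : ContDiffBump x := ⟨2, 3, by norm_num, by norm_num⟩
  have hc : Continuous (nearPotential fun y => χ y * f y) := by
    rw [nearPotential_eq_convolution]
    exact HasCompactSupport.continuous_convolution_right _ χ.hasCompactSupport.mul_right
      (integrable_nearKernel hE).locallyIntegrable (χ.continuous.mul hf)
  refine hc.continuousAt.congr ?_
  filter_upwards [Metric.ball_mem_nhds x one_pos] with z hz
  rw [nearPotential, nearPotential]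
  congr 1
  ext y
  by_cases h : 1 ≤ ‖z - y‖
  · simp [nearKernel_eq_zero h]
  · rw [χ.one_of_mem_closedBall, one_mul]
    rw [Metric.mem_ball] at hz
    rw [Metric.mem_closedBall]
    have := dist_triangle y z x
    rw [not_le, ← dist_eq_norm, dist_comm] at h
    change _ ≤ (2 : ℝ)
    linarith

include hE hfi in
lemma integrable_nearPotential : Integrable (nearPotential f) := by
  rw [nearPotential_eq_convolution]
  exact (integrable_nearKernel hE).integrable_convolution _ hfi

include hfi in
/-- The far part of the potential is asymptotic to `-(∫ f) log |x|`, by dominated convergence. -/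
lemma tendsto_farPotential_div_log [Nontrivial E] :
    Tendsto (fun x => farPotential f x / log ‖x‖) (cocompact E) (𝓝 (-∫ y, f y)) := by
  have hlog : Tendsto (fun x : E => log ‖x‖) (cocompact E) atTop :=
    tendsto_log_atTop.comp tendsto_norm_cocompact_atTop
  have : (fun x => farPotential f x / log ‖x‖) =
      fun x => ∫ y, ((log⁺ ‖y‖ - log⁺ ‖x - y‖) / log ‖x‖) * f y := by
    ext x
    rw [farPotential, div_eq_mul_inv, ← integral_mul_const]
    congr 1
    ext y
    ring
  rw [this, ← integral_neg]
  have hev : ∀ᶠ x : E in cocompact E, 2 ≤ ‖x‖ :=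
    tendsto_norm_cocompact_atTop.eventually_ge_atTop 2
  have hcg : (cocompact E).IsCountablyGenerated := by
    rw [← Metric.cobounded_eq_cocompact, ← comap_norm_atTop]; infer_instance
  refine tendsto_integral_filter_of_dominated_convergence (fun y => 2 * |f y|) ?_ ?_ ?_ ?_
  · refine Eventually.of_forall fun x => ?_
    have h := (integrable_far hfi x).aestronglyMeasurable.mul_const (log ‖x‖)⁻¹
    refine h.congr (Eventually.of_forall fun y => ?_)
    simp only; ring
  · filter_upwards [hev] with x hx
    refine Eventually.of_forall fun y => ?_
    rw [norm_mul, Real.norm_eq_abs, Real.norm_eq_abs]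
    refine mul_le_mul_of_nonneg_right ?_ (abs_nonneg _)
    have hl : 0 < log ‖x‖ := log_pos (by linarith)
    rw [abs_div, abs_of_pos hl, div_le_iff₀ hl]
    have h1 := abs_posLog_sub_le (-y) (-x)
    rw [norm_neg, norm_neg, show -y - -x = x - y by abel] at h1
    refine h1.trans ?_
    have : log (1 + ‖x‖) ≤ log (‖x‖ ^ 2) := log_le_log (by positivity) (by nlinarith)
    rwa [log_pow] at this
  · exact hfi.abs.const_mul _
  · refine Eventually.of_forall fun y => ?_
    have hlim : Tendsto (fun x : E => (log⁺ ‖y‖ + (log⁺ ‖x‖ - log⁺ ‖x - y‖)) / log ‖x‖)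
        (cocompact E) (𝓝 0) := by
      refine squeeze_zero_norm' (a := fun x : E => (log⁺ ‖y‖ + log (1 + ‖y‖)) / log ‖x‖) ?_
        (hlog.const_div_atTop _)
      filter_upwards [hev] with x hx
      have hl : 0 < log ‖x‖ := log_pos (by linarith)
      rw [norm_div, Real.norm_of_nonneg hl.le]
      gcongr
      refine (norm_add_le _ _).trans (add_le_add ?_ (abs_posLog_sub_le x y))
      rw [Real.norm_of_nonneg posLog_nonneg]
    have h2 := (hlim.sub_const 1).mul_const (f y)
    rw [zero_sub, neg_one_mul] at h2
    refine h2.congr' ?_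
    filter_upwards [hev] with x hx
    have hl : 0 < log ‖x‖ := log_pos (by linarith)
    rw [posLog_eq_log (x := ‖x‖) (by rw [abs_norm]; linarith)]
    field_simp
    ring

include hE hf hfi in
/-- Exponentials of the singular part are integrable near infinity, because the mass of `f` there
is small. -/
lemma integrableOn_exp_nearPotential (p : ℝ) (hp : 0 < p) :
    ∃ ρ : ℝ, 1 ≤ ρ ∧ IntegrableOn (fun x => exp (p * |nearPotential f x|) - 1) {x | ρ < ‖x‖} := by
  obtain ⟨N, hN⟩ : ∃ N : ℕ, p * ∫ y in {y : E | (N : ℝ) < ‖y‖}, |f y| ≤ 1 := by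
    have h := tendsto_setIntegral_of_antitone (μ := (volume : Measure E))
      (s := fun N : ℕ => {y : E | (N : ℝ) < ‖y‖}) (f := fun y => |f y|)
      (fun N => measurableSet_lt measurable_const measurable_norm)
      (fun i j hij y hy => lt_of_le_of_lt (Nat.cast_le.2 hij : (i : ℝ) ≤ j) hy)
      ⟨0, hfi.abs.integrableOn⟩
    have he : ⋂ N : ℕ, {y : E | (N : ℝ) < ‖y‖} = ∅ := by
      ext y
      simp only [mem_iInter, mem_ofPred_eq, mem_empty_iff_false, iff_false, not_forall, not_lt]
      exact exists_nat_ge ‖y‖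
    rw [he] at h
    simp only [setIntegral_empty] at h
    have h2 := h.const_mul p
    rw [mul_zero] at h2
    exact (h2.eventually_le_const one_pos).exists
  set S : Set E := {y : E | (N : ℝ) < ‖y‖} with hS
  have hSm : MeasurableSet S := measurableSet_lt measurable_const measurable_norm
  set a : E → ℝ := S.indicator fun y => p * |f y| with ha
  have hai : Integrable a := (hfi.abs.const_mul p).indicator hSm
  have ha0 : ∀ y, 0 ≤ a y := fun y => indicator_nonneg (fun y _ => by positivity) y
  have ha1 : ∫ y, a y ≤ 1 := by
    rw [ha, integral_indicator hSm, integral_const_mul]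
    exact hN
  have hconv : Integrable (fun x => ∫ y, (exp (nearKernel (x - y)) - 1) * a y) := by
    have := (integrable_exp_nearKernel_sub_one hE).integrable_convolution
      (ContinuousLinearMap.mul ℝ ℝ) hai
    refine this.congr (Eventually.of_forall fun x => ?_)
    rw [convolution_mul_swap]
  have hex1 := (integrable_exp_nearKernel_sub_one hE).ae_convolution_exists
      (ContinuousLinearMap.mul ℝ ℝ) hai
  refine ⟨N + 1, by simp, ?_⟩
  refine Integrable.mono' hconv.integrableOn ?_ ?_
  · have := continuous_nearPotential hE hf
    exact Continuous.aestronglyMeasurable (by fun_prop)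
  · rw [ae_restrict_iff' (measurableSet_lt measurable_const measurable_norm)]
    filter_upwards [hex1] with x hx1 hx
    have hx1' : Integrable fun y => (exp (nearKernel (x - y)) - 1) * a y := by
      have := hx1.integrable_swap
      simpa only [ContinuousLinearMap.mul_apply'] using this
    have hpt : ∀ y, p * (nearKernel (x - y) * |f y|) = nearKernel (x - y) * a y := by
      intro y
      by_cases hy : y ∈ S
      · rw [ha, indicator_of_mem hy]; ring
      · have h1 : 1 ≤ ‖x - y‖ := by
          have h2 : ‖x‖ ≤ ‖x - y‖ + ‖y‖ := by simpa using norm_add_le (x - y) y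
          have h3 : ‖y‖ ≤ N := by simpa [hS] using hy
          have h4 : (N : ℝ) + 1 < ‖x‖ := hx
          linarith
        simp [nearKernel_eq_zero h1]
    have hka : Integrable fun y => nearKernel (x - y) * a y := by
      refine ((integrable_near hE hf.abs x).const_mul p).congr (Eventually.of_forall hpt)
    have hle : p * |nearPotential f x| ≤ ∫ y, nearKernel (x - y) * a y := by
      simp_rw [← hpt]
      rw [integral_const_mul]
      gcongr
      rw [nearPotential, ← Real.norm_eq_abs]
      refine (norm_integral_le_integral_norm _).trans_eq ?_
      congr 1
      ext y
      rw [norm_mul, Real.norm_of_nonneg (nearKernel_nonneg _), Real.norm_eq_abs]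
    have h5 := exp_integral_le ha0 hai ha1 hka hx1'
    have h6 : 0 ≤ exp (p * |nearPotential f x|) - 1 := by
      have : 0 ≤ p * |nearPotential f x| := by positivity
      have := one_le_exp this
      linarith
    rw [Real.norm_of_nonneg h6]
    have := exp_le_exp.2 hle
    linarith

end

end

/-! ### The equation solved by the logarithmic potential -/

section

open Laplacian InnerProductSpace Module Real

lemma integral_iterate_negLaplacian_eq_zero {E : Type*} [NormedAddCommGroup E]
    [InnerProductSpace ℝ E] [FiniteDimensional ℝ E] [MeasurableSpace E] [BorelSpace E]
    {m : ℕ} (hm : 0 < m) {φ : E → ℝ}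
    (hφ : ContDiff ℝ ∞ φ) (hφs : HasCompactSupport φ) : ∫ x, negLaplacian^[m] φ x = 0 := by
  obtain ⟨j, rfl⟩ : ∃ j, m = j + 1 := ⟨m - 1, by omega⟩
  have h := integral_mul_negLaplacian (f := fun _ : E => (1 : ℝ)) contDiff_const
    (contDiff_iterate_negLaplacian hφ j) (hasCompactSupport_iterate_negLaplacian hφs j)
  rw [Function.iterate_succ_apply']
  simpa [negLaplacian] using h

section

variable {n : ℕ} {f : EuclideanSpace ℝ (Fin n) → ℝ} (hn : 2 ≤ n) (hf : Continuous f)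
  (hfi : Integrable f)

include hn in
lemma two_le_finrank : 2 ≤ finrank ℝ (EuclideanSpace ℝ (Fin n)) := by
  rwa [finrank_euclideanSpace_fin]

include hn in
lemma logPotential_eq_integral (x : EuclideanSpace ℝ (Fin n)) :
    logPotential f x = normalizingConst n * ∫ y, (log ‖y‖ - log ‖x - y‖) * f y := by
  have : Nontrivial (EuclideanSpace ℝ (Fin n)) :=
    (finrank_pos_iff (R := ℝ)).1 (by rw [finrank_euclideanSpace_fin]; omega)
  rw [logPotential]
  congr 1
  refine integral_congr_ae ?_
  -- the logarithm of the quotient splits unless `y = 0` or `y = x`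
  have h1 : ∀ᵐ y : EuclideanSpace ℝ (Fin n), y ≠ x := by simp [ae_iff]
  have h0 : ∀ᵐ y : EuclideanSpace ℝ (Fin n), y ≠ 0 := by simp [ae_iff]
  filter_upwards [h0, h1] with y hy0 hyx
  rw [log_div (norm_ne_zero_iff.2 hy0) (norm_ne_zero_iff.2 (sub_ne_zero.2 hyx.symm))]

include hn hf hfi in
lemma logPotential_eq (x : EuclideanSpace ℝ (Fin n)) :
    logPotential f x =
      normalizingConst n * (farPotential f x + nearPotential f x - nearPotential f 0) := by
  have hE := two_le_finrank hn
  have h0 : Integrable fun y : EuclideanSpace ℝ (Fin n) => nearKernel y * f y := by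
    simpa [nearKernel_neg] using integrable_near hE hf 0
  rw [logPotential_eq_integral hn]
  have : ∀ y : EuclideanSpace ℝ (Fin n), (log ‖y‖ - log ‖x - y‖) * f y =
      (log⁺ ‖y‖ - log⁺ ‖x - y‖) * f y + nearKernel (x - y) * f y - nearKernel y * f y := by
    intro y
    rw [log_norm_sub_log_norm]
    ring
  simp_rw [this]
  have hsum : Integrable fun y : EuclideanSpace ℝ (Fin n) =>
      (log⁺ ‖y‖ - log⁺ ‖x - y‖) * f y + nearKernel (x - y) * f y :=
    (integrable_far hfi x).add (integrable_near hE hf x)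
  rw [integral_sub hsum h0,
    integral_add (integrable_far hfi x) (integrable_near hE hf x)]
  simp [farPotential, nearPotential, nearKernel_neg]

include hn hf hfi in
lemma continuous_logPotential : Continuous (logPotential f) := by
  have : logPotential f = fun x =>
      normalizingConst n * (farPotential f x + nearPotential f x - nearPotential f 0) :=
    funext (logPotential_eq hn hf hfi)
  rw [this]
  have h1 := continuous_farPotential hfi
  have h2 := continuous_nearPotential (two_le_finrank hn) hf
  fun_prop

/-- The logarithmic potential solves `(-Δ)^{n/2} 𝓛(f) = f` in the sense of distributions. -/
lemma integral_logPotential_mul {m : ℕ} (hm : 0 < m)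
    {f φ : EuclideanSpace ℝ (Fin (2 * m)) → ℝ} (hf : Continuous f) (hfi : Integrable f)
    (hφ : ContDiff ℝ ∞ φ) (hφs : HasCompactSupport φ) :
    ∫ x, logPotential f x * negLaplacian^[m] φ x = ∫ y, f y * φ y := by
  have hn : 2 ≤ 2 * m := by omega
  have hE : 2 ≤ finrank ℝ (EuclideanSpace ℝ (Fin (2 * m))) := two_le_finrank hn
  set Ψ := negLaplacian^[m] φ with hΨ
  have hΨd : ContDiff ℝ ∞ Ψ := contDiff_iterate_negLaplacian hφ m
  have hΨs : HasCompactSupport Ψ := hasCompactSupport_iterate_negLaplacian hφs m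
  have hΨc := hΨd.continuous
  have hΨi : Integrable Ψ := hΨc.integrable_of_hasCompactSupport hΨs
  obtain ⟨C, hC⟩ := hΨs.exists_bound_of_continuous hΨc
  have h0 : Integrable fun y : EuclideanSpace ℝ (Fin (2 * m)) => nearKernel y * f y := by
    simpa [nearKernel_neg] using integrable_near hE hf 0
  have hint : Integrable (fun p : EuclideanSpace ℝ (Fin (2 * m)) ×
        EuclideanSpace ℝ (Fin (2 * m)) => (log ‖p.2‖ - log ‖p.1 - p.2‖) * f p.2 * Ψ p.1)
      (volume.prod volume) := by
    have i1 : Integrable (fun p : EuclideanSpace ℝ (Fin (2 * m)) ×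
        EuclideanSpace ℝ (Fin (2 * m)) => (log⁺ ‖p.2‖ - log⁺ ‖p.1 - p.2‖) * (f p.2 * Ψ p.1))
        (volume.prod volume) := by
      have hl : Integrable fun x : EuclideanSpace ℝ (Fin (2 * m)) => log (1 + ‖x‖) * Ψ x := by
        refine integrable_mul_of_hasCompactSupport ?_ hΨc hΨs
        exact Continuous.log (by fun_prop) fun x => by positivity
      have := hl.mul_prod hfi
      refine this.mono ?_ (Eventually.of_forall fun p => ?_)
      · refine continuous_posLog_norm_sub.aestronglyMeasurable.mul ?_
        exact (Continuous.aestronglyMeasurable (by fun_prop))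
      · simp only [norm_mul, Real.norm_eq_abs]
        have h1 := abs_posLog_sub_le (-p.2) (-p.1)
        rw [norm_neg, norm_neg, show -p.2 - -p.1 = p.1 - p.2 by abel] at h1
        rw [abs_of_nonneg (log_nonneg (by linarith [norm_nonneg p.1]) : 0 ≤ log (1 + ‖p.1‖))]
        calc _ ≤ log (1 + ‖p.1‖) * (|f p.2| * |Ψ p.1|) := by gcongr
          _ = _ := by ring
    have i2 : Integrable (fun p : EuclideanSpace ℝ (Fin (2 * m)) ×
        EuclideanSpace ℝ (Fin (2 * m)) => Ψ p.1 * (nearKernel (p.1 - p.2) * f p.2))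
        (volume.prod volume) := by
      have := hfi.convolution_integrand (ContinuousLinearMap.mul ℝ ℝ) (integrable_nearKernel hE)
      refine Integrable.bdd_mul (c := C) ?_ (hΨc.comp continuous_fst).aestronglyMeasurable
        (Eventually.of_forall fun p => hC _)
      refine this.congr (Eventually.of_forall fun p => ?_)
      simp [mul_comm]
    have i3 : Integrable (fun p : EuclideanSpace ℝ (Fin (2 * m)) ×
        EuclideanSpace ℝ (Fin (2 * m)) => Ψ p.1 * (nearKernel p.2 * f p.2))
        (volume.prod volume) := hΨi.mul_prod h0
    refine ((i1.add i2).sub i3).congr (Eventually.of_forall fun p => ?_)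
    simp only [Pi.add_apply, Pi.sub_apply]
    rw [log_norm_sub_log_norm]
    ring
  have hinner : ∀ y : EuclideanSpace ℝ (Fin (2 * m)), ∫ x, (log ‖y‖ - log ‖x - y‖) * f y * Ψ x =
      f y * (4 ^ (m - 1) * (m - 1).factorial * (2 * m.factorial *
        (volume : Measure (EuclideanSpace ℝ (Fin (2 * m)))).real (Metric.ball 0 1)) * φ y) := by
    intro y
    have hlog : Integrable fun x : EuclideanSpace ℝ (Fin (2 * m)) => log ‖x - y‖ * Ψ x := by
      have h1 : LocallyIntegrable fun x : EuclideanSpace ℝ (Fin (2 * m)) => log ‖x‖ :=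
        locallyIntegrable_log_norm hE
      have h2 := h1.integrable_smul_right_of_hasCompactSupport
        (hΨc.comp (continuous_add_const y)) (hΨs.comp_homeomorph (Homeomorph.addRight y))
      have h3 := h2.comp_sub_right y
      simpa using h3
    have htr := integral_log_iterate_negLaplacian hm (by simp)
      (ψ := fun x => φ (x + y)) (hφ.comp (contDiff_id.add contDiff_const))
      (hφs.comp_homeomorph (Homeomorph.addRight y))
    rw [iterate_negLaplacian_comp_add hφ, zero_add] at htr
    rw [← htr, ← integral_sub_right_eq_self (fun x => -log ‖x‖ * negLaplacian^[m] φ (x + y)) y]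
    have : ∀ x : EuclideanSpace ℝ (Fin (2 * m)), (log ‖y‖ - log ‖x - y‖) * f y * Ψ x =
        f y * (log ‖y‖ * Ψ x - log ‖x - y‖ * Ψ x) := fun x => by ring
    simp_rw [this]
    rw [integral_const_mul, integral_sub (hΨi.const_mul _) hlog, integral_const_mul, hΨ,
      integral_iterate_negLaplacian_eq_zero hm hφ hφs]
    simp [integral_neg]
  have hL : ∀ x : EuclideanSpace ℝ (Fin (2 * m)), logPotential f x * Ψ x =
      normalizingConst (2 * m) * ∫ y, (log ‖y‖ - log ‖x - y‖) * f y * Ψ x := by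
    intro x
    rw [logPotential_eq_integral hn, integral_mul_const]
    ring
  simp_rw [hL]
  rw [integral_const_mul, integral_integral_swap hint]
  simp_rw [hinner]
  rw [← integral_const_mul]
  congr 1
  ext y
  linear_combination (f y * φ y) * normalizingConst_mul hm

end

end

/-! ### Polynomials along lines and mollification -/

section

open Laplacian InnerProductSpace Module Polynomial

lemma exists_antiderivative_degreeLT {j : ℕ} {q : ℝ[X]} (hq : q ∈ degreeLT ℝ j) :
    ∃ P ∈ degreeLT ℝ (j + 1), derivative P = q := by
  by_cases h0 : q = 0
  · exact ⟨0, Submodule.zero_mem _, by simp [h0]⟩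
  have hdeg : q.natDegree < j := (natDegree_lt_iff_degree_lt h0).2 (mem_degreeLT.1 hq)
  refine ⟨∑ i ∈ Finset.range j, monomial (i + 1) (q.coeff i / (i + 1)), ?_, ?_⟩
  · refine Submodule.sum_mem _ fun i hi => ?_
    rw [mem_degreeLT]
    refine (degree_monomial_le _ _).trans_lt ?_
    have := Finset.mem_range.1 hi
    exact_mod_cast Nat.succ_lt_succ this
  · rw [derivative_sum]
    conv_rhs => rw [as_sum_range' q j hdeg]
    refine Finset.sum_congr rfl fun i _ => ?_
    rw [derivative_monomial]
    have : (i : ℝ) + 1 ≠ 0 := by positivity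
    push_cast
    congr 1
    field_simp

/-- A function with a polynomial derivative on an open connected set is a polynomial there. -/
lemma exists_polynomial_of_hasDerivAt {S : Set ℝ} (hS : IsOpen S) (hSc : IsPreconnected S) {j : ℕ}
    {q : ℝ[X]} (hq : q ∈ degreeLT ℝ j) {f : ℝ → ℝ}
    (hf : ∀ t ∈ S, HasDerivAt f (q.eval t) t) :
    ∃ P ∈ degreeLT ℝ (j + 1), ∀ t ∈ S, f t = P.eval t := by
  obtain ⟨P, hP, hPq⟩ := exists_antiderivative_degreeLT hq
  have hd : ∀ t ∈ S, HasDerivAt (fun t => f t - P.eval t) 0 t := by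
    intro t ht
    have := (hf t ht).sub (P.hasDerivAt t)
    rwa [hPq, sub_self] at this
  obtain ⟨c, hc⟩ := hS.exists_is_const_of_deriv_eq_zero hSc
    (fun t ht => (hd t ht).differentiableAt.differentiableWithinAt) (fun t ht => (hd t ht).deriv)
  refine ⟨P + C c, Submodule.add_mem _ hP ?_, fun t ht => ?_⟩
  · rw [mem_degreeLT]
    exact degree_C_le.trans_lt (by exact_mod_cast Nat.succ_pos j)
  · have := hc t ht
    simp
    linarith

variable {E : Type*} [NormedAddCommGroup E] [InnerProductSpace ℝ E] [FiniteDimensional ℝ E]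

lemma contDiff_iterate_dirDeriv {f : E → ℝ} (hf : ContDiff ℝ ∞ f) (h : E) (k : ℕ) :
    ContDiff ℝ ∞ ((dirDeriv h)^[k] f) := by
  induction k with
  | zero => exact hf
  | succ k ih => rw [Function.iterate_succ_apply']; exact contDiff_dirDeriv ih h

lemma hasCompactSupport_iterate_dirDeriv {f : E → ℝ} (hf : HasCompactSupport f) (h : E) (k : ℕ) :
    HasCompactSupport ((dirDeriv h)^[k] f) := by
  induction k with
  | zero => exact hf
  | succ k ih => rw [Function.iterate_succ_apply']; exact hasCompactSupport_dirDeriv ih h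

lemma hasDerivAt_comp_smul {f : E → ℝ} (hf : ContDiff ℝ ∞ f) (h : E) (t : ℝ) :
    HasDerivAt (fun t : ℝ => f (t • h)) (dirDeriv h f (t • h)) t := by
  have h1 : HasDerivAt (fun t : ℝ => t • h) h t := by
    simpa using (hasDerivAt_id t).smul_const h
  exact ((hf.differentiable (by simp) (t • h)).hasFDerivAt).comp_hasDerivAt t h1

/-- A smooth function with vanishing `N`-th derivatives in the direction `h` is a polynomial along
the line spanned by `h`. -/
lemma exists_polynomial_of_iterate_dirDeriv_eq_zero {f : E → ℝ} (hf : ContDiff ℝ ∞ f) {h : E}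
    {N : ℕ} (hN : (dirDeriv h)^[N] f = 0) :
    ∃ p ∈ degreeLT ℝ N, ∀ t : ℝ, f (t • h) = p.eval t := by
  induction N generalizing f with
  | zero =>
    refine ⟨0, Submodule.zero_mem _, fun t => ?_⟩
    have : f = 0 := hN
    simp [this]
  | succ N ih =>
    obtain ⟨q, hq, hqe⟩ := ih (contDiff_dirDeriv hf h) hN
    obtain ⟨P, hP, hPe⟩ := exists_polynomial_of_hasDerivAt isOpen_univ isPreconnected_univ hq
      (f := fun t => f (t • h)) fun t _ => by rw [← hqe]; exact hasDerivAt_comp_smul hf h t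
    exact ⟨P, hP, fun t => hPe t (mem_univ t)⟩

lemma dirDeriv_comp_smul {f : E → ℝ} (hf : ContDiff ℝ ∞ f) (h : E) (c : ℝ) :
    dirDeriv h (fun x => f (c • x)) = fun x => c * dirDeriv h f (c • x) := by
  ext x
  have h1 : HasFDerivAt (fun x : E => c • x) (c • ContinuousLinearMap.id ℝ E) x :=
    (c • ContinuousLinearMap.id ℝ E).hasFDerivAt
  have := ((hf.differentiable (by simp) (c • x)).hasFDerivAt).comp x h1
  rw [dirDeriv]
  erw [this.fderiv]
  simp [dirDeriv]

lemma dirDeriv_const_mul (h : E) (c : ℝ) {f : E → ℝ} (hf : ContDiff ℝ ∞ f) :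
    dirDeriv h (fun x => c * f x) = fun x => c * dirDeriv h f x := by
  ext x
  rw [dirDeriv, fderiv_const_mul (hf.differentiable (by simp) x)]
  rfl

lemma iterate_dirDeriv_comp_smul {f : E → ℝ} (hf : ContDiff ℝ ∞ f) (h : E) (c : ℝ) (k : ℕ) :
    (dirDeriv h)^[k] (fun x => f (c • x)) = fun x => c ^ k * (dirDeriv h)^[k] f (c • x) := by
  induction k with
  | zero => simp
  | succ k ih =>
    have hk := contDiff_iterate_dirDeriv hf h k
    have hk2 : ContDiff ℝ ∞ fun x => (dirDeriv h)^[k] f (c • x) := hk.comp (contDiff_const_smul c)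
    rw [Function.iterate_succ_apply', ih, dirDeriv_const_mul h _ hk2, dirDeriv_comp_smul hk,
      Function.iterate_succ_apply']
    ext x
    ring

lemma negLaplacian_comp_neg {f : E → ℝ} (hf : ContDiff ℝ ∞ f) :
    negLaplacian (fun x => f (-x)) = fun x => negLaplacian f (-x) := by
  have hneg : ContDiff ℝ ∞ fun x => f (-x) := hf.comp contDiff_neg
  have e : ∀ {g : E → ℝ}, ContDiff ℝ ∞ g → ∀ h : E,
      dirDeriv h (fun x => g (-x)) = fun x => (-1) * dirDeriv h g (-x) := by
    intro g hg h
    have := dirDeriv_comp_smul hg h (-1)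
    simpa using this
  ext x
  simp only [negLaplacian, Pi.neg_apply, laplacian_eq_sum_dirDeriv (hf.of_le ENat.LEInfty.out),
    laplacian_eq_sum_dirDeriv (hneg.of_le ENat.LEInfty.out)]
  congr 1
  refine Finset.sum_congr rfl fun i _ => ?_
  have hd := contDiff_dirDeriv hf (stdOrthonormalBasis ℝ E i)
  have hdn : ContDiff ℝ ∞ fun x => dirDeriv (stdOrthonormalBasis ℝ E i) f (-x) :=
    hd.comp contDiff_neg
  rw [e hf, dirDeriv_const_mul _ _ hdn, e hd]
  simp

lemma iterate_negLaplacian_comp_neg {f : E → ℝ} (hf : ContDiff ℝ ∞ f) (k : ℕ) :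
    negLaplacian^[k] (fun x => f (-x)) = fun x => negLaplacian^[k] f (-x) := by
  induction k with
  | zero => rfl
  | succ k ih =>
    rw [Function.iterate_succ_apply', ih, negLaplacian_comp_neg (contDiff_iterate_negLaplacian hf k),
      Function.iterate_succ_apply']

variable [MeasurableSpace E] [BorelSpace E]

/-- The convolution `x ↦ ∫ w(y) ξ(x - y) dy` of real functions. -/
def conv (w ξ : E → ℝ) : E → ℝ := fun x => ∫ y, w y * ξ (x - y)

lemma conv_eq_convolution (w ξ : E → ℝ) :
    conv w ξ = convolution w ξ (ContinuousLinearMap.mul ℝ ℝ) volume := by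
  ext x
  rw [convolution_mul, conv]

lemma integrable_conv {w ξ : E → ℝ} (hw : Continuous w) (hξ : Continuous ξ)
    (hξs : HasCompactSupport ξ) (x : E) : Integrable fun y => w y * ξ (x - y) :=
  integrable_mul_of_hasCompactSupport hw (hξ.comp (continuous_const.sub continuous_id))
    (hξs.comp_homeomorph (Homeomorph.subLeft x))

lemma contDiff_conv {w ξ : E → ℝ} (hw : Continuous w) (hξ : ContDiff ℝ ∞ ξ)
    (hξs : HasCompactSupport ξ) : ContDiff ℝ ∞ (conv w ξ) := by
  rw [conv_eq_convolution]
  exact hξs.contDiff_convolution_right _ hw.locallyIntegrable hξ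

lemma dirDeriv_conv {w ξ : E → ℝ} (hw : Continuous w) (hξ : ContDiff ℝ ∞ ξ)
    (hξs : HasCompactSupport ξ) (h : E) : dirDeriv h (conv w ξ) = conv w (dirDeriv h ξ) := by
  ext x
  have h1 := hξs.hasFDerivAt_convolution_right (ContinuousLinearMap.mul ℝ ℝ)
    hw.locallyIntegrable (hξ.of_le (by simp)) x (μ := volume)
  rw [dirDeriv, conv_eq_convolution, h1.fderiv, convolution_precompR_apply _ hw.locallyIntegrable
    (hξs.fderiv ℝ) (hξ.continuous_fderiv (by simp)), conv_eq_convolution]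
  rfl

lemma iterate_dirDeriv_conv {w ξ : E → ℝ} (hw : Continuous w) (hξ : ContDiff ℝ ∞ ξ)
    (hξs : HasCompactSupport ξ) (h : E) (k : ℕ) :
    (dirDeriv h)^[k] (conv w ξ) = conv w ((dirDeriv h)^[k] ξ) := by
  induction k with
  | zero => rfl
  | succ k ih =>
    rw [Function.iterate_succ_apply', ih, dirDeriv_conv hw (contDiff_iterate_dirDeriv hξ h k)
      (hasCompactSupport_iterate_dirDeriv hξs h k), Function.iterate_succ_apply']

lemma negLaplacian_conv {w ξ : E → ℝ} (hw : Continuous w) (hξ : ContDiff ℝ ∞ ξ)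
    (hξs : HasCompactSupport ξ) : negLaplacian (conv w ξ) = conv w (negLaplacian ξ) := by
  ext x
  simp only [negLaplacian, Pi.neg_apply,
    laplacian_eq_sum_dirDeriv ((contDiff_conv hw hξ hξs).of_le ENat.LEInfty.out),
    laplacian_eq_sum_dirDeriv (hξ.of_le ENat.LEInfty.out), conv, mul_neg, integral_neg,
    Finset.mul_sum]
  have hd := fun i => contDiff_dirDeriv hξ (stdOrthonormalBasis ℝ E i)
  have hs := fun i => hasCompactSupport_dirDeriv hξs (stdOrthonormalBasis ℝ E i)
  rw [integral_finsetSum]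
  · congr 1
    refine Finset.sum_congr rfl fun i _ => ?_
    rw [dirDeriv_conv hw hξ hξs, dirDeriv_conv hw (hd i) (hs i)]
    rfl
  · exact fun i _ => integrable_conv hw (contDiff_dirDeriv (hd i) _).continuous
      (hasCompactSupport_dirDeriv (hs i) _) x

lemma iterate_negLaplacian_conv {w ξ : E → ℝ} (hw : Continuous w) (hξ : ContDiff ℝ ∞ ξ)
    (hξs : HasCompactSupport ξ) (k : ℕ) :
    negLaplacian^[k] (conv w ξ) = conv w (negLaplacian^[k] ξ) := by
  induction k with
  | zero => rfl
  | succ k ih =>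
    rw [Function.iterate_succ_apply', ih, negLaplacian_conv hw (contDiff_iterate_negLaplacian hξ k)
      (hasCompactSupport_iterate_negLaplacian hξs k), Function.iterate_succ_apply']

/-- Mollifications of a distributional solution of `(-Δ)^m w = 0` are classical solutions. -/
lemma iterate_negLaplacian_conv_eq_zero {w ξ : E → ℝ} (hw : Continuous w) (hξ : ContDiff ℝ ∞ ξ)
    (hξs : HasCompactSupport ξ) {m : ℕ}
    (hweak : ∀ φ : E → ℝ, ContDiff ℝ ∞ φ → HasCompactSupport φ →
      ∫ x, w x * negLaplacian^[m] φ x = 0) :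
    negLaplacian^[m] (conv w ξ) = 0 := by
  rw [iterate_negLaplacian_conv hw hξ hξs]
  ext x
  have hn : ContDiff ℝ ∞ fun y => ξ (-y) := hξ.comp contDiff_neg
  have h1 := hweak (fun y => ξ (x - y)) (hξ.comp (contDiff_const.sub contDiff_id))
    (hξs.comp_homeomorph (Homeomorph.subLeft x))
  have h2 : (fun y => ξ (x - y)) = fun y => (fun z => ξ (-z)) (y + -x) := by
    ext y; congr 1; abel
  rw [h2, iterate_negLaplacian_comp_add hn, iterate_negLaplacian_comp_neg hξ] at h1
  simp only [conv, Pi.zero_apply]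
  rw [← h1]
  congr 1
  ext y
  beta_reduce
  rw [neg_add_rev, neg_neg, sub_eq_add_neg]

end

/-! ### Pizzetti's formula -/

section

open Laplacian InnerProductSpace Module Polynomial

/-- The primitive `s ↦ ¼ ∫_s^1 F` of `-F/4`. -/
def tailProfile (F : ℝ → ℝ) (s : ℝ) : ℝ := ∫ u in s..1, F u / 4

lemma hasDerivAt_tailProfile {F : ℝ → ℝ} (hF : Continuous F) (s : ℝ) :
    HasDerivAt (tailProfile F) (-(F s / 4)) s := by
  have hc : Continuous fun u => F u / 4 := hF.div_const 4
  exact intervalIntegral.integral_hasDerivAt_left (hc.intervalIntegrable _ _)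
    hc.aestronglyMeasurable.stronglyMeasurableAtFilter hc.continuousAt

lemma contDiff_tailProfile {F : ℝ → ℝ} (hF : ContDiff ℝ ∞ F) : ContDiff ℝ ∞ (tailProfile F) := by
  rw [contDiff_infty_iff_deriv]
  have hd := hasDerivAt_tailProfile hF.continuous
  refine ⟨fun s => (hd s).differentiableAt, ?_⟩
  rw [show deriv (tailProfile F) = fun s => -(F s / 4) from funext fun s => (hd s).deriv]
  exact (hF.div_const 4).neg

lemma tailProfile_eq_zero {F : ℝ → ℝ} (hF : ∀ s, 1 ≤ s → F s = 0) (s : ℝ) (hs : 1 ≤ s) :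
    tailProfile F s = 0 := by
  rw [tailProfile]
  refine intervalIntegral.integral_zero_ae (Eventually.of_forall fun u hu => ?_)
  rw [uIoc_of_ge hs] at hu
  rw [hF u hu.1.le, zero_div]

variable {E : Type*} [NormedAddCommGroup E] [InnerProductSpace ℝ E] [FiniteDimensional ℝ E]

/-- The radial kernel `t^{-m} F(|x|² / t)` at scale `√t` in dimension `2m`. -/
def radialKernel (F : ℝ → ℝ) (m : ℕ) (t : ℝ) (x : E) : ℝ := (t ^ m)⁻¹ * F (‖x‖ ^ 2 / t)

section kernel

variable {F : ℝ → ℝ} (hF : ContDiff ℝ ∞ F) (hF1 : ∀ s, 1 ≤ s → F s = 0)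

include hF in
lemma contDiff_radialKernel (m : ℕ) (t : ℝ) : ContDiff ℝ ∞ (radialKernel (E := E) F m t) :=
  contDiff_const.mul (hF.comp ((contDiff_norm_sq ℝ).div_const t))

include hF1 in
lemma radialKernel_eq_zero (m : ℕ) {t : ℝ} (ht : 0 < t) {x : E} (hx : t ≤ ‖x‖ ^ 2) :
    radialKernel F m t x = 0 := by
  rw [radialKernel, hF1 _ ((one_le_div ht).2 hx), mul_zero]

include hF1 in
lemma hasCompactSupport_radialKernel (m : ℕ) {t : ℝ} (ht : 0 < t) :
    HasCompactSupport (radialKernel (E := E) F m t) := by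
  refine HasCompactSupport.intro (isCompact_closedBall 0 (√t)) fun x hx => ?_
  rw [mem_closedBall_zero_iff, not_le] at hx
  exact radialKernel_eq_zero hF1 m ht (Real.lt_sq_of_sqrt_lt hx).le

/-- The time derivative of the radial kernel. -/
def radialKernelDeriv (F : ℝ → ℝ) (m : ℕ) (t : ℝ) (x : E) : ℝ :=
  -((t ^ m)⁻¹ * (m * F (‖x‖ ^ 2 / t) / t + ‖x‖ ^ 2 * deriv F (‖x‖ ^ 2 / t) / t ^ 2))

include hF in
lemma hasDerivAt_radialKernel (m : ℕ) {t : ℝ} (ht : 0 < t) (x : E) :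
    HasDerivAt (fun t => radialKernel F m t x) (radialKernelDeriv F m t x) t := by
  have h1 := ((hasDerivAt_pow m t).inv (pow_ne_zero m ht.ne'))
  have h2 : HasDerivAt (fun t : ℝ => ‖x‖ ^ 2 / t) (-‖x‖ ^ 2 / t ^ 2) t := by
    have := (hasDerivAt_inv ht.ne').const_mul (‖x‖ ^ 2)
    convert! this using 1
    field_simp
  have h3 := ((hF.differentiable (by simp) (‖x‖ ^ 2 / t)).hasDerivAt).comp t h2
  have h4 := h1.mul h3
  convert! h4 using 1
  rw [radialKernelDeriv]
  simp only [Pi.inv_apply, Function.comp_apply]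
  cases m with
  | zero => simp; ring
  | succ m =>
    push_cast
    field_simp
    ring

include hF in
/-- The radial kernels solve an evolution equation: the time derivative of the kernel with profile
`F` is the Laplacian of the kernel with profile `tailProfile F`. -/
lemma negLaplacian_radialKernel {m : ℕ} (hd : finrank ℝ E = 2 * m) {t : ℝ} (ht : 0 < t) (x : E) :
    negLaplacian (radialKernel (tailProfile F) m t) x = -radialKernelDeriv F m t x := by
  have h1 : ∀ r : ℝ, HasDerivAt (fun r => (t ^ m)⁻¹ * tailProfile F (r / t))
      ((t ^ m)⁻¹ * (-(F (r / t) / 4) / t)) r := by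
    intro r
    have := ((hasDerivAt_tailProfile hF.continuous (r / t)).comp r
      ((hasDerivAt_id r).div_const t)).const_mul (t ^ m)⁻¹
    convert! this using 1
    ring
  have h2 : HasDerivAt (fun r => (t ^ m)⁻¹ * (-(F (r / t) / 4) / t))
      ((t ^ m)⁻¹ * (-(deriv F (‖x‖ ^ 2 / t) / t / 4) / t)) (‖x‖ ^ 2) := by
    have := ((((hF.differentiable (by simp) (‖x‖ ^ 2 / t)).hasDerivAt.comp (‖x‖ ^ 2)
      ((hasDerivAt_id (‖x‖ ^ 2)).div_const t)).div_const 4).neg.div_const t).const_mul (t ^ m)⁻¹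
    convert! this using 1
    ring
  have key := laplacian_comp_norm_sq (E := E) (x := x)
    (G := fun r => (t ^ m)⁻¹ * tailProfile F (r / t))
    (G' := fun r => (t ^ m)⁻¹ * (-(F (r / t) / 4) / t))
    (G'' := fun r => (t ^ m)⁻¹ * (-(deriv F (r / t) / t / 4) / t))
    ((contDiff_radialKernel (contDiff_tailProfile hF) m t).of_le ENat.LEInfty.out)
    (fun y => h1 _) h2
  rw [negLaplacian, Pi.neg_apply]
  change -(Δ (fun y : E => (t ^ m)⁻¹ * tailProfile F (‖y‖ ^ 2 / t)) x) = _
  rw [key, hd, radialKernelDeriv]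
  push_cast
  field_simp
  ring

variable [MeasurableSpace E] [BorelSpace E]

/-- The average `∫ W(x) t^{-m} F(|x|² / t) dx`. -/
def radialMean (F : ℝ → ℝ) (m : ℕ) (W : E → ℝ) (t : ℝ) : ℝ := ∫ x, W x * radialKernel F m t x

include hF hF1 in
lemma hasDerivAt_radialMean {m : ℕ} (hd : finrank ℝ E = 2 * m) {W : E → ℝ} (hW : ContDiff ℝ ∞ W)
    {t : ℝ} (ht : 0 < t) :
    HasDerivAt (radialMean F m W) (-radialMean (tailProfile F) m (negLaplacian W) t) t := by
  have e : -radialMean (tailProfile F) m (negLaplacian W) t =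
      ∫ x, W x * radialKernelDeriv F m t x := by
    rw [radialMean, ← integral_mul_negLaplacian hW
      (contDiff_radialKernel (contDiff_tailProfile hF) m t)
      (hasCompactSupport_radialKernel (tailProfile_eq_zero hF1) m ht), ← integral_neg]
    congr 1
    ext x
    rw [negLaplacian_radialKernel hF hd ht]
    ring
  rw [e]
  set K : Set (ℝ × E) := Icc (t / 2) (2 * t) ×ˢ Metric.closedBall 0 (√(2 * t)) with hK
  have hKc : IsCompact K := isCompact_Icc.prod (isCompact_closedBall _ _)
  have hdc : Continuous (deriv F) := hF.continuous_deriv (by simp)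
  have hcont : ContinuousOn (fun p : ℝ × E => W p.2 * radialKernelDeriv F m p.1 p.2) K := by
    have hpos : ∀ p ∈ K, p.1 ≠ 0 := by
      intro p hp
      have : t / 2 ≤ p.1 := hp.1.1
      linarith
    have hdiv : ContinuousOn (fun p : ℝ × E => ‖p.2‖ ^ 2 / p.1) K :=
      ContinuousOn.div (by fun_prop) (by fun_prop) hpos
    have hFc := hF.continuous.comp_continuousOn hdiv
    have hF'c := hdc.comp_continuousOn hdiv
    refine (hW.continuous.comp continuous_snd).continuousOn.mul (ContinuousOn.neg ?_)
    refine ContinuousOn.mul (ContinuousOn.inv₀ (by fun_prop) fun p hp => pow_ne_zero _ (hpos p hp))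
      (ContinuousOn.add ?_ ?_)
    · exact ContinuousOn.div (continuousOn_const.mul hFc) (by fun_prop) hpos
    · exact ContinuousOn.div (ContinuousOn.mul (by fun_prop) hF'c) (by fun_prop)
        fun p hp => pow_ne_zero _ (hpos p hp)
  obtain ⟨C, hC⟩ := hKc.exists_bound_of_continuousOn hcont
  have hball : Metric.ball t (t / 2) ∈ 𝓝 t := Metric.ball_mem_nhds t (by positivity)
  have hin : ∀ s ∈ Metric.ball t (t / 2), t / 2 < s ∧ s < 2 * t := by
    intro s hs
    rw [Metric.mem_ball, Real.dist_eq, abs_lt] at hs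
    constructor <;> linarith
  refine (hasDerivAt_integral_of_dominated_loc_of_deriv_le
    (bound := (Metric.closedBall (0 : E) (√(2 * t))).indicator fun _ => C) hball
    (F' := fun s x => W x * radialKernelDeriv F m s x) ?_ ?_ ?_ ?_ ?_ ?_).2
  · exact Eventually.of_forall fun s =>
      (hW.continuous.mul (contDiff_radialKernel hF m s).continuous).aestronglyMeasurable
  · exact integrable_mul_of_hasCompactSupport hW.continuous (contDiff_radialKernel hF m t).continuous
      (hasCompactSupport_radialKernel hF1 m ht)
  · refine (hW.continuous.mul ?_).aestronglyMeasurable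
    have := (contDiff_negLaplacian (contDiff_radialKernel (E := E)
      (contDiff_tailProfile hF) m t)).continuous.neg
    refine this.congr fun x => ?_
    rw [Pi.neg_apply, negLaplacian_radialKernel hF hd ht, neg_neg]
  · refine Eventually.of_forall fun x s hs => ?_
    obtain ⟨h1, h2⟩ := hin s hs
    by_cases hx : x ∈ Metric.closedBall (0 : E) (√(2 * t))
    · rw [indicator_of_mem hx]
      exact hC (s, x) ⟨⟨h1.le, h2.le⟩, hx⟩
    · rw [indicator_of_notMem hx]
      rw [mem_closedBall_zero_iff, not_le] at hx
      have hs0 : 0 < s := by linarith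
      have hgt : 1 < ‖x‖ ^ 2 / s := by
        rw [one_lt_div hs0]
        exact h2.trans (Real.lt_sq_of_sqrt_lt hx)
      have hd0 : deriv F (‖x‖ ^ 2 / s) = 0 := by
        have : F =ᶠ[𝓝 (‖x‖ ^ 2 / s)] fun _ => 0 := by
          filter_upwards [Ioi_mem_nhds hgt] with u hu using hF1 u (le_of_lt hu)
        rw [this.deriv_eq]
        simp
      simp [radialKernelDeriv, hF1 _ hgt.le, hd0]
  · exact (integrable_indicator_iff measurableSet_closedBall).2
      (integrableOn_const (isCompact_closedBall _ _).measure_lt_top.ne)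
  · refine Eventually.of_forall fun x s hs => ?_
    exact (hasDerivAt_radialKernel hF m (by linarith [(hin s hs).1]) x).const_mul _

/-- **Pizzetti's formula**: the radial means of a solution of `(-Δ)^j W = 0` are polynomials of degree
less than `j` in the square of the radius. -/
lemma exists_polynomial_radialMean {m : ℕ} (hd : finrank ℝ E = 2 * m) {j : ℕ} {W : E → ℝ}
    (hW : ContDiff ℝ ∞ W) (hWj : negLaplacian^[j] W = 0) {F : ℝ → ℝ} (hF : ContDiff ℝ ∞ F)
    (hF1 : ∀ s, 1 ≤ s → F s = 0) :
    ∃ p ∈ degreeLT ℝ j, ∀ t > 0, radialMean F m W t = p.eval t := by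
  induction j generalizing W F with
  | zero =>
    have : W = 0 := hWj
    exact ⟨0, Submodule.zero_mem _, fun t _ => by simp [radialMean, this]⟩
  | succ j ih =>
    obtain ⟨q, hq, hqe⟩ := ih (contDiff_negLaplacian hW) hWj (contDiff_tailProfile hF)
      (tailProfile_eq_zero hF1)
    obtain ⟨P, hP, hPe⟩ := exists_polynomial_of_hasDerivAt isOpen_Ioi isPreconnected_Ioi
      (Submodule.neg_mem _ hq) (f := radialMean F m W) (S := Ioi 0) fun t ht => by
        rw [eval_neg, ← hqe t ht]; exact hasDerivAt_radialMean hF hF1 hd hW ht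
    exact ⟨P, hP, hPe⟩

include hF hF1 in
/-- The radial means converge to a multiple of the value at the centre as the radius shrinks. -/
lemma tendsto_radialMean {m : ℕ} (hd : finrank ℝ E = 2 * m) {W : E → ℝ} (hW : Continuous W) :
    Tendsto (radialMean F m W) (𝓝[>] 0) (𝓝 (W 0 * ∫ x : E, F (‖x‖ ^ 2))) := by
  have hFn : Continuous fun x : E => F (‖x‖ ^ 2) := hF.continuous.comp (by fun_prop)
  have hz : ∀ x : E, x ∉ Metric.closedBall (0 : E) 1 → F (‖x‖ ^ 2) = 0 := by
    intro x hx
    rw [mem_closedBall_zero_iff, not_le] at hx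
    exact hF1 _ (by nlinarith)
  have hFs : HasCompactSupport fun x : E => F (‖x‖ ^ 2) :=
    HasCompactSupport.intro (isCompact_closedBall 0 1) hz
  obtain ⟨C, hC⟩ := (isCompact_closedBall (0 : E) 1).exists_bound_of_continuousOn hW.continuousOn
  have key : Tendsto (fun t : ℝ => ∫ x : E, W (√t • x) * F (‖x‖ ^ 2)) (𝓝[>] 0)
      (𝓝 (∫ x : E, W 0 * F (‖x‖ ^ 2))) := by
    refine tendsto_integral_filter_of_dominated_convergence (fun x => C * |F (‖x‖ ^ 2)|) ?_ ?_ ?_ ?_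
    · exact Eventually.of_forall fun t =>
        ((hW.comp (continuous_const_smul _)).mul hFn).aestronglyMeasurable
    · filter_upwards [Ioo_mem_nhdsGT one_pos] with t ht
      refine Eventually.of_forall fun x => ?_
      by_cases hx : x ∈ Metric.closedBall (0 : E) 1
      · rw [norm_mul, Real.norm_eq_abs (F _)]
        gcongr
        refine hC _ ?_
        rw [mem_closedBall_zero_iff] at hx ⊢
        rw [norm_smul, Real.norm_of_nonneg (Real.sqrt_nonneg t)]
        have : √t ≤ 1 := Real.sqrt_le_one.2 ht.2.le
        exact mul_le_one₀ this (norm_nonneg _) hx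
      · simp [hz x hx]
    · exact (hFn.abs.integrable_of_hasCompactSupport hFs.abs).const_mul C
    · refine Eventually.of_forall fun x => Tendsto.mul_const _ ?_
      have h1 : Tendsto (fun t : ℝ => √t • x) (𝓝 0) (𝓝 (√0 • x)) :=
        (Real.continuous_sqrt.smul continuous_const).tendsto 0
      rw [Real.sqrt_zero, zero_smul] at h1
      exact (hW.tendsto 0).comp (h1.mono_left nhdsWithin_le_nhds)
  rw [integral_const_mul] at key
  refine key.congr' ?_
  filter_upwards [self_mem_nhdsWithin] with t (ht : 0 < t)
  have hs : 0 < √t := Real.sqrt_pos.2 ht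
  have hsq : √t ^ 2 = t := Real.sq_sqrt ht.le
  have := Measure.integral_comp_smul (volume : Measure E)
    (fun x => W x * F (‖x‖ ^ 2 / t)) (√t)
  rw [hd, pow_mul, hsq, abs_of_pos (by positivity), smul_eq_mul, ← integral_const_mul] at this
  convert! this using 1
  · congr 1
    ext x
    rw [norm_smul, mul_pow, Real.norm_of_nonneg hs.le, hsq, mul_div_cancel_left₀ _ ht.ne']
  · rw [radialMean]
    congr 1
    ext x
    rw [radialKernel]
    ring

include hF hF1 in
/-- Pizzetti's formula, with the constant term identified. -/
lemma exists_polynomial_radialMean_eval_zero {m : ℕ} (hd : finrank ℝ E = 2 * m) {j : ℕ} {W : E → ℝ}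
    (hW : ContDiff ℝ ∞ W) (hWj : negLaplacian^[j] W = 0) :
    ∃ p ∈ degreeLT ℝ j, p.eval 0 = W 0 * (∫ x : E, F (‖x‖ ^ 2)) ∧
      ∀ t > 0, radialMean F m W t = p.eval t := by
  obtain ⟨p, hp, hpe⟩ := exists_polynomial_radialMean hd hW hWj hF hF1
  refine ⟨p, hp, ?_, hpe⟩
  refine tendsto_nhds_unique ?_ (tendsto_radialMean hF hF1 hd hW.continuous)
  have h1 : Tendsto (fun t => p.eval t) (𝓝[>] 0) (𝓝 (p.eval 0)) :=
    (p.continuous.tendsto 0).mono_left nhdsWithin_le_nhds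
  refine h1.congr' ?_
  filter_upwards [self_mem_nhdsWithin] with t ht using (hpe t ht).symm

end kernel

end

/-! ### Liouville's theorem for smooth polyharmonic functions -/

section

open Laplacian InnerProductSpace Module Polynomial

/-- A smooth profile equal to `1` for `s ≤ ½` and to `0` for `s ≥ 1`. -/
def cutoffProfile (s : ℝ) : ℝ := Real.smoothTransition (2 - 2 * s)

lemma contDiff_cutoffProfile : ContDiff ℝ ∞ cutoffProfile := by
  unfold cutoffProfile
  exact Real.smoothTransition.contDiff.comp (by fun_prop)

lemma cutoffProfile_nonneg (s : ℝ) : 0 ≤ cutoffProfile s := Real.smoothTransition.nonneg _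

lemma cutoffProfile_le_one (s : ℝ) : cutoffProfile s ≤ 1 := Real.smoothTransition.le_one _

lemma cutoffProfile_eq_zero (s : ℝ) (hs : 1 ≤ s) : cutoffProfile s = 0 :=
  Real.smoothTransition.zero_of_nonpos (by linarith)

lemma cutoffProfile_eq_one {s : ℝ} (hs : s ≤ 1 / 2) : cutoffProfile s = 1 :=
  Real.smoothTransition.one_of_one_le (by linarith)

lemma eval_eq_sum_of_mem_degreeLT {m : ℕ} {p : ℝ[X]} (hp : p ∈ degreeLT ℝ m) (t : ℝ) :
    p.eval t = ∑ k ∈ Finset.range m, p.coeff k * t ^ k := by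
  by_cases h0 : p = 0
  · simp [h0]
  · exact eval_eq_sum_range' ((natDegree_lt_iff_degree_lt h0).2 (mem_degreeLT.1 hp)) t

lemma abs_eval_le_of_mem_degreeLT {m : ℕ} {p : ℝ[X]} (hp : p ∈ degreeLT ℝ m) {t : ℝ} (ht : 1 ≤ t) :
    |p.eval t| ≤ (∑ k ∈ Finset.range m, |p.coeff k|) * t ^ m := by
  rw [eval_eq_sum_of_mem_degreeLT hp, Finset.sum_mul]
  refine (Finset.abs_sum_le_sum_abs _ _).trans (Finset.sum_le_sum fun k hk => ?_)
  rw [abs_mul, abs_of_nonneg (by positivity : 0 ≤ t ^ k)]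
  gcongr
  exact (Finset.mem_range.1 hk).le

/-- Extrapolation weights: linear functionals on polynomials of degree less than `m` that recover the
value at `0` from the values at `t, 2t, …, mt`. -/
lemma exists_extrapolation (m : ℕ) :
    ∃ α : ℕ → ℝ, ∀ p ∈ degreeLT ℝ m, ∀ t : ℝ,
      ∑ i ∈ Finset.range m, α i * p.eval ((i + 1) * t) = p.eval 0 := by
  set v : ℕ → ℝ := fun i => i + 1 with hv
  have hinj : Set.InjOn v (Finset.range m : Set ℕ) := fun i _ j _ h => by
    simpa [hv] using h
  refine ⟨fun i => (Lagrange.basis (Finset.range m) v i).eval 0, fun p hp t => ?_⟩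
  have hmono : ∀ k < m, ∑ i ∈ Finset.range m,
      (Lagrange.basis (Finset.range m) v i).eval 0 * v i ^ k = (0 : ℝ) ^ k := by
    intro k hk
    have h1 := Lagrange.eq_interpolate (f := (X : ℝ[X]) ^ k) hinj (by
      rw [degree_X_pow, Finset.card_range]; exact_mod_cast hk)
    have h2 := congrArg (Polynomial.eval 0) h1
    rw [Lagrange.interpolate_apply, eval_finsetSum] at h2
    simp only [eval_mul, eval_C, eval_pow, eval_X] at h2
    rw [h2]
    exact Finset.sum_congr rfl fun i _ => mul_comm _ _
  simp_rw [eval_eq_sum_of_mem_degreeLT hp, Finset.mul_sum]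
  rw [Finset.sum_comm]
  refine Finset.sum_congr rfl fun k hk => ?_
  have ht : t ^ k * (0 : ℝ) ^ k = 0 ^ k := by
    rcases Nat.eq_zero_or_pos k with rfl | hk0
    · simp
    · rw [zero_pow hk0.ne', mul_zero]
  rw [← ht, ← hmono k (Finset.mem_range.1 hk), Finset.mul_sum, Finset.mul_sum]
  refine Finset.sum_congr rfl fun i _ => ?_
  rw [mul_pow]
  ring

variable {E : Type*} [NormedAddCommGroup E] [InnerProductSpace ℝ E] [FiniteDimensional ℝ E]
  [MeasurableSpace E] [BorelSpace E]

lemma integral_cutoffProfile_pos : 0 < ∫ x : E, cutoffProfile (‖x‖ ^ 2) := by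
  have hc : Continuous fun x : E => cutoffProfile (‖x‖ ^ 2) :=
    contDiff_cutoffProfile.continuous.comp (by fun_prop)
  refine hc.integral_pos_of_hasCompactSupport_nonneg_nonzero (x := 0) ?_
    (fun x => cutoffProfile_nonneg _) ?_
  · refine HasCompactSupport.intro (isCompact_closedBall 0 1) fun x hx => ?_
    rw [mem_closedBall_zero_iff, not_le] at hx
    exact cutoffProfile_eq_zero _ (by nlinarith)
  · rw [cutoffProfile_eq_one (by norm_num)]
    exact one_ne_zero

/-- Solutions of `(-Δ)^m W = 0` in dimension `2m` are reproduced by convolution with one fixed kernel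
at every scale. -/
lemma exists_reproducing_kernel {m : ℕ} (hd : finrank ℝ E = 2 * m) :
    ∃ η : E → ℝ, ContDiff ℝ ∞ η ∧ HasCompactSupport η ∧
      ∀ W : E → ℝ, ContDiff ℝ ∞ W → negLaplacian^[m] W = 0 → ∀ r > 0,
        conv W (fun z => (r ^ (2 * m))⁻¹ * η (r⁻¹ • z)) = W := by
  obtain ⟨α, hα⟩ := exists_extrapolation m
  set M := ∫ x : E, cutoffProfile (‖x‖ ^ 2) with hM
  have hM0 : M ≠ 0 := integral_cutoffProfile_pos.ne'
  have hF := contDiff_cutoffProfile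
  have hF1 := cutoffProfile_eq_zero
  have hpos : ∀ i : ℕ, (0 : ℝ) < i + 1 := fun i => by positivity
  refine ⟨fun x => ∑ i ∈ Finset.range m, M⁻¹ * α i * radialKernel cutoffProfile m (i + 1) x,
    ?_, ?_, ?_⟩
  · exact ContDiff.sum fun i _ => contDiff_const.mul (contDiff_radialKernel hF m _)
  · refine HasCompactSupport.intro (isCompact_closedBall 0 (√(m : ℝ))) fun x hx => ?_
    rw [mem_closedBall_zero_iff, not_le] at hx
    refine Finset.sum_eq_zero fun i hi => ?_
    rw [radialKernel_eq_zero hF1 m (hpos i), mul_zero]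
    have h1 : (i : ℝ) + 1 ≤ m := by exact_mod_cast Finset.mem_range.1 hi
    exact h1.trans (Real.lt_sq_of_sqrt_lt hx).le
  · intro W hW hWm r hr
    ext x
    have hWx : ContDiff ℝ ∞ fun y => W (y + x) := hW.comp (contDiff_id.add contDiff_const)
    have hWxm : negLaplacian^[m] (fun y => W (y + x)) = 0 := by
      rw [iterate_negLaplacian_comp_add hW, hWm]; rfl
    obtain ⟨p, hp, hp0, hpe⟩ := exists_polynomial_radialMean_eval_zero hF hF1 hd hWx hWxm
    rw [zero_add, ← hM] at hp0
    have hr2 : 0 < r ^ 2 := by positivity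
    have hscale : ∀ (i : ℕ) (z : E),
        (r ^ (2 * m))⁻¹ * radialKernel cutoffProfile m (i + 1) (r⁻¹ • z) =
          radialKernel cutoffProfile m ((i + 1) * r ^ 2) z := by
      intro i z
      rw [radialKernel, radialKernel, norm_smul, mul_pow, norm_inv, Real.norm_of_nonneg hr.le,
        mul_pow, ← pow_mul, mul_inv, ← mul_assoc, mul_comm (r ^ (2 * m))⁻¹]
      congr 2
      field_simp
    have hterm : ∀ i : ℕ, p.eval ((i + 1) * r ^ 2) =
        ∫ y, W y * radialKernel cutoffProfile m ((i + 1) * r ^ 2) (x - y) := by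
      intro i
      rw [← hpe _ (mul_pos (hpos i) hr2), radialMean,
        ← integral_sub_right_eq_self (fun y => W (y + x) * _) x]
      congr 1
      ext y
      rw [sub_add_cancel, radialKernel, radialKernel, norm_sub_rev]
    have hexp : ∀ y : E, W y * ((r ^ (2 * m))⁻¹ * ∑ i ∈ Finset.range m,
        M⁻¹ * α i * radialKernel cutoffProfile m (i + 1) (r⁻¹ • (x - y))) =
        ∑ i ∈ Finset.range m, M⁻¹ * α i *
          (W y * radialKernel cutoffProfile m ((i + 1) * r ^ 2) (x - y)) := by
      intro y
      rw [Finset.mul_sum, Finset.mul_sum]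
      refine Finset.sum_congr rfl fun i _ => ?_
      rw [← hscale]
      ring
    simp only [conv, hexp]
    rw [integral_finsetSum]
    · simp_rw [integral_const_mul, ← hterm, mul_assoc]
      rw [← Finset.mul_sum, hα p hp, hp0]
      field_simp
    · exact fun i _ => (integrable_conv hW.continuous (contDiff_radialKernel hF m _).continuous
        (hasCompactSupport_radialKernel hF1 m (mul_pos (hpos i) hr2)) x).const_mul _

/-- By Pizzetti's formula, a polynomial bound on the positive part of a polyharmonic function in `L¹`
bounds the function itself. -/
lemma exists_integral_abs_le {m : ℕ} (hd : finrank ℝ E = 2 * m) {W : E → ℝ} (hW : ContDiff ℝ ∞ W)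
    (hWm : negLaplacian^[m] W = 0) {A : ℝ} (hA : 0 ≤ A) {K : ℕ}
    (hgr : ∀ R : ℝ, 0 ≤ R → ∫⁻ x in Metric.ball (0 : E) R, ENNReal.ofReal (W x) ≤
      ENNReal.ofReal (A * (1 + R) ^ K)) :
    ∃ A' : ℝ, 0 ≤ A' ∧ ∀ r : ℝ, 1 ≤ r →
      ∫ x in Metric.closedBall (0 : E) r, |W x| ≤ A' * r ^ (K + 4 * m) := by
  have hF := contDiff_cutoffProfile
  have hF1 := cutoffProfile_eq_zero
  obtain ⟨p, hp, -, hpe⟩ := exists_polynomial_radialMean_eval_zero hF hF1 hd hW hWm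
  set P := ∑ k ∈ Finset.range m, |p.coeff k| with hP
  have hP0 : 0 ≤ P := Finset.sum_nonneg fun _ _ => abs_nonneg _
  refine ⟨2 * A * 3 ^ K + P * 4 ^ m, by positivity, fun r hr => ?_⟩
  -- at this scale the cutoff is `1` on the ball of radius `r` and lives in the ball of radius `2r`
  set t := 2 * r ^ 2 with ht
  have ht1 : 1 ≤ t := by nlinarith
  have ht0 : 0 < t := by linarith
  have hWc := hW.continuous
  have hkc : Continuous (radialKernel (E := E) cutoffProfile m t) :=
    (contDiff_radialKernel hF m t).continuous
  have hks : HasCompactSupport (radialKernel (E := E) cutoffProfile m t) :=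
    hasCompactSupport_radialKernel hF1 m ht0
  have hk0 : ∀ x : E, 0 ≤ radialKernel cutoffProfile m t x := fun x =>
    mul_nonneg (by positivity) (cutoffProfile_nonneg _)
  have hk1 : ∀ x : E, radialKernel cutoffProfile m t x ≤ (t ^ m)⁻¹ := fun x =>
    mul_le_of_le_one_right (by positivity) (cutoffProfile_le_one _)
  have hWp : Continuous fun x => max (W x) 0 := hWc.max continuous_const
  have h1 : ∫ x in Metric.ball (0 : E) (2 * r), max (W x) 0 ≤ A * (1 + 2 * r) ^ K := by
    rw [integral_eq_lintegral_of_nonneg_ae (f := fun x => max (W x) 0)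
      (Eventually.of_forall fun x => le_max_right _ _)
      hWp.aestronglyMeasurable]
    refine ENNReal.toReal_le_of_le_ofReal (by positivity) ?_
    refine le_trans (le_of_eq ?_) (hgr (2 * r) (by linarith))
    congr 1
    ext x
    rw [ENNReal.ofReal_max, ENNReal.ofReal_zero]
    simp
  have h2 : ∫ x, max (W x) 0 * radialKernel cutoffProfile m t x ≤
      (t ^ m)⁻¹ * (A * (1 + 2 * r) ^ K) := by
    refine le_trans ?_ (mul_le_mul_of_nonneg_left h1 (by positivity))
    rw [← integral_const_mul, ← integral_indicator measurableSet_ball]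
    refine integral_mono (integrable_mul_of_hasCompactSupport hWp hkc hks) ?_ fun x => ?_
    · rw [integrable_indicator_iff measurableSet_ball]
      have : IntegrableOn (fun x => (t ^ m)⁻¹ * max (W x) 0) (Metric.closedBall (0 : E) (2 * r)) :=
        (continuous_const.mul hWp).continuousOn.integrableOn_compact (isCompact_closedBall _ _)
      exact this.mono_set Metric.ball_subset_closedBall
    · by_cases hx : x ∈ Metric.ball (0 : E) (2 * r)
      · rw [indicator_of_mem hx, mul_comm]
        exact mul_le_mul_of_nonneg_right (hk1 x) (le_max_right _ _)
      · rw [indicator_of_notMem hx]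
        rw [mem_ball_zero_iff, not_lt] at hx
        rw [radialKernel_eq_zero hF1 m ht0 (by nlinarith), mul_zero]
  -- `|W| = 2 W⁺ - W`, and the mean of `W` is a polynomial in `t`
  have h3 : ∫ x, |W x| * radialKernel cutoffProfile m t x =
      2 * (∫ x, max (W x) 0 * radialKernel cutoffProfile m t x) - p.eval t := by
    rw [← hpe t ht0, radialMean, ← integral_const_mul, ← integral_sub]
    · congr 1
      ext x
      have : |W x| = 2 * max (W x) 0 - W x := by
        rcases le_total (W x) 0 with h | h
        · rw [abs_of_nonpos h, max_eq_right h]; ring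
        · rw [abs_of_nonneg h, max_eq_left h]; ring
      rw [this]
      ring
    · exact (integrable_mul_of_hasCompactSupport hWp hkc hks).const_mul 2
    · exact integrable_mul_of_hasCompactSupport hWc hkc hks
  have h4 : (t ^ m)⁻¹ * ∫ x in Metric.closedBall (0 : E) r, |W x| ≤
      ∫ x, |W x| * radialKernel cutoffProfile m t x := by
    rw [← integral_const_mul, ← integral_indicator measurableSet_closedBall]
    refine integral_mono ?_ (integrable_mul_of_hasCompactSupport hWc.abs hkc hks) fun x => ?_
    · rw [integrable_indicator_iff measurableSet_closedBall]
      exact (continuous_const.mul hWc.abs).continuousOn.integrableOn_compact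
        (isCompact_closedBall _ _)
    · by_cases hx : x ∈ Metric.closedBall (0 : E) r
      · rw [indicator_of_mem hx, mul_comm]
        rw [mem_closedBall_zero_iff] at hx
        have : ‖x‖ ^ 2 / t ≤ 1 / 2 := by
          rw [div_le_iff₀ ht0]
          nlinarith [norm_nonneg x]
        rw [radialKernel, cutoffProfile_eq_one this, mul_one]
      · rw [indicator_of_notMem hx]
        exact mul_nonneg (abs_nonneg _) (hk0 x)
  have h5 := abs_eval_le_of_mem_degreeLT hp ht1
  have h6 : (t ^ m)⁻¹ * ∫ x in Metric.closedBall (0 : E) r, |W x| ≤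
      (t ^ m)⁻¹ * (2 * (A * (1 + 2 * r) ^ K) + P * t ^ (2 * m)) := by
    have h7 := neg_abs_le (p.eval t)
    have h8 : (t ^ m)⁻¹ * (P * t ^ (2 * m)) = P * t ^ m := by
      rw [two_mul, pow_add]
      field_simp
    rw [mul_add, h8]
    linarith
  have h9 := le_of_mul_le_mul_left h6 (by positivity)
  refine h9.trans ?_
  have hr0 : 0 ≤ r := by linarith
  have e1 : (1 + 2 * r) ^ K ≤ 3 ^ K * r ^ (K + 4 * m) := by
    calc (1 + 2 * r) ^ K ≤ (3 * r) ^ K := by gcongr; linarith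
      _ = 3 ^ K * r ^ K := mul_pow _ _ _
      _ ≤ 3 ^ K * r ^ (K + 4 * m) := by gcongr; omega
  have e2 : t ^ (2 * m) ≤ 4 ^ m * r ^ (K + 4 * m) := by
    calc t ^ (2 * m) = 4 ^ m * r ^ (4 * m) := by
          rw [ht, mul_pow, ← pow_mul, pow_mul 2 2 m, ← mul_assoc]; norm_num
      _ ≤ 4 ^ m * r ^ (K + 4 * m) := by gcongr; omega
  calc 2 * (A * (1 + 2 * r) ^ K) + P * t ^ (2 * m)
      ≤ 2 * (A * (3 ^ K * r ^ (K + 4 * m))) + P * (4 ^ m * r ^ (K + 4 * m)) := by gcongr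
    _ = _ := by ring

/-- **Liouville's theorem** for polyharmonic functions whose positive part has polynomial growth: high
derivatives vanish. -/
lemma iterate_dirDeriv_eq_zero {m : ℕ} (hd : finrank ℝ E = 2 * m) {W : E → ℝ}
    (hW : ContDiff ℝ ∞ W) (hWm : negLaplacian^[m] W = 0) {A : ℝ} (hA : 0 ≤ A) {K : ℕ}
    (hgr : ∀ R : ℝ, 0 ≤ R → ∫⁻ x in Metric.ball (0 : E) R, ENNReal.ofReal (W x) ≤
      ENNReal.ofReal (A * (1 + R) ^ K)) (h : E) :
    (dirDeriv h)^[K + 4 * m + 1] W = 0 := by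
  obtain ⟨A', hA', hA'r⟩ := exists_integral_abs_le hd hW hWm hA hgr
  obtain ⟨η, hη, hηs, hrep⟩ := exists_reproducing_kernel hd
  set N := K + 4 * m + 1 with hN
  set ξ := (dirDeriv h)^[N] η with hξ
  have hξd : ContDiff ℝ ∞ ξ := contDiff_iterate_dirDeriv hη h N
  have hξs : HasCompactSupport ξ := hasCompactSupport_iterate_dirDeriv hηs h N
  obtain ⟨C, hC⟩ := hξs.exists_bound_of_continuous hξd.continuous
  have hC0 : 0 ≤ C := (norm_nonneg _).trans (hC 0)
  obtain ⟨ρ, hρ⟩ := hξs.isCompact.isBounded.subset_closedBall 0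
  have hρ' : ∀ z : E, |ρ| < ‖z‖ → ξ z = 0 := by
    intro z hz
    refine image_eq_zero_of_notMem_tsupport fun hmem => ?_
    have := hρ hmem
    rw [mem_closedBall_zero_iff] at this
    exact absurd (this.trans (le_abs_self ρ)) (not_le.2 hz)
  ext x
  -- derivatives of the reproduced function fall on the kernel, and each gains a factor `r⁻¹`
  have key : ∀ r : ℝ, 1 + ‖x‖ ≤ r →
      |(dirDeriv h)^[N] W x| ≤ C * A' * (1 + |ρ|) ^ (K + 4 * m) * r⁻¹ := by
    intro r hr
    have hr1 : 1 ≤ r := by linarith [norm_nonneg x]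
    have hr0 : 0 < r := by linarith
    have hηr : ContDiff ℝ ∞ fun z => η (r⁻¹ • z) := hη.comp (contDiff_const_smul _)
    have hηrs : HasCompactSupport fun z => (r ^ (2 * m))⁻¹ * η (r⁻¹ • z) :=
      (hηs.comp_smul (inv_ne_zero hr0.ne')).mul_left
    have e1 : (dirDeriv h)^[N] (fun z => (r ^ (2 * m))⁻¹ * η (r⁻¹ • z)) =
        fun z => (r ^ (2 * m))⁻¹ * ((r⁻¹) ^ N * ξ (r⁻¹ • z)) := by
      have : ∀ k, (dirDeriv h)^[k] (fun z => (r ^ (2 * m))⁻¹ * η (r⁻¹ • z)) =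
          fun z => (r ^ (2 * m))⁻¹ * (dirDeriv h)^[k] (fun z => η (r⁻¹ • z)) z := by
        intro k
        induction k with
        | zero => rfl
        | succ k ih =>
          rw [Function.iterate_succ_apply', ih, dirDeriv_const_mul h _
            (contDiff_iterate_dirDeriv hηr h k), Function.iterate_succ_apply']
      rw [this, iterate_dirDeriv_comp_smul hη]
    have e2 : (dirDeriv h)^[N] W x =
        ∫ y, W y * ((r ^ (2 * m))⁻¹ * ((r⁻¹) ^ N * ξ (r⁻¹ • (x - y)))) := by
      conv_lhs => rw [← hrep W hW hWm r hr0]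
      rw [iterate_dirDeriv_conv hW.continuous (contDiff_const.mul hηr) hηrs, e1]
      rfl
    have hR1 : 1 ≤ (1 + |ρ|) * r := by nlinarith [abs_nonneg ρ]
    have hbd := hA'r ((1 + |ρ|) * r) hR1
    have e3 : |(dirDeriv h)^[N] W x| ≤
        (r⁻¹) ^ N * C * ∫ y in Metric.closedBall (0 : E) ((1 + |ρ|) * r), |W y| := by
      rw [e2, ← integral_const_mul, ← integral_indicator measurableSet_closedBall,
        ← Real.norm_eq_abs]
      refine norm_integral_le_of_norm_le ?_ (Eventually.of_forall fun y => ?_)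
      · rw [integrable_indicator_iff measurableSet_closedBall]
        exact (continuous_const.mul hW.continuous.abs).continuousOn.integrableOn_compact
          (isCompact_closedBall _ _)
      · by_cases hy : y ∈ Metric.closedBall (0 : E) ((1 + |ρ|) * r)
        · rw [indicator_of_mem hy, norm_mul, norm_mul, norm_mul,
            Real.norm_of_nonneg (by positivity : 0 ≤ (r ^ (2 * m))⁻¹),
            Real.norm_of_nonneg (by positivity : 0 ≤ (r⁻¹) ^ N), Real.norm_eq_abs]
          have h1 : (r ^ (2 * m))⁻¹ ≤ 1 := inv_le_one_of_one_le₀ (one_le_pow₀ hr1)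
          calc |W y| * ((r ^ (2 * m))⁻¹ * (r⁻¹ ^ N * ‖ξ (r⁻¹ • (x - y))‖))
              ≤ |W y| * (1 * (r⁻¹ ^ N * C)) := by
                gcongr
                exact hC _
            _ = _ := by ring
        · rw [indicator_of_notMem hy]
          rw [mem_closedBall_zero_iff, not_le] at hy
          have hz : ξ (r⁻¹ • (x - y)) = 0 := by
            apply hρ'
            rw [norm_smul, norm_inv, Real.norm_of_nonneg hr0.le, inv_mul_eq_div, lt_div_iff₀ hr0]
            have := norm_sub_norm_le y x
            rw [norm_sub_rev] at this
            nlinarith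
          simp [hz]
    calc |(dirDeriv h)^[N] W x|
        ≤ (r⁻¹) ^ N * C * (A' * ((1 + |ρ|) * r) ^ (K + 4 * m)) := by
          refine e3.trans ?_
          gcongr
      _ = C * A' * (1 + |ρ|) ^ (K + 4 * m) * r⁻¹ := by
          rw [hN, mul_pow, inv_pow, pow_succ]
          field_simp
  have hlim : Tendsto (fun r : ℝ => C * A' * (1 + |ρ|) ^ (K + 4 * m) * r⁻¹) atTop (𝓝 0) := by
    simpa using tendsto_inv_atTop_zero.const_mul (C * A' * (1 + |ρ|) ^ (K + 4 * m))
  have h0 : |(dirDeriv h)^[N] W x| ≤ 0 := by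
    refine ge_of_tendsto hlim ?_
    filter_upwards [eventually_ge_atTop (1 + ‖x‖)] with r hr using key r hr
  simpa using h0

end

/-! ### Liouville's theorem for distributional solutions -/

section

open Laplacian InnerProductSpace Module Polynomial

variable {E : Type*} [NormedAddCommGroup E] [InnerProductSpace ℝ E] [FiniteDimensional ℝ E]
  [MeasurableSpace E] [BorelSpace E]

lemma ofReal_integral_le_lintegral_ofReal {X : Type*} [MeasurableSpace X] {μ : Measure X}
    {g : X → ℝ} (hg : Integrable g μ) :
    ENNReal.ofReal (∫ x, g x ∂μ) ≤ ∫⁻ x, ENNReal.ofReal (g x) ∂μ := by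
  rw [integral_eq_lintegral_pos_part_sub_lintegral_neg_part hg]
  refine (ENNReal.ofReal_le_ofReal (sub_le_self _ ENNReal.toReal_nonneg)).trans ?_
  exact ENNReal.ofReal_toReal_le

lemma conv_eq_integral_swap (w ξ : E → ℝ) (x : E) : conv w ξ x = ∫ y, ξ y * w (x - y) := by
  rw [conv, ← integral_sub_left_eq_self (fun y => ξ y * w (x - y)) volume x]
  congr 1
  ext y
  rw [sub_sub_cancel, mul_comm]

/-- The mass of the positive part over a ball does not increase under mollification, up to enlarging
the ball. -/
lemma lintegral_ofReal_conv_le {w ξ : E → ℝ} (hw : Continuous w) (hξ : Continuous ξ)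
    (hξs : HasCompactSupport ξ) (hξ0 : ∀ x, 0 ≤ ξ x) (hξ1 : ∫ x, ξ x = 1)
    (hξb : ∀ x : E, 1 ≤ ‖x‖ → ξ x = 0) (R : ℝ) :
    ∫⁻ x in Metric.ball (0 : E) R, ENNReal.ofReal (conv w ξ x) ≤
      ∫⁻ x in Metric.ball (0 : E) (R + 1), ENNReal.ofReal (w x) := by
  have hint : ∀ x, Integrable fun y => ξ y * w (x - y) := fun x => by
    have := integrable_mul_of_hasCompactSupport (f := fun y => w (x - y)) (by fun_prop) hξ hξs
    exact this.congr (Eventually.of_forall fun y => mul_comm _ _)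
  have h1 : ∀ x, ENNReal.ofReal (conv w ξ x) ≤
      ∫⁻ y, ENNReal.ofReal (ξ y) * ENNReal.ofReal (w (x - y)) := by
    intro x
    rw [conv_eq_integral_swap]
    refine (ofReal_integral_le_lintegral_ofReal (hint x)).trans_eq ?_
    congr 1
    ext y
    rw [ENNReal.ofReal_mul (hξ0 y)]
  have hmeas : Measurable fun p : E × E =>
      ENNReal.ofReal (ξ p.2) * ENNReal.ofReal (w (p.1 - p.2)) := by
    have h1 : Measurable fun p : E × E => ENNReal.ofReal (ξ p.2) :=
      (ENNReal.continuous_ofReal.comp (hξ.comp continuous_snd)).measurable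
    have h2 : Measurable fun p : E × E => ENNReal.ofReal (w (p.1 - p.2)) :=
      (ENNReal.continuous_ofReal.comp
        (hw.comp (continuous_fst.sub continuous_snd))).measurable
    exact h1.mul h2
  have hone : ∫⁻ y, ENNReal.ofReal (ξ y) = 1 := by
    rw [← ofReal_integral_eq_lintegral_ofReal (hξ.integrable_of_hasCompactSupport hξs)
      (Eventually.of_forall hξ0), hξ1, ENNReal.ofReal_one]
  set B := ∫⁻ x in Metric.ball (0 : E) (R + 1), ENNReal.ofReal (w x) with hB
  calc ∫⁻ x in Metric.ball (0 : E) R, ENNReal.ofReal (conv w ξ x)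
      ≤ ∫⁻ x in Metric.ball (0 : E) R,
          ∫⁻ y, ENNReal.ofReal (ξ y) * ENNReal.ofReal (w (x - y)) := lintegral_mono fun x => h1 x
    _ = ∫⁻ y, ∫⁻ x in Metric.ball (0 : E) R,
          ENNReal.ofReal (ξ y) * ENNReal.ofReal (w (x - y)) :=
        lintegral_lintegral_swap hmeas.aemeasurable
    _ ≤ ∫⁻ y, ENNReal.ofReal (ξ y) * B := by
        refine lintegral_mono fun y => ?_
        by_cases hy : 1 ≤ ‖y‖
        · simp [hξb y hy]
        rw [not_le] at hy
        simp only
        rw [lintegral_const_mul' _ _ ENNReal.ofReal_ne_top]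
        gcongr
        rw [hB, ← lintegral_indicator measurableSet_ball, ← lintegral_indicator measurableSet_ball,
          ← lintegral_sub_right_eq_self
            ((Metric.ball (0 : E) (R + 1)).indicator fun x => ENNReal.ofReal (w x)) y]
        refine lintegral_mono fun x => ?_
        by_cases hx : x ∈ Metric.ball (0 : E) R
        · rw [indicator_of_mem hx, indicator_of_mem]
          rw [mem_ball_zero_iff] at hx ⊢
          have := norm_sub_le x y
          linarith
        · rw [indicator_of_notMem hx]
          exact zero_le
    _ = B := by
        have hm : Measurable fun y => ENNReal.ofReal (ξ y) :=
          (ENNReal.continuous_ofReal.comp hξ).measurable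
        rw [lintegral_mul_const _ hm, hone, one_mul]

/-- **Liouville's theorem**: a continuous distributional solution of `(-Δ)^m w = 0` in dimension `2m`,
whose positive part has polynomial growth in `L¹`, is a polynomial on every line through the
origin, of bounded degree and with coefficients depending continuously on the direction. -/
theorem exists_continuous_coeff_of_polyharmonic {m : ℕ} (hd : finrank ℝ E = 2 * m) {w : E → ℝ}
    (hw : Continuous w)
    (hweak : ∀ φ : E → ℝ, ContDiff ℝ ∞ φ → HasCompactSupport φ →
      ∫ x, w x * negLaplacian^[m] φ x = 0)
    {A : ℝ} (hA : 0 ≤ A) {K : ℕ}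
    (hgr : ∀ R : ℝ, 0 ≤ R → ∫⁻ x in Metric.ball (0 : E) R, ENNReal.ofReal (w x) ≤
      ENNReal.ofReal (A * (1 + R) ^ K)) :
    ∃ (N : ℕ) (a : ℕ → E → ℝ), (∀ k, Continuous (a k)) ∧
      ∀ (x : E) (t : ℝ), w (t • x) = ∑ k ∈ Finset.range N, a k x * t ^ k := by
  set N := K + 4 * m + 1 with hN
  set v : ℕ → ℝ := fun i => i with hv
  have hinj : Set.InjOn v (Finset.range N : Set ℕ) := fun i _ j _ h => by simpa [hv] using h
  let b : ℕ → ContDiffBump (0 : E) := fun j =>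
    ⟨1 / (2 * ((j : ℝ) + 1)), 1 / ((j : ℝ) + 1), by positivity, by
      apply one_div_lt_one_div_of_lt <;> linarith [(Nat.cast_nonneg j : (0 : ℝ) ≤ j)]⟩
  set ρ : ℕ → E → ℝ := fun j => (b j).normed volume with hρ
  have hρd : ∀ j, ContDiff ℝ ∞ (ρ j) := fun j => (b j).contDiff_normed
  have hρs : ∀ j, HasCompactSupport (ρ j) := fun j => (b j).hasCompactSupport_normed
  have hW0 : ∀ j, negLaplacian^[m] (conv w (ρ j)) = 0 := fun j =>
    iterate_negLaplacian_conv_eq_zero hw (hρd j) (hρs j) hweak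
  have hWgr : ∀ j, ∀ R : ℝ, 0 ≤ R →
      ∫⁻ x in Metric.ball (0 : E) R, ENNReal.ofReal (conv w (ρ j) x) ≤
        ENNReal.ofReal (A * 2 ^ K * (1 + R) ^ K) := by
    intro j R hR
    refine (lintegral_ofReal_conv_le hw (hρd j).continuous (hρs j) (b j).nonneg_normed
      (b j).integral_normed (fun x hx => ?_) R).trans ((hgr (R + 1) (by linarith)).trans ?_)
    · have : x ∉ Function.support (ρ j) := by
        rw [hρ, (b j).support_normed_eq, mem_ball_zero_iff, not_lt]
        change 1 / ((j : ℝ) + 1) ≤ ‖x‖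
        refine le_trans ?_ hx
        rw [div_le_one (by positivity)]
        linarith [(Nat.cast_nonneg j : (0 : ℝ) ≤ j)]
      simpa using this
    · apply ENNReal.ofReal_le_ofReal
      rw [mul_assoc, ← mul_pow]
      gcongr
      linarith
  have hpoly : ∀ j x, ∃ p ∈ degreeLT ℝ N, ∀ t : ℝ, conv w (ρ j) (t • x) = p.eval t := fun j x =>
    exists_polynomial_of_iterate_dirDeriv_eq_zero (contDiff_conv hw (hρd j) (hρs j))
      (iterate_dirDeriv_eq_zero hd (contDiff_conv hw (hρd j) (hρs j)) (hW0 j) (by positivity)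
        (hWgr j) x)
  -- Lagrange interpolation at the nodes `0, …, N - 1` survives the passage to the limit in `j`
  have hlag : ∀ j x (t : ℝ), conv w (ρ j) (t • x) =
      ∑ i ∈ Finset.range N, conv w (ρ j) ((i : ℝ) • x) *
        (Lagrange.basis (Finset.range N) v i).eval t := by
    intro j x t
    obtain ⟨p, hp, hpe⟩ := hpoly j x
    have h1 := Lagrange.eq_interpolate (f := p) hinj (by
      rw [Finset.card_range]; exact mem_degreeLT.1 hp)
    have h2 := congrArg (Polynomial.eval t) h1
    rw [Lagrange.interpolate_apply, eval_finsetSum] at h2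
    simp only [eval_mul, eval_C] at h2
    rw [hpe, h2]
    exact Finset.sum_congr rfl fun i _ => by rw [hpe]
  have hconv : ∀ x, Tendsto (fun j => conv w (ρ j) x) atTop (𝓝 (w x)) := by
    intro x
    have h0 : Tendsto (fun j => (b j).rOut) atTop (𝓝 0) := tendsto_one_div_add_atTop_nhds_zero_nat
    have := ContDiffBump.convolution_tendsto_right_of_continuous (μ := (volume : Measure E))
      h0 hw x
    refine this.congr fun j => ?_
    rw [conv_eq_integral_swap, convolution_lsmul]
    rfl
  have hlim : ∀ x (t : ℝ), w (t • x) = ∑ i ∈ Finset.range N, w ((i : ℝ) • x) *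
        (Lagrange.basis (Finset.range N) v i).eval t := by
    intro x t
    refine tendsto_nhds_unique (hconv _) ?_
    simp_rw [hlag _ x t]
    exact tendsto_finsetSum _ fun i _ => (hconv _).mul_const _
  refine ⟨N, fun k x => ∑ i ∈ Finset.range N, w ((i : ℝ) • x) *
    (Lagrange.basis (Finset.range N) v i).coeff k, fun k => ?_, fun x t => ?_⟩
  · fun_prop
  · rw [hlim]
    simp_rw [Finset.sum_mul]
    rw [Finset.sum_comm]
    refine Finset.sum_congr rfl fun i hi => ?_
    have hb : Lagrange.basis (Finset.range N) v i ∈ degreeLT ℝ N := by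
      rw [mem_degreeLT, Lagrange.degree_basis hinj hi, Finset.card_range]
      exact_mod_cast (by omega : N - 1 < N)
    rw [eval_eq_sum_of_mem_degreeLT hb, Finset.mul_sum]
    exact Finset.sum_congr rfl fun k _ => by ring

end

/-! ### Length of rays in complete metrics -/

section

open Module

variable {n : ℕ}

lemma pathELength_tangentENorm (u : EuclideanSpace ℝ (Fin n) → ℝ) (γ : ℝ → EuclideanSpace ℝ (Fin n))
    (a b : ℝ) :
    letI : ∀ z : EuclideanSpace ℝ (Fin n), ENorm (TangentSpace 𝓘(ℝ, EuclideanSpace ℝ (Fin n)) z) :=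
      tangentENorm u
    Manifold.pathELength 𝓘(ℝ, EuclideanSpace ℝ (Fin n)) γ a b =
      ∫⁻ t in Icc a b, ENNReal.ofReal (Real.exp (u (γ t))) * ‖deriv γ t‖ₑ := by
  let _ : ∀ z : EuclideanSpace ℝ (Fin n), ENorm (TangentSpace 𝓘(ℝ, EuclideanSpace ℝ (Fin n)) z) :=
      tangentENorm u
  rw [Manifold.pathELength]
  congr 1
  ext t
  rw [mfderiv_eq_fderiv]
  rfl

lemma tangentENormSMulClass (u : EuclideanSpace ℝ (Fin n) → ℝ) (z : EuclideanSpace ℝ (Fin n)) :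
    letI := tangentENorm u z
    ENormSMulClass ℝ (TangentSpace 𝓘(ℝ, EuclideanSpace ℝ (Fin n)) z) := by
  let _ := tangentENorm u z
  constructor
  intro r v
  change ENNReal.ofReal (Real.exp (u z)) * ‖r • (id v : EuclideanSpace ℝ (Fin n))‖ₑ =
    ‖r‖ₑ * (ENNReal.ofReal (Real.exp (u z)) * ‖(id v : EuclideanSpace ℝ (Fin n))‖ₑ)
  rw [enorm_smul]
  ring

lemma geodesicDist_le {u : EuclideanSpace ℝ (Fin n) → ℝ} {γ : ℝ → EuclideanSpace ℝ (Fin n)}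
    (hγ : ContDiff ℝ 1 γ) {a b : ℝ} (hab : a ≤ b) :
    geodesicDist u (γ a) (γ b) ≤
      ∫⁻ t in Icc a b, ENNReal.ofReal (Real.exp (u (γ t))) * ‖deriv γ t‖ₑ := by
  let _ : ∀ z : EuclideanSpace ℝ (Fin n), ENorm (TangentSpace 𝓘(ℝ, EuclideanSpace ℝ (Fin n)) z) :=
      tangentENorm u
  have : ∀ z : EuclideanSpace ℝ (Fin n),
      ENormSMulClass ℝ (TangentSpace 𝓘(ℝ, EuclideanSpace ℝ (Fin n)) z) :=
    tangentENormSMulClass u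
  rw [← pathELength_tangentENorm]
  exact Manifold.riemannianEDist_le_pathELength hγ.contMDiff.contMDiffOn rfl rfl hab

/-- A point outside the unit ball about `a` is at `g`-distance at least `inf_{B_1(a)} e^u` from `a`: any
curve between them has a final piece that crosses the unit ball. -/
lemma le_geodesicDist {u : EuclideanSpace ℝ (Fin n) → ℝ} {a y : EuclideanSpace ℝ (Fin n)} {c : ℝ}
    (hc : ∀ z ∈ Metric.closedBall a 1, c ≤ u z) (hy : 1 ≤ ‖y - a‖) :
    ENNReal.ofReal (Real.exp c) ≤ geodesicDist u y a := by
  let _ : ∀ z : EuclideanSpace ℝ (Fin n), ENorm (TangentSpace 𝓘(ℝ, EuclideanSpace ℝ (Fin n)) z) :=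
    tangentENorm u
  refine le_of_forall_gt fun r hr => ?_
  obtain ⟨γ, h0, h1, hγ, hlen⟩ := Manifold.exists_lt_of_riemannianEDist_lt hr
  refine lt_of_le_of_lt ?_ hlen
  rw [contMDiffOn_iff_contDiffOn] at hγ
  have hγc : ContinuousOn γ (Icc 0 1) := hγ.continuousOn
  -- the last time at which the curve is outside the unit ball
  set S : Set ℝ := Icc 0 1 ∩ (fun t => ‖γ t - a‖) ⁻¹' Ici 1 with hS
  have hSc : IsCompact S := isCompact_Icc.of_isClosed_subset
    ((hγc.sub continuousOn_const).norm.preimage_isClosed_of_isClosed isClosed_Icc isClosed_Ici)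
    inter_subset_left
  have hSne : S.Nonempty := ⟨0, ⟨le_rfl, zero_le_one⟩, by simpa [h0] using hy⟩
  obtain ⟨t₀, ⟨ht₀, ht₀'⟩, hmax⟩ := hSc.exists_isGreatest hSne
  have hafter : ∀ t ∈ Ioc t₀ 1, ‖γ t - a‖ < 1 := by
    intro t ht
    by_contra hcon
    exact absurd (hmax ⟨⟨ht₀.1.trans ht.1.le, ht.2⟩, not_lt.1 hcon⟩) (not_le.2 ht.1)
  calc ENNReal.ofReal (Real.exp c)
      ≤ ENNReal.ofReal (Real.exp c) * ‖γ 1 - γ t₀‖ₑ := by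
        refine le_mul_of_one_le_right zero_le ?_
        rw [h1, enorm_sub_rev, ← ofReal_norm]
        exact ENNReal.one_le_ofReal.2 ht₀'
    _ ≤ ENNReal.ofReal (Real.exp c) * ∫⁻ t in Icc t₀ 1, ‖deriv γ t‖ₑ := by
        gcongr
        exact enorm_sub_le_lintegral_deriv_of_contDiffOn_Icc
          (hγ.mono (Icc_subset_Icc_left ht₀.1)) ht₀.2
    _ = ∫⁻ t in Ioc t₀ 1, ENNReal.ofReal (Real.exp c) * ‖deriv γ t‖ₑ := by
        rw [lintegral_const_mul' _ _ ENNReal.ofReal_ne_top, restrict_Ioc_eq_restrict_Icc]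
    _ ≤ ∫⁻ t in Ioc t₀ 1, ENNReal.ofReal (Real.exp (u (γ t))) * ‖deriv γ t‖ₑ := by
        refine setLIntegral_mono' measurableSet_Ioc fun t ht => ?_
        gcongr
        apply hc
        rw [mem_closedBall_iff_norm]
        exact (hafter t ht).le
    _ ≤ ∫⁻ t in Icc 0 1, ENNReal.ofReal (Real.exp (u (γ t))) * ‖deriv γ t‖ₑ :=
        lintegral_mono_set (Ioc_subset_Icc_self.trans (Icc_subset_Icc_left ht₀.1))
    _ = _ := (pathELength_tangentENorm u γ 0 1).symm

/-- In a complete metric, rays to infinity have infinite length. -/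
lemma IsCompleteMetric.lintegral_ray_eq_top {u : EuclideanSpace ℝ (Fin n) → ℝ} (hu : Continuous u)
    (hc : IsCompleteMetric u) {x : EuclideanSpace ℝ (Fin n)} (hx : x ≠ 0) :
    ∫⁻ t in Ioi (1 : ℝ), ENNReal.ofReal (Real.exp (u (t • x))) = ⊤ := by
  by_contra hfin
  set ν : Measure ℝ := (volume.restrict (Ioi (1 : ℝ))).withDensity fun t =>
    ENNReal.ofReal (Real.exp (u (t • x))) with hν
  have hfinν : IsFiniteMeasure ν := isFiniteMeasure_withDensity hfin
  have hleν : ∀ s : Set ℝ, MeasurableSet s → s ⊆ Ioi 1 →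
      ∫⁻ t in s, ENNReal.ofReal (Real.exp (u (t • x))) = ν s := by
    intro s hs hs1
    rw [hν, withDensity_apply _ hs, Measure.restrict_restrict hs, inter_eq_left.2 hs1]
  have htail : Tendsto (fun N : ℕ => ν (Ioi (N : ℝ))) atTop (𝓝 0) := by
    have h := tendsto_measure_iInter_atTop (μ := ν) (s := fun N : ℕ => Ioi (N : ℝ))
      (fun N => measurableSet_Ioi.nullMeasurableSet)
      (fun i j hij => Ioi_subset_Ioi (Nat.cast_le.2 hij)) ⟨0, measure_ne_top _ _⟩
    have he : ⋂ N : ℕ, Ioi (N : ℝ) = ∅ := by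
      ext t
      simp only [mem_iInter, mem_Ioi, mem_empty_iff_false, iff_false, not_forall, not_lt]
      exact exists_nat_ge t
    rwa [he, measure_empty] at h
  have htail' : Tendsto (fun N : ℕ => ‖x‖ₑ * ν (Ioi (N : ℝ))) atTop (𝓝 0) := by
    have := ENNReal.Tendsto.const_mul (a := ‖x‖ₑ) htail (Or.inr (by simp))
    rwa [mul_zero] at this
  set y : ℕ → EuclideanSpace ℝ (Fin n) := fun k => ((k : ℝ) + 2) • x with hy
  have hder : ∀ t : ℝ, deriv (fun t : ℝ => t • x) t = x := fun t => by
    simpa using ((hasDerivAt_id t).smul_const x).deriv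
  have hdist : ∀ N j k : ℕ, N ≤ j → j ≤ k →
      geodesicDist u (y j) (y k) ≤ ‖x‖ₑ * ν (Ioi (N : ℝ)) := by
    intro N j k hNj hjk
    have hjk' : (j : ℝ) + 2 ≤ k + 2 := by simpa using hjk
    have hNj' : (N : ℝ) ≤ j := Nat.cast_le.2 hNj
    have hj0 : (0 : ℝ) ≤ j := Nat.cast_nonneg j
    refine (geodesicDist_le (u := u) (γ := fun t : ℝ => t • x) (by fun_prop) hjk').trans ?_
    simp only [hder]
    rw [lintegral_mul_const' _ _ (by simp), mul_comm, hleν _ measurableSet_Icc]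
    · gcongr
      intro t ht
      have : (j : ℝ) + 2 ≤ t := ht.1
      exact lt_of_lt_of_le (by linarith) this
    · intro t ht
      have : (j : ℝ) + 2 ≤ t := ht.1
      exact lt_of_lt_of_le (by linarith) this
  have hsymm : ∀ p q, geodesicDist u p q = geodesicDist u q p := by
    intro p q
    let _ : ∀ z : EuclideanSpace ℝ (Fin n), ENorm (TangentSpace 𝓘(ℝ, EuclideanSpace ℝ (Fin n)) z) :=
      tangentENorm u
    have : ∀ z : EuclideanSpace ℝ (Fin n),
        ENormSMulClass ℝ (TangentSpace 𝓘(ℝ, EuclideanSpace ℝ (Fin n)) z) :=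
      tangentENormSMulClass u
    exact Manifold.riemannianEDist_comm
  obtain ⟨a, ha⟩ := hc y fun ε hε => by
    obtain ⟨N, hN⟩ := (htail'.eventually_lt_const hε).exists
    refine ⟨N, fun j hj k hk => ?_⟩
    rcases le_total j k with h | h
    · exact (hdist N j k hj h).trans_lt hN
    · rw [hsymm]; exact (hdist N k j hk h).trans_lt hN
  obtain ⟨z₀, -, hz₀⟩ := (isCompact_closedBall a 1).exists_isMinOn ⟨a, by simp⟩ hu.continuousOn
  have hfar : ∀ᶠ k in atTop, 1 ≤ ‖y k - a‖ := by
    have hx0 : 0 < ‖x‖ := norm_pos_iff.2 hx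
    have h1 : Tendsto (fun k : ℕ => ((k : ℝ) + 2) * ‖x‖ - ‖a‖) atTop atTop :=
      tendsto_atTop_add_const_right _ _ ((tendsto_atTop_add_const_right _ _
        tendsto_natCast_atTop_atTop).atTop_mul_const hx0)
    filter_upwards [h1.eventually_ge_atTop 1] with k hk
    refine hk.trans ?_
    have := norm_sub_norm_le (y k) a
    rw [hy] at this ⊢
    rwa [norm_smul, Real.norm_of_nonneg (by positivity)] at this
  have hpos : 0 < ENNReal.ofReal (Real.exp (u z₀)) := ENNReal.ofReal_pos.2 (Real.exp_pos _)
  obtain ⟨k, hk1, hk2⟩ := ((ha.eventually_lt_const hpos).and hfar).exists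
  exact absurd hk1 (not_lt.2 (le_geodesicDist (fun z hz => hz₀ hz) hk2))

section Rays

variable {E : Type*} [NormedAddCommGroup E] [InnerProductSpace ℝ E] [FiniteDimensional ℝ E]
  [MeasurableSpace E] [BorelSpace E]

lemma setLIntegral_ball_comp_smul {F : E → ℝ≥0∞} (hF : Measurable F) {t : ℝ} (ht : 0 < t) (r : ℝ) :
    ∫⁻ x in Metric.ball (0 : E) r, F (t • x) =
      ENNReal.ofReal ((t ^ finrank ℝ E)⁻¹) * ∫⁻ x in Metric.ball (0 : E) (t * r), F x := by
  have h1 := Measure.map_addHaar_smul (volume : Measure E) ht.ne'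
  rw [← lintegral_indicator measurableSet_ball, ← lintegral_indicator measurableSet_ball,
    ← abs_of_pos (by positivity : 0 < (t ^ finrank ℝ E)⁻¹), ← smul_eq_mul,
    ← lintegral_smul_measure, ← h1, lintegral_map (hF.indicator measurableSet_ball)
      (measurable_const_smul t)]
  congr 1
  ext x
  have : x ∈ Metric.ball (0 : E) r ↔ t • x ∈ Metric.ball (0 : E) (t * r) := by
    rw [mem_ball_zero_iff, mem_ball_zero_iff, norm_smul, Real.norm_of_nonneg ht.le,
      mul_lt_mul_iff_right₀ ht]
  by_cases hx : x ∈ Metric.ball (0 : E) r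
  · rw [indicator_of_mem hx, indicator_of_mem (this.1 hx)]
  · rw [indicator_of_notMem hx, indicator_of_notMem (fun h => hx (this.2 h))]

lemma lintegral_Ioi_inv_sq_lt_top : ∫⁻ t in Ioi (1 : ℝ), ENNReal.ofReal ((t ^ 2)⁻¹) < ⊤ := by
  have h : IntegrableOn (fun t : ℝ => (t ^ 2)⁻¹) (Ioi 1) := by
    have := integrableOn_Ioi_rpow_of_lt (a := -2) (by norm_num) (zero_lt_one' ℝ)
    refine this.congr_fun (fun t ht => ?_) measurableSet_Ioi
    have : (0 : ℝ) < t := lt_trans one_pos ht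
    simp only
    rw [Real.rpow_neg this.le]
    norm_cast
  exact h.lintegral_lt_top

/-- If the mass of `F ≥ 0` on balls of radius `R` is `O(R^K)`, then `F` is integrable against `t^{-q} dt`
along almost every ray as soon as `q + dim E ≥ K + 2`: integrate over the directions in a ball, and
rescale. -/
lemma ae_lintegral_ray_lt_top {F : E → ℝ≥0∞} (hF : Measurable F) {C : ℝ} {K q : ℕ}
    (hgr : ∀ R : ℝ, 1 ≤ R → ∫⁻ x in Metric.ball (0 : E) R, F x ≤ ENNReal.ofReal (C * R ^ K))
    (hq : K + 2 ≤ q + finrank ℝ E) :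
    ∀ᵐ x : E, ∫⁻ t in Ioi (1 : ℝ), ENNReal.ofReal ((t ^ q)⁻¹) * F (t • x) < ⊤ := by
  have hmeas : Measurable fun p : E × ℝ => ENNReal.ofReal ((p.2 ^ q)⁻¹) * F (p.2 • p.1) := by
    have h1 : Measurable fun p : E × ℝ => p.2 • p.1 := (continuous_snd.smul continuous_fst).measurable
    exact (by fun_prop : Measurable fun p : E × ℝ => ENNReal.ofReal ((p.2 ^ q)⁻¹)).mul (hF.comp h1)
  have key : ∀ j : ℕ, ∀ᵐ x ∂(volume.restrict (Metric.ball (0 : E) (j + 1))),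
      ∫⁻ t in Ioi (1 : ℝ), ENNReal.ofReal ((t ^ q)⁻¹) * F (t • x) < ⊤ := by
    intro j
    refine ae_lt_top (Measurable.lintegral_prod_right' hmeas) (ne_of_lt ?_)
    rw [lintegral_lintegral_swap hmeas.aemeasurable]
    have hb : ∀ t ∈ Ioi (1 : ℝ), ∫⁻ x in Metric.ball (0 : E) (j + 1),
        ENNReal.ofReal ((t ^ q)⁻¹) * F (t • x) ≤
          ENNReal.ofReal (|C| * (j + 1) ^ K) * ENNReal.ofReal ((t ^ 2)⁻¹) := by
      intro t ht
      have ht1 : (1 : ℝ) < t := ht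
      have ht0 : (0 : ℝ) < t := by linarith
      rw [lintegral_const_mul' _ _ ENNReal.ofReal_ne_top, setLIntegral_ball_comp_smul hF ht0]
      have hR : 1 ≤ t * ((j : ℝ) + 1) := by
        have : (0 : ℝ) ≤ j := Nat.cast_nonneg j
        nlinarith
      refine (mul_le_mul_right (mul_le_mul_right (hgr _ hR) _) _).trans ?_
      rw [← ENNReal.ofReal_mul (by positivity), ← ENNReal.ofReal_mul (by positivity),
        ← ENNReal.ofReal_mul (by positivity)]
      apply ENNReal.ofReal_le_ofReal
      obtain ⟨l, hl⟩ := Nat.exists_eq_add_of_le hq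
      calc (t ^ q)⁻¹ * ((t ^ finrank ℝ E)⁻¹ * (C * (t * (j + 1)) ^ K))
          ≤ (t ^ q)⁻¹ * ((t ^ finrank ℝ E)⁻¹ * (|C| * (t * (j + 1)) ^ K)) := by
            gcongr
            exact le_abs_self C
        _ = |C| * (j + 1) ^ K * ((t ^ 2)⁻¹ * (t ^ l)⁻¹) := by
            rw [← mul_assoc, ← mul_inv, ← pow_add, hl, pow_add, pow_add, mul_pow]
            field_simp
        _ ≤ |C| * (j + 1) ^ K * ((t ^ 2)⁻¹ * 1) := by
            gcongr
            exact inv_le_one_of_one_le₀ (one_le_pow₀ ht1.le)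
        _ = _ := by rw [mul_one]
    refine (setLIntegral_mono' measurableSet_Ioi hb).trans_lt ?_
    rw [lintegral_const_mul' _ _ ENNReal.ofReal_ne_top]
    exact ENNReal.mul_lt_top ENNReal.ofReal_lt_top lintegral_Ioi_inv_sq_lt_top
  have hall : ∀ᵐ x : E, ∀ j : ℕ, x ∈ Metric.ball (0 : E) (j + 1) →
      ∫⁻ t in Ioi (1 : ℝ), ENNReal.ofReal ((t ^ q)⁻¹) * F (t • x) < ⊤ :=
    ae_all_iff.2 fun j => (ae_restrict_iff' measurableSet_ball).1 (key j)
  filter_upwards [hall] with x hx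
  obtain ⟨j, hj⟩ := exists_nat_gt ‖x‖
  exact hx j (by rw [mem_ball_zero_iff]; linarith)

end Rays

end

/-! ### Integrability along rays -/

section

open Module Asymptotics

section Polynomials

/-- A polynomial of positive degree `d` with positive leading coefficient outgrows every sublinear
perturbation. -/
lemma tendsto_sum_pow_add_atTop {a : ℕ → ℝ} {N d : ℕ} (hd : 1 ≤ d) (hdN : d < N) (ha : 0 < a d)
    (hk : ∀ k, d < k → k < N → a k = 0) {s : ℝ → ℝ} (hs : s =o[atTop] fun t : ℝ => t) :
    Tendsto (fun t : ℝ => ∑ k ∈ Finset.range N, a k * t ^ k + s t) atTop atTop := by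
  have hs' : s =o[atTop] fun t : ℝ => t ^ d := by
    refine hs.trans_isBigO (IsBigO.of_bound 1 ?_)
    filter_upwards [eventually_ge_atTop 1] with t ht
    rw [one_mul, norm_pow]
    have : 1 ≤ ‖t‖ := by rwa [Real.norm_of_nonneg (by linarith)]
    exact le_self_pow₀ this (by omega)
  have hrest : (fun t : ℝ => ∑ k ∈ (Finset.range N).erase d, a k * t ^ k) =o[atTop]
      fun t : ℝ => t ^ d := by
    refine IsLittleO.fun_sum fun k hk' => ?_
    rw [Finset.mem_erase, Finset.mem_range] at hk'
    rcases lt_or_gt_of_ne hk'.1 with h | h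
    · exact (isLittleO_pow_pow_atTop_of_lt h).const_mul_left _
    · simp only [hk k h hk'.2, zero_mul]
      exact isLittleO_zero _ _
  have hlead : Tendsto (fun t : ℝ => a d * t ^ d) atTop atTop :=
    (tendsto_pow_atTop (by omega)).const_mul_atTop ha
  have heq : (fun t : ℝ => a d * t ^ d + (∑ k ∈ (Finset.range N).erase d, a k * t ^ k + s t))
      ~[atTop] fun t : ℝ => a d * t ^ d :=
    IsEquivalent.refl.add_isLittleO ((hrest.add hs').const_mul_right ha.ne')
  refine (heq.symm.tendsto_atTop hlead).congr fun t => ?_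
  rw [← Finset.add_sum_erase _ _ (Finset.mem_range.2 hdN), add_assoc]

end Polynomials

section Rays

variable {E : Type*} [NormedAddCommGroup E] [InnerProductSpace ℝ E] [FiniteDimensional ℝ E]
  [MeasurableSpace E] [BorelSpace E]

lemma ae_integrableOn_ray_exp_abs_sub_one (hE : 2 ≤ finrank ℝ E) {g : E → ℝ} (hg : Continuous g)
    {ρ : ℝ} (hρ : IntegrableOn (fun x => Real.exp |g x| - 1) {x | ρ < ‖x‖}) :
    ∀ᵐ x : E, x ≠ 0 → ∃ T : ℝ, 1 ≤ T ∧
      IntegrableOn (fun t : ℝ => Real.exp |g (t • x)| - 1) (Ioi T) := by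
  have hS : MeasurableSet {x : E | ρ < ‖x‖} := measurableSet_lt measurable_const measurable_norm
  have hc : Continuous fun x => Real.exp |g x| - 1 := by fun_prop
  have hm : Measurable ({x : E | ρ < ‖x‖}.indicator fun x => ENNReal.ofReal (Real.exp |g x| - 1)) :=
    hc.measurable.ennreal_ofReal.indicator hS
  have hfin : ∫⁻ x in {x : E | ρ < ‖x‖}, ENNReal.ofReal (Real.exp |g x| - 1) < ⊤ :=
    hρ.lintegral_lt_top
  filter_upwards [ae_lintegral_ray_lt_top (K := 0) (q := 0) hm
    (C := (∫⁻ x in {x : E | ρ < ‖x‖}, ENNReal.ofReal (Real.exp |g x| - 1)).toReal)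
    (fun R _ => by
      rw [pow_zero, mul_one, ENNReal.ofReal_toReal hfin.ne, ← lintegral_indicator hS]
      exact setLIntegral_le_lintegral _ _) (by omega)] with x hx hx0
  have hx0' : 0 < ‖x‖ := norm_pos_iff.2 hx0
  refine ⟨max 1 (ρ / ‖x‖), le_max_left _ _, ?_⟩
  have hc' : Continuous fun t : ℝ => Real.exp |g (t • x)| - 1 := by fun_prop
  refine ⟨hc'.aestronglyMeasurable, ?_⟩
  rw [hasFiniteIntegral_iff_ofReal (Eventually.of_forall fun t => by simp)]
  refine lt_of_le_of_lt ?_ hx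
  refine (setLIntegral_mono' measurableSet_Ioi fun t ht => ?_).trans
    (lintegral_mono_set (Ioi_subset_Ioi (le_max_left _ _)))
  have ht1 : 1 < t := (le_max_left _ _).trans_lt ht
  have ht2 : ρ / ‖x‖ < t := (le_max_right _ _).trans_lt ht
  have : t • x ∈ {x : E | ρ < ‖x‖} := by
    rw [mem_ofPred_eq, norm_smul, Real.norm_of_nonneg (by linarith)]
    rwa [div_lt_iff₀ hx0'] at ht2
  rw [indicator_of_mem this]
  simp

/-- A ray along which `u ≤ D - β log t + |g|` with `β > 1` and `e^{|g|} - 1` integrable has finite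
length, so it cannot exist in a complete metric. -/
lemma IsCompleteMetric.not_eventually_le {n : ℕ} {u : EuclideanSpace ℝ (Fin n) → ℝ}
    (hu : Continuous u) (hc : IsCompleteMetric u) {x : EuclideanSpace ℝ (Fin n)} (hx : x ≠ 0)
    {g : ℝ → ℝ} {T D β : ℝ} (hg : IntegrableOn (fun t : ℝ => Real.exp |g t| - 1) (Ioi T))
    (hβ : 1 < β) : ¬ ∀ᶠ t : ℝ in atTop, u (t • x) ≤ D - β * Real.log t + |g t| := by
  intro hle
  obtain ⟨T₁, hT₁⟩ := eventually_atTop.1 hle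
  set T₂ := max 1 (max T T₁) with hT₂
  have h1T : 1 ≤ T₂ := le_max_left _ _
  have hTT : T ≤ T₂ := (le_max_left _ _).trans (le_max_right _ _)
  have hT1T : T₁ ≤ T₂ := (le_max_right _ _).trans (le_max_right _ _)
  have hcont : Continuous fun t : ℝ => Real.exp (u (t • x)) := by fun_prop
  have htop := hc.lintegral_ray_eq_top hu hx
  rw [← Ioc_union_Ioi_eq_Ioi h1T] at htop
  have h1 : ∫⁻ t in Ioc 1 T₂, ENNReal.ofReal (Real.exp (u (t • x))) < ⊤ :=
    ((hcont.integrableOn_Icc (a := 1) (b := T₂)).mono_set Ioc_subset_Icc_self).lintegral_lt_top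
  have h2 : ∫⁻ t in Ioi T₂, ENNReal.ofReal (Real.exp (u (t • x))) < ⊤ := by
    have hi : IntegrableOn (fun t : ℝ => Real.exp D * (t ^ (-β) + (Real.exp |g t| - 1))) (Ioi T₂) :=
      ((integrableOn_Ioi_rpow_of_lt (by linarith) (by linarith)).add
        (hg.mono_set (Ioi_subset_Ioi hTT))).const_mul _
    refine lt_of_le_of_lt (setLIntegral_mono' measurableSet_Ioi fun t ht => ?_) hi.lintegral_lt_top
    have ht' : T₂ < t := ht
    have ht0 : 0 < t := by linarith
    apply ENNReal.ofReal_le_ofReal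
    have hp1 : t ^ (-β) ≤ 1 := Real.rpow_le_one_of_one_le_of_nonpos (by linarith) (by linarith)
    have hp0 : 0 ≤ t ^ (-β) := Real.rpow_nonneg ht0.le _
    have hE0 : 0 ≤ Real.exp |g t| - 1 := by simp
    calc Real.exp (u (t • x)) ≤ Real.exp (D - β * Real.log t + |g t|) :=
          Real.exp_le_exp.2 (hT₁ t (by linarith))
      _ = Real.exp D * (t ^ (-β) * Real.exp |g t|) := by
          rw [Real.rpow_def_of_pos ht0, ← Real.exp_add, ← Real.exp_add]
          ring_nf
      _ ≤ _ := by
          gcongr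
          nlinarith
  refine absurd htop (ne_of_lt ?_)
  exact (lintegral_union_le _ _ _).trans_lt (ENNReal.add_lt_top.2 ⟨h1, h2⟩)

/-- If `U` is, up to an integrable error `e^{|g|} - 1`, at least `q log t`, then `e^U t^{-q}` is not
integrable at infinity. -/
lemma not_eventually_ge_of_lintegral_lt_top {U g : ℝ → ℝ} (hg : Measurable g) {T : ℝ} {q : ℕ}
    (hgi : IntegrableOn (fun t : ℝ => Real.exp |g t| - 1) (Ioi T))
    (hU : ∫⁻ t in Ioi (1 : ℝ), ENNReal.ofReal ((t ^ q)⁻¹) * ENNReal.ofReal (Real.exp (U t)) < ⊤) :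
    ¬ ∀ᶠ t : ℝ in atTop, q * Real.log t - |g t| ≤ U t := by
  intro hle
  obtain ⟨T₁, hT₁⟩ := eventually_atTop.1 hle
  set T₂ := max 1 (max T T₁) with hT₂
  have h1T : 1 ≤ T₂ := le_max_left _ _
  have hTT : T ≤ T₂ := (le_max_left _ _).trans (le_max_right _ _)
  have hT1T : T₁ ≤ T₂ := (le_max_right _ _).trans (le_max_right _ _)
  have hgm : Measurable fun t : ℝ => ENNReal.ofReal (Real.exp |g t| - 1) := by fun_prop
  have hone : ∫⁻ _t in Ioi T₂, (1 : ℝ≥0∞) = ⊤ := by simp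
  refine absurd hone (ne_of_lt ?_)
  calc ∫⁻ _t in Ioi T₂, (1 : ℝ≥0∞)
      ≤ ∫⁻ t in Ioi T₂, (ENNReal.ofReal (Real.exp |g t| - 1) +
          ENNReal.ofReal ((t ^ q)⁻¹) * ENNReal.ofReal (Real.exp (U t))) := by
        refine setLIntegral_mono' measurableSet_Ioi fun t ht => ?_
        have ht' : T₂ < t := ht
        have ht0 : 0 < t := by linarith
        have hE0 : 0 ≤ Real.exp |g t| - 1 := by simp
        rw [← ENNReal.ofReal_mul (by positivity), ← ENNReal.ofReal_add hE0 (by positivity),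
          ← ENNReal.ofReal_one]
        apply ENNReal.ofReal_le_ofReal
        have h1 : Real.exp (-|g t|) ≤ (t ^ q)⁻¹ * Real.exp (U t) := by
          rw [← Real.exp_log ht0, ← Real.exp_nat_mul, ← Real.exp_neg, ← Real.exp_add,
            Real.exp_le_exp, Real.exp_log ht0]
          linarith [hT₁ t (by linarith)]
        have h2 := Real.add_one_le_exp (-|g t|)
        have h3 := Real.add_one_le_exp |g t|
        linarith
    _ = (∫⁻ t in Ioi T₂, ENNReal.ofReal (Real.exp |g t| - 1)) +
          ∫⁻ t in Ioi T₂, ENNReal.ofReal ((t ^ q)⁻¹) * ENNReal.ofReal (Real.exp (U t)) :=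
        lintegral_add_left hgm _
    _ < ⊤ := ENNReal.add_lt_top.2
        ⟨(hgi.mono_set (Ioi_subset_Ioi hTT)).lintegral_lt_top,
          (lintegral_mono_set (Ioi_subset_Ioi h1T)).trans_lt hU⟩

end Rays

end

/-! ### Growth of integrals over balls -/

section

open Module Asymptotics

section VolumeGrowth

variable {E : Type*} [NormedAddCommGroup E] [InnerProductSpace ℝ E] [FiniteDimensional ℝ E]
  [MeasurableSpace E] [BorelSpace E]

lemma eventually_cocompact_iff_norm {P : E → Prop} :
    (∀ᶠ x in cocompact E, P x) ↔ ∃ r : ℝ, ∀ x, r ≤ ‖x‖ → P x := by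
  rw [← Metric.cobounded_eq_cocompact, ← comap_norm_atTop, eventually_comap, eventually_atTop]
  exact ⟨fun ⟨r, h⟩ => ⟨r, fun x hx => h _ hx x rfl⟩,
    fun ⟨r, h⟩ => ⟨r, fun b hb x hx => h x (hx ▸ hb)⟩⟩

lemma lintegral_ball_norm_rpow (hE : 0 < finrank ℝ E) {γ : ℝ} (hγ : 0 < γ) :
    ∃ C : ℝ, 0 ≤ C ∧ ∀ R : ℝ, 0 < R →
      ∫⁻ x in Metric.ball (0 : E) R, ENNReal.ofReal (‖x‖ ^ (γ - finrank ℝ E)) =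
        ENNReal.ofReal (C * R ^ γ) := by
  have : Nontrivial E := finrank_pos_iff.1 hE
  have hfin : ∫⁻ x in Metric.ball (0 : E) 1, ENNReal.ofReal (‖x‖ ^ (γ - finrank ℝ E)) < ⊤ := by
    refine Integrable.lintegral_lt_top ?_
    change IntegrableOn _ _ _
    rw [integrableOn_fun_norm_addHaar (volume : Measure E)
      (f := fun r : ℝ => r ^ (γ - finrank ℝ E))]
    have h := (intervalIntegral.integrableOn_Ioo_rpow_iff (s := γ - 1) one_pos).2 (by linarith)
    refine h.congr_fun (fun r hr => ?_) measurableSet_Ioo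
    have hr0 : 0 < r := hr.1
    simp only [smul_eq_mul]
    rw [← Real.rpow_natCast, ← Real.rpow_add hr0, Nat.cast_sub hE]
    congr 1
    push_cast
    ring
  refine ⟨(∫⁻ x in Metric.ball (0 : E) 1, ENNReal.ofReal (‖x‖ ^ (γ - finrank ℝ E))).toReal,
    ENNReal.toReal_nonneg, fun R hR => ?_⟩
  have h := setLIntegral_ball_comp_smul (E := E)
    (F := fun x => ENNReal.ofReal (‖x‖ ^ (γ - finrank ℝ E))) (by fun_prop) hR 1
  rw [mul_one] at h
  have hs : ∀ x : E, ENNReal.ofReal (‖R • x‖ ^ (γ - finrank ℝ E)) =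
      ENNReal.ofReal (R ^ (γ - finrank ℝ E)) * ENNReal.ofReal (‖x‖ ^ (γ - finrank ℝ E)) := by
    intro x
    rw [← ENNReal.ofReal_mul (by positivity), norm_smul, Real.norm_of_nonneg hR.le,
      Real.mul_rpow hR.le (norm_nonneg _)]
  simp_rw [hs] at h
  rw [lintegral_const_mul' _ _ ENNReal.ofReal_ne_top] at h
  rw [mul_comm, ENNReal.ofReal_mul (by positivity), ENNReal.ofReal_toReal hfin.ne]
  calc _ = ENNReal.ofReal (R ^ finrank ℝ E) * (ENNReal.ofReal ((R ^ finrank ℝ E)⁻¹) *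
        ∫⁻ x in Metric.ball (0 : E) R, ENNReal.ofReal (‖x‖ ^ (γ - finrank ℝ E))) := by
        rw [← mul_assoc, ← ENNReal.ofReal_mul (by positivity),
          mul_inv_cancel₀ (by positivity), ENNReal.ofReal_one, one_mul]
    _ = _ := by
        rw [← h, ← mul_assoc, ← ENNReal.ofReal_mul (by positivity), ← Real.rpow_natCast,
          ← Real.rpow_add hR]
        congr 3
        ring

variable {H G : E → ℝ} {σ : ℝ} (hE : 2 ≤ finrank ℝ E) (hH : Continuous H) (hG : Continuous G)
  (hσ : Tendsto (fun x => H x / Real.log ‖x‖) (cocompact E) (𝓝 σ))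

include hσ in
lemma eventually_le_mul_log {β : ℝ} (hβ : σ < β) :
    ∀ᶠ x in cocompact E, H x ≤ β * Real.log ‖x‖ := by
  have h1 : ∀ᶠ x in cocompact E, 1 < ‖x‖ :=
    (tendsto_norm_cocompact_atTop (E := E)).eventually_gt_atTop 1
  filter_upwards [h1, hσ.eventually_lt_const hβ] with x hx1 hx
  exact ((div_lt_iff₀ (Real.log_pos hx1)).1 hx).le

include hσ in
lemma eventually_mul_log_le {β : ℝ} (hβ : β < σ) :
    ∀ᶠ x in cocompact E, β * Real.log ‖x‖ ≤ H x := by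
  have h1 : ∀ᶠ x in cocompact E, 1 < ‖x‖ :=
    (tendsto_norm_cocompact_atTop (E := E)).eventually_gt_atTop 1
  filter_upwards [h1, hσ.eventually_const_lt hβ] with x hx1 hx
  exact ((lt_div_iff₀ (Real.log_pos hx1)).1 hx).le

include hE hH hG hσ in
/-- Near infinity `e^{H+G} ≤ |x|^{γ-n} (1 + (e^{|G|} - 1))`; the first term integrates to a multiple of `R^γ`
over `B_R`, and in the second one `|x|^{γ-n} ≤ R^γ`. -/
lemma exists_setIntegral_ball_exp_le {ρ : ℝ}
    (hρ : IntegrableOn (fun x => Real.exp |G x| - 1) {x | ρ < ‖x‖}) {γ : ℝ} (hγ : 0 < γ)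
    (hγσ : finrank ℝ E + σ < γ) :
    ∃ C : ℝ, 0 < C ∧ ∀ᶠ R : ℝ in atTop,
      ∫ x in Metric.ball (0 : E) R, Real.exp (H x + G x) ≤ C * R ^ γ := by
  obtain ⟨r, hr⟩ := eventually_cocompact_iff_norm.1
    (eventually_le_mul_log hσ (β := γ - finrank ℝ E) (by linarith))
  obtain ⟨I, hI0, hI⟩ := lintegral_ball_norm_rpow (E := E) (by omega) hγ
  have hcont : Continuous fun x => Real.exp (H x + G x) := by fun_prop
  have hcg : Continuous fun x => Real.exp |G x| - 1 := by fun_prop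
  have hg0 : ∀ x, 0 ≤ Real.exp |G x| - 1 := fun x => by simp
  set ρ₁ := max 1 (max ρ r) with hρ₁
  have h1ρ : 1 ≤ ρ₁ := le_max_left _ _
  have hρρ : ρ ≤ ρ₁ := (le_max_left _ _).trans (le_max_right _ _)
  have hrρ : r ≤ ρ₁ := (le_max_right _ _).trans (le_max_right _ _)
  set V₀ := (∫⁻ x in Metric.closedBall (0 : E) ρ₁, ENNReal.ofReal (Real.exp (H x + G x))).toReal
  have hV₀ : ∫⁻ x in Metric.closedBall (0 : E) ρ₁, ENNReal.ofReal (Real.exp (H x + G x)) =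
      ENNReal.ofReal V₀ := by
    rw [ENNReal.ofReal_toReal]
    exact (hcont.continuousOn.integrableOn_compact (isCompact_closedBall 0 ρ₁)).lintegral_lt_top.ne
  set J := (∫⁻ x in {x : E | ρ < ‖x‖}, ENNReal.ofReal (Real.exp |G x| - 1)).toReal
  have hJ : ∫⁻ x in {x : E | ρ < ‖x‖}, ENNReal.ofReal (Real.exp |G x| - 1) = ENNReal.ofReal J := by
    rw [ENNReal.ofReal_toReal]
    exact hρ.lintegral_lt_top.ne
  have hV0 : 0 ≤ V₀ := ENNReal.toReal_nonneg
  have hJ0 : 0 ≤ J := ENNReal.toReal_nonneg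
  refine ⟨V₀ + I + J + 1, by positivity, ?_⟩
  filter_upwards [eventually_ge_atTop 1] with R hR
  have hR0 : 0 < R := by linarith
  have hRγ : 1 ≤ R ^ γ := Real.one_le_rpow hR hγ.le
  have hpt : ∀ x ∈ Metric.ball (0 : E) R ∩ {x | ρ₁ < ‖x‖}, ENNReal.ofReal (Real.exp (H x + G x)) ≤
      ENNReal.ofReal (‖x‖ ^ (γ - finrank ℝ E)) +
        ENNReal.ofReal (R ^ γ) * ENNReal.ofReal (Real.exp |G x| - 1) := by
    rintro x ⟨hxR, hx⟩
    rw [mem_ball_zero_iff] at hxR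
    rw [mem_ofPred_eq] at hx
    have hx0 : 0 < ‖x‖ := by linarith
    rw [← ENNReal.ofReal_mul (by positivity),
      ← ENNReal.ofReal_add (by positivity) (mul_nonneg (by positivity) (hg0 x))]
    apply ENNReal.ofReal_le_ofReal
    have hle : ‖x‖ ^ (γ - finrank ℝ E) ≤ R ^ γ :=
      (Real.rpow_le_rpow_of_exponent_le (by linarith) (by simp)).trans
        (Real.rpow_le_rpow hx0.le hxR.le hγ.le)
    calc Real.exp (H x + G x) ≤ Real.exp ((γ - finrank ℝ E) * Real.log ‖x‖ + |G x|) := by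
          apply Real.exp_le_exp.2
          gcongr
          · exact hr x (by linarith)
          · exact le_abs_self _
      _ = ‖x‖ ^ (γ - finrank ℝ E) + ‖x‖ ^ (γ - finrank ℝ E) * (Real.exp |G x| - 1) := by
          rw [Real.rpow_def_of_pos hx0, Real.exp_add]
          ring_nf
      _ ≤ _ := by
          gcongr
          exact hg0 x
  have hmain : ∫⁻ x in Metric.ball (0 : E) R, ENNReal.ofReal (Real.exp (H x + G x)) ≤
      ENNReal.ofReal ((V₀ + I + J + 1) * R ^ γ) := by
    calc ∫⁻ x in Metric.ball (0 : E) R, ENNReal.ofReal (Real.exp (H x + G x))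
        ≤ ∫⁻ x in Metric.closedBall (0 : E) ρ₁ ∪ (Metric.ball (0 : E) R ∩ {x | ρ₁ < ‖x‖}),
            ENNReal.ofReal (Real.exp (H x + G x)) := by
          refine lintegral_mono_set fun x hx => ?_
          rcases le_or_gt ‖x‖ ρ₁ with h | h
          · exact Or.inl (by simpa using h)
          · exact Or.inr ⟨hx, h⟩
      _ ≤ _ := lintegral_union_le _ _ _
      _ ≤ ENNReal.ofReal V₀ + (ENNReal.ofReal (I * R ^ γ) +
            ENNReal.ofReal (R ^ γ) * ENNReal.ofReal J) := by
          rw [hV₀]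
          gcongr
          refine (setLIntegral_mono' (measurableSet_ball.inter
            (measurableSet_lt measurable_const measurable_norm)) hpt).trans ?_
          rw [lintegral_add_left (by fun_prop), lintegral_const_mul' _ _ ENNReal.ofReal_ne_top,
            ← hI R hR0, ← hJ]
          gcongr
          · exact inter_subset_left
          · exact fun x hx => hρρ.trans_lt hx.2
      _ ≤ _ := by
          rw [← ENNReal.ofReal_mul (by positivity), ← ENNReal.ofReal_add (by positivity) (by positivity),
            ← ENNReal.ofReal_add (by positivity) (by positivity)]
          apply ENNReal.ofReal_le_ofReal
          nlinarith
  rw [integral_eq_lintegral_of_nonneg_ae (Eventually.of_forall fun x => (Real.exp_pos _).le)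
    hcont.aestronglyMeasurable]
  exact ENNReal.toReal_le_of_le_ofReal (by positivity) hmain

include hE hH hG hσ in
/-- By `e^t ≥ 1 + t`, an integrable perturbation `G` does not decrease the order of growth. -/
lemma exists_le_setIntegral_ball_exp (hGi : Integrable G) {γ : ℝ} (hγσ : γ < finrank ℝ E + σ) :
    ∃ C : ℝ, 0 < C ∧ ∀ᶠ R : ℝ in atTop,
      C * R ^ γ ≤ ∫ x in Metric.ball (0 : E) R, Real.exp (H x + G x) := by
  have : Nontrivial E := finrank_pos_iff.1 (by omega : 0 < finrank ℝ E)
  set N := finrank ℝ E with hN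
  obtain ⟨r, hr⟩ := eventually_cocompact_iff_norm.1
    (eventually_mul_log_le hσ (β := γ - N) (by linarith))
  have hcont : Continuous fun x => Real.exp (H x + G x) := by fun_prop
  set b := (volume : Measure E).real (Metric.ball 0 1) with hb
  have hb0 : 0 < b := ENNReal.toReal_pos (Metric.measure_ball_pos _ _ one_pos).ne' measure_ball_lt_top.ne
  have hball : ∀ R : ℝ, 0 < R → (volume : Measure E).real (Metric.ball 0 R) = R ^ N * b := by
    intro R hR
    rw [hb, Measure.real, Measure.real, Measure.addHaar_ball _ _ hR.le, ENNReal.toReal_mul,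
      ENNReal.toReal_ofReal (by positivity)]
  refine ⟨b / 4 * Real.exp (-(|γ - N| * Real.log 2)), by positivity, ?_⟩
  have hlarge : ∀ᶠ R : ℝ in atTop, (∫ x, |G x|) ≤ b / 4 * R ^ N :=
    (((tendsto_pow_atTop (by omega : N ≠ 0)).const_mul_atTop
      (by positivity : 0 < b / 4)).eventually_ge_atTop _)
  filter_upwards [hlarge, eventually_ge_atTop 1, eventually_ge_atTop (2 * r)] with R hRG hR1 hRr
  have hR0 : 0 < R := by linarith
  set S := Metric.ball (0 : E) R \ Metric.ball 0 (R / 2) with hS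
  have hSm : MeasurableSet S := measurableSet_ball.diff measurableSet_ball
  have hSsub : S ⊆ Metric.ball 0 R := sdiff_subset
  have hSvol : b / 2 * R ^ N ≤ (volume : Measure E).real S := by
    rw [hS, measureReal_sdiff (Metric.ball_subset_ball (by linarith)) measurableSet_ball,
      hball R hR0, hball _ (by linarith), div_pow]
    have h2 : (2 : ℝ) ≤ 2 ^ N := le_self_pow₀ (by norm_num) (by omega)
    have : R ^ N / 2 ^ N ≤ R ^ N / 2 := by gcongr
    nlinarith
  -- a lower bound for `H` on the annulus
  set a := (γ - N) * Real.log R - |γ - N| * Real.log 2 with ha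
  have hpt : ∀ x ∈ S, Real.exp a * (1 + G x) ≤ Real.exp (H x + G x) := by
    rintro x ⟨hxR, hx⟩
    rw [mem_ball_zero_iff] at hxR
    rw [mem_ball_zero_iff, not_lt] at hx
    have hx0 : 0 < ‖x‖ := by linarith
    have hl1 : Real.log ‖x‖ ≤ Real.log R := Real.log_le_log hx0 hxR.le
    have hl2 : Real.log R - Real.log 2 ≤ Real.log ‖x‖ := by
      rw [← Real.log_div hR0.ne' two_ne_zero]
      exact Real.log_le_log (by positivity) hx
    have haH : a ≤ H x := by
      refine le_trans ?_ (hr x (by linarith))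
      have h1 : |(γ - N) * (Real.log R - Real.log ‖x‖)| ≤ |γ - N| * Real.log 2 := by
        rw [abs_mul]
        gcongr
        rw [abs_of_nonneg (by linarith)]
        linarith
      have h2 := (abs_le.1 h1).2
      rw [ha]
      linarith
    have h3 := Real.add_one_le_exp (G x)
    calc Real.exp a * (1 + G x) ≤ Real.exp a * Real.exp (G x) := by gcongr; linarith
      _ ≤ _ := by rw [← Real.exp_add]; gcongr
  have hint : IntegrableOn (fun x => Real.exp (H x + G x)) (Metric.ball 0 R) :=
    (hcont.continuousOn.integrableOn_compact (isCompact_closedBall 0 R)).mono_set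
      Metric.ball_subset_closedBall
  have hfinS : volume S ≠ ⊤ := (measure_mono hSsub).trans_lt measure_ball_lt_top |>.ne
  have honeS : IntegrableOn (fun _ : E => (1 : ℝ)) S := integrableOn_const hfinS
  have hGS : -∫ x, |G x| ≤ ∫ x in S, G x := by
    have h1 : |∫ x in S, G x| ≤ ∫ x in S, |G x| := abs_integral_le_integral_abs
    have h2 : ∫ x in S, |G x| ≤ ∫ x, |G x| :=
      setIntegral_le_integral hGi.abs (Eventually.of_forall fun x => abs_nonneg _)
    linarith [(abs_le.1 h1).1]
  have hRγ : Real.exp a * R ^ N = R ^ γ * Real.exp (-(|γ - N| * Real.log 2)) := by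
    rw [← Real.rpow_natCast, Real.rpow_def_of_pos hR0, Real.rpow_def_of_pos hR0, ← Real.exp_add,
      ← Real.exp_add, ha]
    ring_nf
  calc b / 4 * Real.exp (-(|γ - N| * Real.log 2)) * R ^ γ = Real.exp a * (b / 4 * R ^ N) := by
        linear_combination (-b / 4) * hRγ
    _ ≤ Real.exp a * ((volume : Measure E).real S + ∫ x in S, G x) := by
        gcongr
        linarith
    _ = ∫ x in S, Real.exp a * (1 + G x) := by
        rw [integral_const_mul, integral_add honeS hGi.integrableOn]
        simp
    _ ≤ ∫ x in S, Real.exp (H x + G x) :=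
        setIntegral_mono_on ((honeS.add hGi.integrableOn).const_mul _)
          (hint.mono_set hSsub) hSm hpt
    _ ≤ _ := setIntegral_mono_set hint (Eventually.of_forall fun x => (Real.exp_pos _).le)
        (Eventually.of_forall hSsub)

include hE hH hG hσ in
/-- If `H ~ σ log |x|` at infinity, and `G` is integrable with `e^{|G|} - 1` integrable near infinity,
then `∫_{B_R} e^{H+G}` grows like `R^{n+σ}` on the logarithmic scale. -/
theorem tendsto_log_setIntegral_ball_exp_div_log (hGi : Integrable G) {ρ : ℝ}
    (hρ : IntegrableOn (fun x => Real.exp |G x| - 1) {x | ρ < ‖x‖}) (h0 : 0 ≤ finrank ℝ E + σ) :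
    Tendsto (fun R : ℝ => Real.log (∫ x in Metric.ball (0 : E) R, Real.exp (H x + G x)) /
      Real.log R) atTop (𝓝 (finrank ℝ E + σ)) := by
  have hlim : ∀ C γ : ℝ, Tendsto (fun R : ℝ => Real.log C / Real.log R + γ) atTop (𝓝 γ) := by
    intro C γ
    simpa using (Real.tendsto_log_atTop.const_div_atTop (Real.log C)).add_const γ
  have hlog : ∀ C γ : ℝ, 0 < C → ∀ R : ℝ, 1 < R →
      Real.log (C * R ^ γ) / Real.log R = Real.log C / Real.log R + γ := by
    intro C γ hC R hR
    have h1 := Real.log_pos hR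
    rw [Real.log_mul hC.ne' (Real.rpow_pos_of_pos (by linarith) _).ne', Real.log_rpow (by linarith)]
    field_simp
  refine tendsto_order.2 ⟨fun a ha => ?_, fun a ha => ?_⟩
  · obtain ⟨γ, hγ1, hγ2⟩ := exists_between ha
    obtain ⟨C, hC, hV⟩ := exists_le_setIntegral_ball_exp hE hH hG hσ hGi hγ2
    filter_upwards [hV, eventually_gt_atTop 1, (hlim C γ).eventually_const_lt hγ1] with R hR h1 h2
    refine h2.trans_le ?_
    rw [← hlog C γ hC R h1]
    have := Real.rpow_pos_of_pos (by linarith : 0 < R) γ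
    exact div_le_div_of_nonneg_right (Real.log_le_log (by positivity) hR) (Real.log_pos h1).le
  · obtain ⟨γ, hγ1, hγ2⟩ := exists_between ha
    obtain ⟨C, hC, hV⟩ := exists_setIntegral_ball_exp_le hE hH hG hσ hρ (by linarith) hγ1
    obtain ⟨C', hC', hV'⟩ := exists_le_setIntegral_ball_exp hE hH hG hσ hGi
      (sub_one_lt (finrank ℝ E + σ))
    filter_upwards [hV, hV', eventually_gt_atTop 1, (hlim C γ).eventually_lt_const hγ2]
      with R hR hR' h1 h2
    refine lt_of_le_of_lt ?_ h2
    rw [← hlog C γ hC R h1]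
    have := Real.rpow_pos_of_pos (by linarith : 0 < R) (finrank ℝ E + σ - 1)
    exact div_le_div_of_nonneg_right (Real.log_le_log (lt_of_lt_of_le (by positivity) hR') hR)
      (Real.log_pos h1).le

end VolumeGrowth

end

/-! ### Volume entropy of normal metrics -/

section

open Module Asymptotics

section Entropy

variable {n : ℕ} {u : EuclideanSpace ℝ (Fin n) → ℝ}

lemma lintegral_ball_exp_lt_top (hu : Continuous u) (R : ℝ) :
    ∫⁻ x in Metric.ball 0 R, ENNReal.ofReal (Real.exp (n * u x)) < ⊤ := by
  have hc : Continuous fun x => Real.exp (n * u x) := by fun_prop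
  exact ((hc.continuousOn.integrableOn_compact (isCompact_closedBall 0 R)).mono_set
    Metric.ball_subset_closedBall).lintegral_lt_top

lemma volumeMeasure_ball (R : ℝ) :
    volumeMeasure u (Metric.ball 0 R) =
      ∫⁻ x in Metric.ball 0 R, ENNReal.ofReal (Real.exp (n * u x)) := by
  rw [volumeMeasure, withDensity_apply _ measurableSet_ball]

lemma volumeMeasure_real_ball (hu : Continuous u) (R : ℝ) :
    (volumeMeasure u).real (Metric.ball 0 R) = ∫ x in Metric.ball 0 R, Real.exp (n * u x) := by
  have hc : Continuous fun x => Real.exp (n * u x) := by fun_prop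
  rw [Measure.real, volumeMeasure_ball, integral_eq_lintegral_of_nonneg_ae
    (Eventually.of_forall fun x => (Real.exp_pos _).le) hc.aestronglyMeasurable]

lemma tendsto_log_volume_ball_div_log (hn : 2 ≤ n) :
    Tendsto (fun R : ℝ => Real.log ((volume : Measure (EuclideanSpace ℝ (Fin n))).real
      (Metric.ball 0 R)) / Real.log R) atTop (𝓝 n) := by
  set b := (volume : Measure (EuclideanSpace ℝ (Fin n))).real (Metric.ball 0 1) with hb
  have hb0 : 0 < b :=
    ENNReal.toReal_pos (Metric.measure_ball_pos _ _ one_pos).ne' measure_ball_lt_top.ne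
  have h1 : Tendsto (fun R : ℝ => (n : ℝ) + Real.log b / Real.log R) atTop (𝓝 n) := by
    simpa using (Real.tendsto_log_atTop.const_div_atTop (Real.log b)).const_add (n : ℝ)
  refine h1.congr' ?_
  filter_upwards [eventually_gt_atTop 1] with R hR
  have : Nontrivial (EuclideanSpace ℝ (Fin n)) :=
    (finrank_pos_iff (R := ℝ)).1 (by rw [finrank_euclideanSpace_fin]; omega)
  have hl := Real.log_pos hR
  rw [Measure.real, Measure.addHaar_ball _ _ (by linarith), ENNReal.toReal_mul,
    ENNReal.toReal_ofReal (by positivity), finrank_euclideanSpace_fin, ← Measure.real, ← hb,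
    Real.log_mul (by positivity) hb0.ne', Real.log_pow]
  field_simp

lemma volumeEntropy_eq_of_tendsto (hn : 2 ≤ n) {L : ℝ}
    (hL : Tendsto (fun R : ℝ => Real.log ((volumeMeasure u).real (Metric.ball 0 R)) / Real.log R)
      atTop (𝓝 L)) : volumeEntropy u = ((L / n : ℝ) : EReal) := by
  have hn0 : (n : ℝ) ≠ 0 := by positivity
  have h := hL.div (tendsto_log_volume_ball_div_log hn) hn0
  rw [volumeEntropy]
  refine (continuous_coe_real_ereal.continuousAt.tendsto.comp (h.congr' ?_)).limsup_eq
  filter_upwards [eventually_gt_atTop 1] with R hR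
  have hl := (Real.log_pos hR).ne'
  simp only [Pi.div_apply]
  rw [div_div_div_cancel_right₀ hl]

/-- Finite volume entropy means polynomial volume growth. -/
lemma exists_lintegral_ball_exp_le (hn : 2 ≤ n) (hu : Continuous u) (hτ : volumeEntropy u < ⊤) :
    ∃ (C : ℝ) (K : ℕ), 0 ≤ C ∧ ∀ R : ℝ, 1 ≤ R →
      ∫⁻ x in Metric.ball 0 R, ENNReal.ofReal (Real.exp (n * u x)) ≤ ENNReal.ofReal (C * R ^ K) := by
  obtain ⟨M, hM, -⟩ := EReal.lt_iff_exists_real_btwn.1 hτ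
  have h1 := eventually_lt_of_limsup_lt hM
  have h2 := (tendsto_log_volume_ball_div_log hn).eventually_lt_const (lt_add_one (n : ℝ))
  have h3 := (tendsto_log_volume_ball_div_log hn).eventually_const_lt
    (by positivity : (0 : ℝ) < n)
  obtain ⟨K, hK⟩ := exists_nat_ge (|M| * (n + 1))
  obtain ⟨R₀, hR₀⟩ := eventually_atTop.1 (((h1.and h2).and h3).and (eventually_gt_atTop 1))
  set V := fun R : ℝ => (volumeMeasure u).real (Metric.ball 0 R) with hV
  have hV0 : ∀ R, 0 ≤ V R := fun R => ENNReal.toReal_nonneg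
  have hfin : ∀ R, volumeMeasure u (Metric.ball 0 R) ≠ ⊤ := fun R => by
    rw [volumeMeasure_ball]; exact (lintegral_ball_exp_lt_top hu R).ne
  have hbig : ∀ R, R₀ ≤ R → V R ≤ R ^ K := by
    intro R hR
    obtain ⟨⟨⟨ha, hb⟩, hc⟩, hd⟩ := hR₀ R hR
    have hl := Real.log_pos hd
    have hB := (div_lt_iff₀ hl).1 hb
    have hB0 := (div_pos_iff_of_pos_right hl).1 hc
    have hA : Real.log (V R) <
        M * Real.log ((volume : Measure (EuclideanSpace ℝ (Fin n))).real (Metric.ball 0 R)) :=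
      (div_lt_iff₀ hB0).1 (EReal.coe_lt_coe_iff.1 ha)
    rcases (hV0 R).eq_or_lt with h | h
    · rw [← h]; positivity
    · rw [← Real.log_le_log_iff h (by positivity), Real.log_pow]
      calc Real.log (V R) ≤ |M| * ((n + 1) * Real.log R) := by
            refine hA.le.trans ?_
            gcongr
            exact le_abs_self M
        _ = |M| * (n + 1) * Real.log R := by ring
        _ ≤ _ := by gcongr
  refine ⟨1 + V R₀, K, by linarith [hV0 R₀], fun R hR => ?_⟩
  rw [← volumeMeasure_ball, ← ENNReal.ofReal_toReal (hfin R)]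
  apply ENNReal.ofReal_le_ofReal
  have hRK : 1 ≤ R ^ K := one_le_pow₀ hR
  change V R ≤ _
  rcases le_total R₀ R with h | h
  · have := hbig R h
    nlinarith [hV0 R₀]
  · have : V R ≤ V R₀ := ENNReal.toReal_mono (hfin R₀) (measure_mono (Metric.ball_subset_ball h))
    nlinarith [hV0 R₀]

end Entropy

section NormalMetrics

variable {n : ℕ} {f : EuclideanSpace ℝ (Fin n) → ℝ} (hn : 2 ≤ n) (hf : Continuous f)
  (hfi : Integrable f)

include hn hf hfi in
/-- The logarithmic potential is the sum of a function `h` asymptotic to a multiple of `log |x|` and an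
integrable function `g` such that `e^{p|g|} - 1` is integrable near infinity for every `p > 0`. -/
lemma exists_logPotential_eq_add :
    ∃ h g : EuclideanSpace ℝ (Fin n) → ℝ, Continuous h ∧ Continuous g ∧
      (∀ x, logPotential f x = h x + g x) ∧
      Tendsto (fun x => h x / Real.log ‖x‖) (cocompact _) (𝓝 (-(normalizingConst n * ∫ y, f y))) ∧
      (∃ A, 0 ≤ A ∧ ∀ x, |h x| ≤ A * (1 + ‖x‖)) ∧ Integrable g ∧
      ∀ p : ℝ, 0 < p → ∃ ρ : ℝ,
        IntegrableOn (fun x => Real.exp |p * g x| - 1) {x | ρ < ‖x‖} := by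
  have hE := two_le_finrank hn
  have : Nontrivial (EuclideanSpace ℝ (Fin n)) := (finrank_pos_iff (R := ℝ)).1 (by omega)
  have hc := normalizingConst_pos (n := n)
  have hfar := continuous_farPotential hfi
  have hnear := continuous_nearPotential hE hf
  have hlog : Tendsto (fun x : EuclideanSpace ℝ (Fin n) => Real.log ‖x‖) (cocompact _) atTop :=
    Real.tendsto_log_atTop.comp tendsto_norm_cocompact_atTop
  refine ⟨fun x => normalizingConst n * farPotential f x - normalizingConst n * nearPotential f 0,
    fun x => normalizingConst n * nearPotential f x, by fun_prop, by fun_prop, fun x => ?_, ?_, ?_,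
    (integrable_nearPotential hE hfi).const_mul _, fun p hp => ?_⟩
  · rw [logPotential_eq hn hf hfi]
    ring
  · have := ((tendsto_farPotential_div_log hfi).const_mul (normalizingConst n)).sub
      (hlog.const_div_atTop (normalizingConst n * nearPotential f 0))
    rw [sub_zero, mul_neg] at this
    refine this.congr fun x => ?_
    ring
  · refine ⟨normalizingConst n * (∫ y, |f y|) + |normalizingConst n * nearPotential f 0|,
      add_nonneg (mul_nonneg hc.le (integral_nonneg fun _ => abs_nonneg _)) (abs_nonneg _),
      fun x => ?_⟩
    have h1 := abs_farPotential_le hfi x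
    have h2 : Real.log (1 + ‖x‖) ≤ 1 + ‖x‖ := Real.log_le_self (by positivity)
    have h3 : 0 ≤ ∫ y, |f y| := integral_nonneg fun _ => abs_nonneg _
    calc _ ≤ |normalizingConst n * farPotential f x| + |normalizingConst n * nearPotential f 0| :=
          abs_sub _ _
      _ ≤ normalizingConst n * ((1 + ‖x‖) * ∫ y, |f y|) +
            |normalizingConst n * nearPotential f 0| * (1 + ‖x‖) := by
          rw [abs_mul, abs_of_pos hc]
          gcongr
          · exact h1.trans (by gcongr)
          · exact le_mul_of_one_le_right (abs_nonneg _) (by linarith [norm_nonneg x])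
      _ = _ := by ring
  · obtain ⟨ρ, -, hρ⟩ := integrableOn_exp_nearPotential hE hf hfi (p * normalizingConst n)
      (by positivity)
    refine ⟨ρ, hρ.congr_fun (fun x _ => ?_) (measurableSet_lt measurable_const measurable_norm)⟩
    simp only
    rw [← mul_assoc, abs_mul, abs_of_pos (by positivity : 0 < p * normalizingConst n)]

lemma tendsto_add_const_div_log {E : Type*} [NormedAddCommGroup E] [ProperSpace E] {h : E → ℝ}
    {σ : ℝ} (hσ : Tendsto (fun x => h x / Real.log ‖x‖) (cocompact E) (𝓝 σ)) (C : ℝ) :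
    Tendsto (fun x => (h x + C) / Real.log ‖x‖) (cocompact E) (𝓝 σ) := by
  have hlog : Tendsto (fun x : E => Real.log ‖x‖) (cocompact _) atTop :=
    Real.tendsto_log_atTop.comp tendsto_norm_cocompact_atTop
  have := hσ.add (hlog.const_div_atTop C)
  rw [add_zero] at this
  exact this.congr fun x => (add_div _ _ _).symm

lemma tendsto_smul_cocompact {E : Type*} [NormedAddCommGroup E] [NormedSpace ℝ E] [ProperSpace E]
    {x : E} (hx : x ≠ 0) : Tendsto (fun t : ℝ => t • x) atTop (cocompact E) := by
  rw [← Metric.cobounded_eq_cocompact, ← tendsto_norm_atTop_iff_cobounded]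
  simp_rw [norm_smul]
  exact tendsto_norm_atTop_atTop.atTop_mul_const (norm_pos_iff.2 hx)

variable {u : EuclideanSpace ℝ (Fin n) → ℝ} (hu : Continuous u) (hc : IsCompleteMetric u)

include hn hf hfi hu hc in
/-- A complete normal metric has normalized integrated Q-curvature at most `1`: otherwise `e^u` is,
up to an integrable error, at most `|x|^{-β}` with `β > 1`, and almost every ray has finite length. -/
lemma normalizingConst_mul_integral_le_one {C : ℝ} (hnorm : ∀ x, u x = logPotential f x + C) :
    normalizingConst n * ∫ y, f y ≤ 1 := by
  by_contra! hα
  have hE := two_le_finrank hn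
  obtain ⟨h, g, hh, hg, hsum, hσ, -, -, hexp⟩ := exists_logPotential_eq_add hn hf hfi
  obtain ⟨β, hβ1, hβ2⟩ := exists_between hα
  have hle := eventually_le_mul_log (tendsto_add_const_div_log hσ C) (neg_lt_neg hβ2)
  obtain ⟨ρ, hρ⟩ := hexp 1 one_pos
  simp only [one_mul] at hρ
  obtain ⟨x, hx0, hx⟩ := ((ae_ne_zero (by omega)).and
    (ae_integrableOn_ray_exp_abs_sub_one hE hg hρ)).exists
  obtain ⟨T, -, hT⟩ := hx hx0
  refine hc.not_eventually_le hu hx0 hT hβ1 (D := -β * Real.log ‖x‖) ?_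
  filter_upwards [(tendsto_smul_cocompact hx0).eventually hle, eventually_gt_atTop 0] with t ht ht0
  rw [norm_smul, Real.norm_of_nonneg ht0.le,
    Real.log_mul ht0.ne' (norm_ne_zero_iff.2 hx0)] at ht
  rw [hnorm, hsum]
  linarith [le_abs_self (g (t • x))]

include hn hf hfi hu hc in
lemma volumeEntropy_eq_of_eq_logPotential_add {C : ℝ} (hnorm : ∀ x, u x = logPotential f x + C) :
    volumeEntropy u = ((1 - normalizingConst n * ∫ y, f y : ℝ) : EReal) := by
  have hα := normalizingConst_mul_integral_le_one hn hf hfi hu hc hnorm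
  have hE := two_le_finrank hn
  have hn0 : (0 : ℝ) < n := by positivity
  obtain ⟨h, g, hh, hg, hsum, hσ, -, hgi, hexp⟩ := exists_logPotential_eq_add hn hf hfi
  obtain ⟨ρ, hρ⟩ := hexp n hn0
  have hH : Tendsto (fun x => n * (h x + C) / Real.log ‖x‖) (cocompact _)
      (𝓝 (n * -(normalizingConst n * ∫ y, f y))) :=
    ((tendsto_add_const_div_log hσ C).const_mul (n : ℝ)).congr fun x => (mul_div_assoc _ _ _).symm
  have hlim := tendsto_log_setIntegral_ball_exp_div_log hE (H := fun x => n * (h x + C))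
    (G := fun x => n * g x) (by fun_prop) (by fun_prop) hH (hgi.const_mul _) hρ (by
      rw [finrank_euclideanSpace_fin]
      nlinarith)
  rw [finrank_euclideanSpace_fin] at hlim
  have hV : ∀ R, ∫ x in Metric.ball 0 R, Real.exp (n * (h x + C) + n * g x) =
      (volumeMeasure u).real (Metric.ball 0 R) := by
    intro R
    rw [volumeMeasure_real_ball hu]
    congr 1
    ext x
    rw [hnorm, hsum]
    ring_nf
  simp_rw [hV] at hlim
  rw [volumeEntropy_eq_of_tendsto hn hlim]
  congr 1
  field_simp
  ring

end NormalMetrics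

end

/-! ### Metrics of finite volume entropy are normal -/

section

open Module Asymptotics

section Converse

lemma isLittleO_comp_smul {E : Type*} [NormedAddCommGroup E] [NormedSpace ℝ E] [ProperSpace E]
    {h : E → ℝ} {σ : ℝ} (hσ : Tendsto (fun x => h x / Real.log ‖x‖) (cocompact E) (𝓝 σ)) {x : E}
    (hx : x ≠ 0) : (fun t : ℝ => h (t • x)) =o[atTop] fun t : ℝ => t := by
  have hx' := norm_ne_zero_iff.2 hx
  have hcc := tendsto_smul_cocompact hx
  have hlog : Tendsto (fun t : ℝ => Real.log ‖t • x‖) atTop atTop :=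
    Real.tendsto_log_atTop.comp (tendsto_norm_cocompact_atTop.comp hcc)
  have h1 : (fun t : ℝ => h (t • x) / Real.log ‖t • x‖) =O[atTop] fun _ : ℝ => (1 : ℝ) :=
    (hσ.comp hcc).isBigO_one ℝ
  have h2 : (fun t : ℝ => Real.log ‖t • x‖) =o[atTop] fun t : ℝ => t := by
    have := Real.isLittleO_log_id_atTop.add (isLittleO_const_id_atTop (Real.log ‖x‖))
    refine this.congr' ?_ EventuallyEq.rfl
    filter_upwards [eventually_gt_atTop 0] with t ht
    rw [norm_smul, Real.norm_of_nonneg ht.le, Real.log_mul ht.ne' hx']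
  have h3 := h1.mul_isLittleO h2
  simp only [one_mul] at h3
  refine h3.congr' ?_ EventuallyEq.rfl
  filter_upwards [hlog.eventually_gt_atTop 0] with t ht
  exact div_mul_cancel₀ _ ht.ne'

variable {n : ℕ} {f u : EuclideanSpace ℝ (Fin n) → ℝ} (hn : 2 ≤ n) (hf : Continuous f)
  (hfi : Integrable f) (hu : Continuous u) (hc : IsCompleteMetric u)

include hn hf hfi hu hc in
/-- If `u - 𝓛(f)` is polynomial along lines through the origin, then it is constant. A leading coefficient
that is negative on an open set would produce rays of finite length, a positive one would violate polynomial
volume growth. -/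
lemma eq_logPotential_add_const {C : ℝ} {K : ℕ}
    (hgr : ∀ R : ℝ, 1 ≤ R →
      ∫⁻ x in Metric.ball 0 R, ENNReal.ofReal (Real.exp (n * u x)) ≤ ENNReal.ofReal (C * R ^ K))
    {N : ℕ} {a : ℕ → EuclideanSpace ℝ (Fin n) → ℝ} (ha : ∀ k, Continuous (a k))
    (hw : ∀ x (t : ℝ), u (t • x) - logPotential f (t • x) = ∑ k ∈ Finset.range N, a k x * t ^ k)
    (x : EuclideanSpace ℝ (Fin n)) :
    u x = logPotential f x + (u 0 - logPotential f 0) := by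
  have hE := two_le_finrank hn
  have hn0 : (0 : ℝ) < n := by positivity
  by_cases hz : ∀ k, 1 ≤ k → k < N → ∀ x, a k x = 0
  · have hconst : ∀ t : ℝ, u (t • x) - logPotential f (t • x) =
        ∑ k ∈ Finset.range N, a k x * (0 : ℝ) ^ k := by
      intro t
      rw [hw]
      refine Finset.sum_congr rfl fun k hk => ?_
      rcases Nat.eq_zero_or_pos k with rfl | hk0
      · simp
      · simp [hz k hk0 (Finset.mem_range.1 hk) x]
    have h1 := hconst 1
    have h0 := hconst 0
    rw [one_smul] at h1
    rw [zero_smul] at h0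
    linarith
  exfalso
  push Not at hz
  obtain ⟨d, ⟨hd1, hdN, x₀, hx₀⟩, hmax⟩ : ∃ d, (1 ≤ d ∧ d < N ∧ ∃ x, a d x ≠ 0) ∧
      ∀ k, d < k → k < N → ∀ x, a k x = 0 := by
    classical
    obtain ⟨k₀, hk₀⟩ := hz
    have hspec := Nat.findGreatest_spec (P := fun k => 1 ≤ k ∧ k < N ∧ ∃ x, a k x ≠ 0)
      (n := N) hk₀.2.1.le hk₀
    refine ⟨_, hspec, fun k hk hkN x => ?_⟩
    by_contra hne
    exact Nat.findGreatest_is_greatest hk hkN.le ⟨by omega, hkN, x, hne⟩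
  obtain ⟨h, g, hh, hg, hsum, hσ, -, -, hexp⟩ := exists_logPotential_eq_add hn hf hfi
  have hu_eq : ∀ x (t : ℝ), u (t • x) =
      ∑ k ∈ Finset.range N, a k x * t ^ k + h (t • x) + g (t • x) := fun x t => by
    linarith [hw x t, hsum (t • x)]
  have hlog : (fun t : ℝ => Real.log t) =o[atTop] fun t : ℝ => t := Real.isLittleO_log_id_atTop
  rcases lt_or_gt_of_ne hx₀ with hneg | hpos
  · obtain ⟨ρ, hρ⟩ := hexp 1 one_pos
    simp only [one_mul] at hρ
    have hae := (ae_ne_zero (E := EuclideanSpace ℝ (Fin n)) (by omega)).and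
      (ae_integrableOn_ray_exp_abs_sub_one hE hg hρ)
    obtain ⟨x, ⟨hx0, hx⟩, hxU⟩ := (Measure.dense_of_ae hae).exists_mem_open
      (isOpen_lt (ha d) continuous_const) ⟨x₀, hneg⟩
    obtain ⟨T, -, hT⟩ := hx hx0
    refine hc.not_eventually_le hu hx0 hT one_lt_two (D := 0) ?_
    have hlim := tendsto_sum_pow_add_atTop (a := fun k => -a k x) hd1 hdN (neg_pos.2 hxU)
      (fun k h1 h2 => by rw [hmax k h1 h2, neg_zero])
      ((isLittleO_comp_smul hσ hx0).neg_left.sub (hlog.const_mul_left 2))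
    filter_upwards [hlim.eventually_ge_atTop 0] with t ht
    rw [hu_eq]
    simp only [neg_mul, Finset.sum_neg_distrib] at ht
    linarith [le_abs_self (g (t • x))]
  · obtain ⟨ρ, hρ⟩ := hexp n hn0
    have hcont : Continuous fun x => Real.exp (n * u x) := by fun_prop
    have hae := ((ae_ne_zero (E := EuclideanSpace ℝ (Fin n)) (by omega)).and
      (ae_integrableOn_ray_exp_abs_sub_one hE (g := fun x => n * g x) (by fun_prop) hρ)).and
      (ae_lintegral_ray_lt_top hcont.measurable.ennreal_ofReal (q := K + 2) hgr (by omega))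
    obtain ⟨x, ⟨⟨hx0, hx⟩, hxv⟩, hxU⟩ := (Measure.dense_of_ae hae).exists_mem_open
      (isOpen_lt continuous_const (ha d)) ⟨x₀, hpos⟩
    obtain ⟨T, -, hT⟩ := hx hx0
    refine not_eventually_ge_of_lintegral_lt_top (g := fun t : ℝ => n * g (t • x))
      (Continuous.measurable (by fun_prop)) hT hxv ?_
    have hlim := tendsto_sum_pow_add_atTop (a := fun k => a k x) hd1 hdN hxU
      (fun k h1 h2 => hmax k h1 h2 x)
      ((isLittleO_comp_smul hσ hx0).sub (hlog.const_mul_left (((K + 2 : ℕ) : ℝ) / n)))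
    filter_upwards [hlim.eventually_ge_atTop 0] with t ht
    rw [hu_eq]
    have h1 := mul_le_mul_of_nonneg_left ht hn0.le
    have h2 : (n : ℝ) * (((K + 2 : ℕ) : ℝ) / n * Real.log t) = ((K + 2 : ℕ) : ℝ) * Real.log t := by
      field_simp
    have h3 := neg_abs_le (n * g (t • x))
    linarith

include hn hf hfi hu in
/-- The positive part of `u - 𝓛(f)` has polynomial growth in the mean: `u⁺ ≤ e^{nu}` is controlled by the
volume. -/
lemma exists_lintegral_ball_sub_logPotential_le {C : ℝ} {K : ℕ} (hC : 0 ≤ C)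
    (hgr : ∀ R : ℝ, 1 ≤ R →
      ∫⁻ x in Metric.ball 0 R, ENNReal.ofReal (Real.exp (n * u x)) ≤ ENNReal.ofReal (C * R ^ K)) :
    ∃ (A : ℝ) (L : ℕ), 0 ≤ A ∧ ∀ R : ℝ, 0 ≤ R →
      ∫⁻ x in Metric.ball 0 R, ENNReal.ofReal (u x - logPotential f x) ≤
        ENNReal.ofReal (A * (1 + R) ^ L) := by
  obtain ⟨h, g, hh, hg, hsum, -, ⟨A, hA0, hA⟩, hgi, -⟩ := exists_logPotential_eq_add hn hf hfi
  have hnt : Nontrivial (EuclideanSpace ℝ (Fin n)) :=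
    (finrank_pos_iff (R := ℝ)).1 (by rw [finrank_euclideanSpace_fin]; omega)
  have hn1 : (1 : ℝ) ≤ n := by exact_mod_cast (by omega : 1 ≤ n)
  set b := (volume : Measure (EuclideanSpace ℝ (Fin n))).real (Metric.ball 0 1) with hb
  have hb0 : 0 ≤ b := ENNReal.toReal_nonneg
  set I := ∫ x, |g x| with hI
  have hI0 : 0 ≤ I := integral_nonneg fun _ => abs_nonneg _
  refine ⟨C + A * b + I, K + (n + 1), by positivity, fun R hR => ?_⟩
  have hpt : ∀ x ∈ Metric.ball (0 : EuclideanSpace ℝ (Fin n)) R,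
      ENNReal.ofReal (u x - logPotential f x) ≤
        ENNReal.ofReal (Real.exp (n * u x)) + (ENNReal.ofReal (A * (1 + R)) +
          ENNReal.ofReal |g x|) := by
    intro x hx
    rw [mem_ball_zero_iff] at hx
    rw [← ENNReal.ofReal_add (by positivity) (abs_nonneg _),
      ← ENNReal.ofReal_add (by positivity) (by positivity)]
    apply ENNReal.ofReal_le_ofReal
    rw [hsum]
    have h1 : u x ≤ Real.exp (n * u x) := by
      rcases le_total (u x) 0 with h0 | h0
      · exact h0.trans (Real.exp_pos _).le
      · have := Real.add_one_le_exp (n * u x)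
        nlinarith
    have h2 : A * (1 + ‖x‖) ≤ A * (1 + R) := by gcongr
    linarith [(abs_le.1 (hA x)).1, neg_abs_le (g x)]
  refine (setLIntegral_mono' measurableSet_ball hpt).trans ?_
  rw [lintegral_add_right _ (by fun_prop), lintegral_add_right _ (by fun_prop),
    setLIntegral_const, Measure.addHaar_ball _ _ hR, finrank_euclideanSpace_fin,
    ← ENNReal.ofReal_toReal (measure_ball_lt_top (μ := (volume : Measure (EuclideanSpace ℝ (Fin n))))
      (x := 0) (r := 1)).ne, ← Measure.real, ← hb]
  have hg1 : ∫⁻ x in Metric.ball 0 R, ENNReal.ofReal |g x| ≤ ENNReal.ofReal I := by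
    rw [hI, ofReal_integral_eq_lintegral_ofReal hgi.abs (Eventually.of_forall fun _ => abs_nonneg _)]
    exact setLIntegral_le_lintegral _ _
  have hu1 : ∫⁻ x in Metric.ball 0 R, ENNReal.ofReal (Real.exp (n * u x)) ≤
      ENNReal.ofReal (C * (1 + R) ^ K) :=
    (lintegral_mono_set (Metric.ball_subset_ball (by linarith))).trans (hgr (1 + R) (by linarith))
  refine (add_le_add hu1 (add_le_add le_rfl hg1)).trans ?_
  rw [← ENNReal.ofReal_mul (by positivity), ← ENNReal.ofReal_mul (by positivity),
    ← ENNReal.ofReal_add (by positivity) (by positivity),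
    ← ENNReal.ofReal_add (by positivity) (by positivity)]
  apply ENNReal.ofReal_le_ofReal
  have h1R : 1 ≤ 1 + R := by linarith
  have e1 : (1 + R) ^ K ≤ (1 + R) ^ (K + (n + 1)) := pow_le_pow_right₀ h1R (by omega)
  have e2 : (1 + R) * R ^ n ≤ (1 + R) ^ (K + (n + 1)) :=
    calc (1 + R) * R ^ n ≤ (1 + R) * (1 + R) ^ n := by gcongr; linarith
      _ = (1 + R) ^ (n + 1) := by ring
      _ ≤ _ := pow_le_pow_right₀ h1R (by omega)
  have e3 : 1 ≤ (1 + R) ^ (K + (n + 1)) := one_le_pow₀ h1R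
  calc C * (1 + R) ^ K + (A * (1 + R) * (R ^ n * b) + I)
      = C * (1 + R) ^ K + (A * b * ((1 + R) * R ^ n) + I * 1) := by ring
    _ ≤ C * (1 + R) ^ (K + (n + 1)) + (A * b * (1 + R) ^ (K + (n + 1)) +
          I * (1 + R) ^ (K + (n + 1))) := by gcongr
    _ = _ := by ring

end Converse

lemma qDensity_eq {m : ℕ} (u : EuclideanSpace ℝ (Fin (2 * m)) → ℝ) :
    qDensity u = negLaplacian^[m] u := by
  ext x
  have hm : 2 * m / 2 = m := by omega
  rw [qDensity, qCurvature, hm, mul_right_comm, ← Real.exp_add, neg_add_cancel, Real.exp_zero,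
    one_mul]
  rfl

lemma isNormalMetric_of_volumeEntropy_lt_top {m : ℕ} (hm : 0 < m)
    {u : EuclideanSpace ℝ (Fin (2 * m)) → ℝ} (hu : ContDiff ℝ ∞ u) (hc : IsCompleteMetric u)
    (hQ : HasFiniteTotalQCurvature u) (hτ : volumeEntropy u < ⊤) : IsNormalMetric u := by
  have hn : 2 ≤ 2 * m := by omega
  have hf : Continuous (qDensity u) := by
    rw [qDensity_eq]
    exact (contDiff_iterate_negLaplacian hu m).continuous
  have hlp := continuous_logPotential hn hf hQ
  obtain ⟨C, K, hC, hgr⟩ := exists_lintegral_ball_exp_le hn hu.continuous hτ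
  obtain ⟨A, L, hA, hgrw⟩ := exists_lintegral_ball_sub_logPotential_le hn hf hQ hu.continuous hC hgr
  obtain ⟨N, a, ha, hw⟩ := exists_continuous_coeff_of_polyharmonic (m := m)
    (w := fun x => u x - logPotential (qDensity u) x) (by simp) (by fun_prop) (fun φ hφ hφs => by
      have hψ := (contDiff_iterate_negLaplacian hφ m).continuous
      have hψs := hasCompactSupport_iterate_negLaplacian hφs m
      simp_rw [sub_mul]
      rw [integral_sub (integrable_mul_of_hasCompactSupport hu.continuous hψ hψs)
        (integrable_mul_of_hasCompactSupport hlp hψ hψs), integral_logPotential_mul hm hf hQ hφ hφs,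
        integral_mul_iterate_negLaplacian hu hφ hφs, qDensity_eq, sub_self]) hA hgrw
  exact ⟨_, eq_logPotential_add_const hn hf hQ hu.continuous hc hgr ha hw⟩

lemma IsNormalMetric.volumeEntropy_eq {m : ℕ} (hm : 0 < m)
    {u : EuclideanSpace ℝ (Fin (2 * m)) → ℝ} (hu : ContDiff ℝ ∞ u) (hc : IsCompleteMetric u)
    (hQ : HasFiniteTotalQCurvature u) (hnorm : IsNormalMetric u) :
    volumeEntropy u = ((1 - alphaZero u : ℝ) : EReal) := by
  have hf : Continuous (qDensity u) := by
    rw [qDensity_eq]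
    exact (contDiff_iterate_negLaplacian hu m).continuous
  obtain ⟨C, hC⟩ := hnorm
  exact volumeEntropy_eq_of_eq_logPotential_add (by omega) hf hQ hu.continuous hc hC

end

end ConformalMetric

end

theorem theorem1p1 (n : ℕ) (hn : 2 ≤ n) (heven : Even n)
    (u : EuclideanSpace ℝ (Fin n) → ℝ) (hu : ContDiff ℝ ∞ u)
    (hcomplete : ConformalMetric.IsCompleteMetric u)
    (hQ : ConformalMetric.HasFiniteTotalQCurvature u) :
    (ConformalMetric.IsNormalMetric u ↔ ConformalMetric.volumeEntropy u < ⊤) ∧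
    (ConformalMetric.volumeEntropy u < ⊤ →
      ConformalMetric.volumeEntropy u = ((1 - ConformalMetric.alphaZero u : ℝ) : EReal)) := by
  obtain ⟨m, rfl⟩ := heven.two_dvd
  have hm : 0 < m := by omega
  have h1 := fun h => ConformalMetric.isNormalMetric_of_volumeEntropy_lt_top hm hu hcomplete hQ h
  have h2 := fun h => ConformalMetric.IsNormalMetric.volumeEntropy_eq hm hu hcomplete hQ h
  exact ⟨⟨fun h => h2 h ▸ EReal.coe_lt_top _, h1⟩, fun h => h2 (h1 h)⟩
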